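/- Let $T=\{t_1,\dots,t_n\}$ be a finite set of tiles, each a finite union of unit squares of the integer lattice that is homeomorphic to a closed disk; tiles may be translated but not rotated. For each $i$ choose a basepoint on the boundary of $t_i$ and let $r_i$ be the word in $x^{\pm1},y^{\pm1}$ read along the clockwise boundary path of $t_i$ from this basepoint ($x$, $x^{-1}$, $y$, $y^{-1}$ for a unit step to the east, west, north, south). Let $\mathcal P=\langle x,y\mid r_1,\dots,r_n\rangle$, let $G$ be the group it presents, and let $X_{\mathcal P}$ be its standard 2-complex: one 0-cell, a 1-cell for each generator, and for each $i$ a 2-cell $c_i$ attached along $r_i$. Let $\pi_2(X_{\mathcal P})$ be the group of spherical pictures over $\mathcal P$ (up to planar isotopy and FLOAT, BRIDGE and FOLD moves), with its left $\mathbb ZG$-module structure, let $H_2(X_{\mathcal P})$ be the second cellular homology group, and let $h:\pi_2(X_{\mathcal P})\to H_2(X_{\mathcal P})$ be the Hurewicz homomorphism, which sends the class of a spherical picture $\mathbb P$ to $\sum_i \exp_{r_i}(\mathbb P)\,c_i$, where $\exp_{r_i}(\mathbb P)$ is the number of disks of $\mathbb P$ labelled $r_i^{+}$ minus the number of disks labelled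 $r_i^{-}$. Let $\mathcal R$ be the family of all regions (finite unions of lattice squares) that are homeomorphic to a closed disk. A tiling of $\Gamma\in\mathcal R$ covers $\Gamma$, without gaps or overlaps, by translates of tiles of $T$. For a tiling $\alpha$ let $b_i(\alpha)$ be the number of copies of $t_i$ used, and let $\mathbb B_\alpha$ be the picture over $\mathcal P$ that is the planar dual of $\alpha$: each copy of $t_i$ gives a disk labelled $r_i^{+}$, each tile edge gives an arc labelled by its letter, and the boundary word is the clockwise boundary word of $\Gamma$ from a chosen boundary basepoint. Let $I\subseteq\bigoplus_{i=1}^n\mathbb Z t_i$ be the subgroup generated by all $\sum_i b_i(\alpha)t_i-\sum_i b_i(\beta)t_i$, and let $J\subseteq\pi_2(X_{\mathcal P})$ be the $\mathbb ZG$-submodule generated by the classes of all spherical pictures $\mathbb B_\alpha\cdot\mathbb B_\beta^{-1}$, where in both cases $\alpha,\beta$ range over all pairs of tilings of a common region $\Gamma\in\mathcal R$ (and $\mathbb B_\alpha,\mathbb B_\beta$ are read from the same basepoint). Then the tile counting group $G(T,\mathcal R)=\bigoplus_{i=1}^n\mathbb Z t_i\,/\,I$ is isomorphic to $H_2(X_{\mathcal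 P})/h(J)$. -/

import Mathlib

open scoped BigOperators

namespace TilePictures

/-! ### Words, and pictures over a group presentation -/

/-- A word in the letters `α` and their formal inverses; `(a, true)` is `a`, `(a, false)` is `a⁻¹`. -/
abbrev Word (α : Type*) := List (α × Bool)

/-- The inverse letter. -/
def inv {α : Type*} (a : α × Bool) : α × Bool := (a.1, !a.2)

/-- The formal inverse of a word (reverse the word and invert each letter). -/
abbrev winv {α : Type*} (w : Word α) : Word α := FreeGroup.invRev w

/-- The elementary pieces of a picture over a presentation with generators `α` and relators
indexed by `ι`: an arc having a minimum, an arc having a maximum, and a based disk labelled by the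
relator `i` with exponent `+1` (`true`) or `-1` (`false`). -/
inductive Atom (α ι : Type*)
  | cup (a : α × Bool) : Atom α ι
  | cap (a : α × Bool) : Atom α ι
  | disk (i : ι) (ε : Bool) : Atom α ι

/-- The label of a disk: the relator or its inverse. -/
def diskWord {α ι : Type*} (r : ι → Word α) (i : ι) (ε : Bool) : Word α :=
  if ε then r i else winv (r i)

/-- The arcs that enter an elementary piece from below. -/
def Atom.src {α ι : Type*} : Atom α ι → Word α
  | .cup _ => []
  | .cap a => [a, inv a]
  | .disk _ _ => []

/-- The arcs that leave an elementary piece upwards. All arcs of a disk leave upwards, its basepoint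
is at the bottom, so that its label, read clockwise from the basepoint, is read from left to
right. -/
def Atom.tgt {α ι : Type*} (r : ι → Word α) : Atom α ι → Word α
  | .cup a => [a, inv a]
  | .cap _ => []
  | .disk i ε => diskWord r i ε

/-- A horizontal slab of a picture that contains exactly one elementary piece, with vertical arcs
`pre` to its left and `post` to its right. A letter `(a, true)` (resp. `(a, false)`) stands for a
vertical arc labelled `a` whose transverse orientation points to the right (resp. left). -/
structure Step (α ι : Type*) where
  pre : Word α
  atom : Atom α ι
  post : Word α

/-- The word read from left to right along the bottom of a slab. -/
def Step.src {α ι : Type*} (s : Step α ι) : Word α := s.pre ++ s.atom.src ++ s.post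

/-- The word read from left to right along the top of a slab. -/
def Step.tgt {α ι : Type*} (r : ι → Word α) (s : Step α ι) : Word α :=
  s.pre ++ s.atom.tgt r ++ s.post

/-- `IsPath r a l b`: the slabs in `l` can be stacked on each other, with bottom word `a` and top
word `b`. -/
def IsPath {α ι : Type*} (r : ι → Word α) : Word α → List (Step α ι) → Word α → Prop
  | a, [], b => a = b
  | a, s :: l, b => a = s.src ∧ IsPath r (s.tgt r) l b

/-- Put vertical arcs `x` to the left and `y` to the right of a slab. -/
def Step.pad {α ι : Type*} (x y : Word α) (s : Step α ι) : Step α ι := ⟨x ++ s.pre, s.atom, s.post ++ y⟩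

/-- Put vertical arcs `x` to the left and `y` to the right of a stack of slabs. -/
def pad {α ι : Type*} (x y : Word α) (l : List (Step α ι)) : List (Step α ι) := l.map (Step.pad x y)

/-- Nested minima: from the word `u v` to the word `u w w⁻¹ v`. -/
def cups {α : Type*} (ι : Type*) : Word α → Word α → Word α → List (Step α ι)
  | _, [], _ => []
  | u, a :: w, v => ⟨u, .cup a, v⟩ :: cups ι (u ++ [a]) w (inv a :: v)

/-- Nested maxima: from the word `u w w⁻¹ v` to the word `u v`. -/
def caps {α : Type*} (ι : Type*) : Word α → Word α → Word α → List (Step α ι)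
  | _, [], _ => []
  | u, a :: w, v => caps ι (u ++ [a]) w (inv a :: v) ++ [⟨u, .cap a, v⟩]

/-- The local moves on stacks of slabs. The first four express planar isotopy: independent pieces
change their heights, an arc is straightened (in two ways), and a disk is rotated by a full turn.
The others are the FLOAT move (a closed arc without anything inside it), the BRIDGE move, and the
FOLD move (two neighbouring disks with the same relator and opposite exponents, all arcs of one
going to the other, the basepoints in the same region). -/
inductive LocalMove {α ι : Type*} (r : ι → Word α) : List (Step α ι) → List (Step α ι) → Prop
  | exchange (u : Word α) (A : Atom α ι) (v : Word α) (B : Atom α ι) (w : Word α) :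
      LocalMove r [⟨u, A, v ++ B.src ++ w⟩, ⟨u ++ A.tgt r ++ v, B, w⟩]
        [⟨u ++ A.src ++ v, B, w⟩, ⟨u, A, v ++ B.tgt r ++ w⟩]
  | straighten_left (u : Word α) (a : α × Bool) (v : Word α) :
      LocalMove r [⟨u, .cup a, a :: v⟩, ⟨u ++ [a], .cap (inv a), v⟩] []
  | straighten_right (u : Word α) (a : α × Bool) (v : Word α) :
      LocalMove r [⟨u ++ [a], .cup (inv a), v⟩, ⟨u, .cap a, a :: v⟩] []
  | rotate (u : Word α) (i : ι) (ε : Bool) (v : Word α) :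
      LocalMove r
        (cups ι u (winv (diskWord r i ε)) v ++
          [⟨u ++ winv (diskWord r i ε), .disk i ε, diskWord r i ε ++ v⟩] ++
          caps ι u (winv (diskWord r i ε)) (diskWord r i ε ++ v))
        [⟨u, .disk i ε, v⟩]
  | float (u : Word α) (a : α × Bool) (v : Word α) :
      LocalMove r [⟨u, .cup a, v⟩, ⟨u, .cap a, v⟩] []
  | bridge (u : Word α) (a : α × Bool) (v : Word α) :
      LocalMove r [⟨u, .cap a, v⟩, ⟨u, .cup a, v⟩] []
  | fold (u : Word α) (i : ι) (ε : Bool) (v : Word α) :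
      LocalMove r
        ([⟨u, .disk i ε, v⟩, ⟨u ++ diskWord r i ε, .disk i (!ε), v⟩] ++
          caps ι u (diskWord r i ε) v) []

/-- Two stacks of slabs with bottom word `a` and top word `b` are locally equivalent if they are
related by finitely many local moves and inverses of local moves, each applied in some slabs and
producing again a stack with bottom word `a` and top word `b`. -/
inductive LocalEquiv {α ι : Type*} (r : ι → Word α) (a b : Word α) :
    List (Step α ι) → List (Step α ι) → Prop
  | move {k m m' l : List (Step α ι)} : LocalMove r m m' →
      IsPath r a (k ++ m ++ l) b → IsPath r a (k ++ m' ++ l) b →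
      LocalEquiv r a b (k ++ m ++ l) (k ++ m' ++ l)
  | refl {l : List (Step α ι)} : IsPath r a l b → LocalEquiv r a b l l
  | symm {l l' : List (Step α ι)} : LocalEquiv r a b l l' → LocalEquiv r a b l' l
  | trans {l l' l'' : List (Step α ι)} :
      LocalEquiv r a b l l' → LocalEquiv r a b l' l'' → LocalEquiv r a b l l''

/-- A picture over the presentation with relators `r`, in general position with respect to the
height and cut into horizontal slabs. The ambient disk is the lower half of a large round disk,
the ambient basepoint is at the bottom, and all arcs that meet its boundary do so on the upper
side, so that the boundary word `word`, read clockwise from the basepoint, is read there from left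
to right. -/
structure Picture {α ι : Type*} (r : ι → Word α) where
  steps : List (Step α ι)
  word : Word α
  valid : IsPath r [] steps word

/-- A picture is spherical if no arc meets the boundary of the ambient disk. -/
def Picture.IsSpherical {α ι : Type*} {r : ι → Word α} (B : Picture r) : Prop := B.word = []

/-- One move between pictures: a planar isotopy, FLOAT, BRIDGE or FOLD in the interior, or the
deletion of a floating arc that hits the boundary of the ambient disk. -/
def Picture.Move {α ι : Type*} {r : ι → Word α} (B D : Picture r) : Prop :=
  (B.word = D.word ∧ LocalEquiv r [] B.word B.steps D.steps) ∨
  ∃ (u : Word α) (a : α × Bool) (v : Word α), D.word = u ++ v ∧ B.steps = D.steps ++ [⟨u, .cup a, v⟩]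

/-- Equivalence of pictures: the equivalence relation generated by the moves. -/
def pictureSetoid {α ι : Type*} (r : ι → Word α) : Setoid (Picture r) :=
  Relation.EqvGen.setoid Picture.Move

/-- The set `Σ` of equivalence classes of pictures. -/
def PictureGroup {α ι : Type*} (r : ι → Word α) := Quotient (pictureSetoid r)

/-! ### Basic facts on stacks of slabs -/

section Basic

variable {α ι : Type*} {r : ι → Word α}

theorem inv_inv (a : α × Bool) : inv (inv a) = a := by simp [inv]

theorem winv_cons (a : α × Bool) (w : Word α) : winv (a :: w) = winv w ++ [inv a] := by
  simp [winv, FreeGroup.invRev, inv]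

theorem isPath_append {a b c : Word α} {l m : List (Step α ι)} (hl : IsPath r a l b)
    (hm : IsPath r b m c) : IsPath r a (l ++ m) c := by
  induction l generalizing a with
  | nil => simp only [IsPath] at hl; subst hl; simpa using hm
  | cons s l ih => exact ⟨hl.1, ih hl.2⟩

theorem isPath_split {a c : Word α} {l m : List (Step α ι)} (h : IsPath r a (l ++ m) c) :
    ∃ b, IsPath r a l b ∧ IsPath r b m c := by
  induction l generalizing a with
  | nil => exact ⟨a, rfl, h⟩
  | cons s l ih =>
    obtain ⟨b, h1, h2⟩ := ih h.2
    exact ⟨b, ⟨h.1, h1⟩, h2⟩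

theorem isPath_unique {a b c : Word α} {l : List (Step α ι)} (hb : IsPath r a l b)
    (hc : IsPath r a l c) : b = c := by
  induction l generalizing a with
  | nil => exact Eq.trans (Eq.symm hb) hc
  | cons s l ih => exact ih hb.2 hc.2

theorem isPath_pad {a b : Word α} {l : List (Step α ι)} (x y : Word α) (h : IsPath r a l b) :
    IsPath r (x ++ a ++ y) (pad x y l) (x ++ b ++ y) := by
  induction l generalizing a with
  | nil => simp only [IsPath] at h; subst h; rfl
  | cons s l ih =>
    refine ⟨?_, ?_⟩
    · rw [h.1]; simp [Step.src, Step.pad]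
    · have := ih h.2
      simpa [Step.tgt, Step.pad, pad] using this

theorem pad_append (x y : Word α) (l m : List (Step α ι)) :
    pad x y (l ++ m) = pad x y l ++ pad x y m := by simp [pad]

theorem pad_pad (x y x' y' : Word α) (l : List (Step α ι)) :
    pad x y (pad x' y' l) = pad (x ++ x') (y' ++ y) l := by
  simp [pad, Step.pad, Function.comp_def]

theorem pad_nil (l : List (Step α ι)) : pad [] [] l = l := by
  induction l with
  | nil => rfl
  | cons s l ih => simp only [pad, List.map_cons] at ih ⊢; rw [ih]; simp [Step.pad]

theorem isPath_cups (u w v : Word α) : IsPath r (u ++ v) (cups ι u w v) (u ++ w ++ winv w ++ v) := by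
  induction w generalizing u v with
  | nil => simp [cups, IsPath, winv]
  | cons a w ih =>
    refine ⟨by simp [Step.src, Atom.src], ?_⟩
    have := ih (u ++ [a]) (inv a :: v)
    simpa [Step.tgt, Atom.tgt, winv_cons] using this

theorem isPath_caps (u w v : Word α) : IsPath r (u ++ w ++ winv w ++ v) (caps ι u w v) (u ++ v) := by
  induction w generalizing u v with
  | nil => simp [caps, IsPath, winv]
  | cons a w ih =>
    have := ih (u ++ [a]) (inv a :: v)
    refine isPath_append (b := u ++ [a] ++ inv a :: v) (by simpa [winv_cons] using this) ?_
    simp [IsPath, Step.src, Step.tgt, Atom.src, Atom.tgt]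

theorem pad_cups (x y u w v : Word α) :
    pad x y (cups ι u w v) = cups ι (x ++ u) w (v ++ y) := by
  induction w generalizing u v with
  | nil => rfl
  | cons a w ih =>
    have := ih (u ++ [a]) (inv a :: v)
    simp only [cups, pad, List.map_cons, Step.pad] at this ⊢
    rw [this]; simp

theorem pad_caps (x y u w v : Word α) :
    pad x y (caps ι u w v) = caps ι (x ++ u) w (v ++ y) := by
  induction w generalizing u v with
  | nil => rfl
  | cons a w ih =>
    have := ih (u ++ [a]) (inv a :: v)
    simp only [caps, pad, List.map_append, List.map_cons, List.map_nil, Step.pad] at this ⊢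
    rw [this]; simp

theorem cups_append (u w w' v : Word α) :
    cups ι u (w ++ w') v = cups ι u w v ++ cups ι (u ++ w) w' (winv w ++ v) := by
  induction w generalizing u v with
  | nil => simp [cups, winv]
  | cons a w ih => simp [cups, ih, winv_cons]

theorem localMove_pad (x y : Word α) {m m' : List (Step α ι)} (h : LocalMove r m m') :
    LocalMove r (pad x y m) (pad x y m') := by
  cases h with
  | exchange u A v B w =>
    simpa [pad, Step.pad] using LocalMove.exchange (r := r) (x ++ u) A v B (w ++ y)
  | straighten_left u a v =>
    simpa [pad, Step.pad] using LocalMove.straighten_left (r := r) (x ++ u) a (v ++ y)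
  | straighten_right u a v =>
    simpa [pad, Step.pad] using LocalMove.straighten_right (r := r) (x ++ u) a (v ++ y)
  | rotate u i ε v =>
    have := LocalMove.rotate (r := r) (x ++ u) i ε (v ++ y)
    rw [pad_append, pad_append, pad_cups, pad_caps]
    simpa [pad, Step.pad] using this
  | float u a v => simpa [pad, Step.pad] using LocalMove.float (r := r) (x ++ u) a (v ++ y)
  | bridge u a v => simpa [pad, Step.pad] using LocalMove.bridge (r := r) (x ++ u) a (v ++ y)
  | fold u i ε v =>
    have := LocalMove.fold (r := r) (x ++ u) i ε (v ++ y)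
    rw [pad_append, pad_caps]
    simpa [pad, Step.pad] using this

theorem LocalEquiv.isPath {a b : Word α} {l l' : List (Step α ι)} (h : LocalEquiv r a b l l') :
    IsPath r a l b ∧ IsPath r a l' b := by
  induction h with
  | move _ h1 h2 => exact ⟨h1, h2⟩
  | refl h => exact ⟨h, h⟩
  | symm _ ih => exact ⟨ih.2, ih.1⟩
  | trans _ _ ih1 ih2 => exact ⟨ih1.1, ih2.2⟩

theorem LocalEquiv.context {a b c d : Word α} {k l m m' : List (Step α ι)} (hk : IsPath r a k c)
    (h : LocalEquiv r c d m m') (hl : IsPath r d l b) :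
    LocalEquiv r a b (k ++ m ++ l) (k ++ m' ++ l) := by
  induction h with
  | @move k' m m' l' h h1 h2 =>
    have := LocalEquiv.move (k := k ++ k') (l := l' ++ l) h
      (by simpa using isPath_append hk (isPath_append h1 hl))
      (by simpa using isPath_append hk (isPath_append h2 hl))
    simpa using this
  | refl h => exact .refl (isPath_append (isPath_append hk h) hl)
  | symm _ ih => exact .symm ih
  | trans _ _ ih1 ih2 => exact .trans ih1 ih2

theorem LocalEquiv.left {a b c : Word α} {k m m' : List (Step α ι)} (hk : IsPath r a k c)
    (h : LocalEquiv r c b m m') : LocalEquiv r a b (k ++ m) (k ++ m') := by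
  simpa using LocalEquiv.context hk h (show IsPath r b [] b from rfl)

theorem LocalEquiv.right {a b c : Word α} {l m m' : List (Step α ι)}
    (h : LocalEquiv r a c m m') (hl : IsPath r c l b) : LocalEquiv r a b (m ++ l) (m' ++ l) := by
  simpa using LocalEquiv.context (show IsPath r a [] a from rfl) h hl

theorem LocalEquiv.of_move {a b : Word α} {m m' : List (Step α ι)} (h : LocalMove r m m')
    (h1 : IsPath r a m b) (h2 : IsPath r a m' b) : LocalEquiv r a b m m' := by
  simpa using LocalEquiv.move (k := []) (l := []) h (by simpa using h1) (by simpa using h2)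

theorem LocalEquiv.pad (x y : Word α) {a b : Word α} {l l' : List (Step α ι)}
    (h : LocalEquiv r a b l l') :
    LocalEquiv r (x ++ a ++ y) (x ++ b ++ y) (TilePictures.pad x y l) (TilePictures.pad x y l') := by
  induction h with
  | move h h1 h2 =>
    have h1 := isPath_pad x y h1
    have h2 := isPath_pad x y h2
    simp only [pad_append] at h1 h2 ⊢
    exact .move (localMove_pad x y h) h1 h2
  | refl h => exact .refl (isPath_pad x y h)
  | symm _ ih => exact .symm ih
  | trans _ _ ih1 ih2 => exact .trans ih1 ih2

theorem isPath_singleton (u : Word α) (A : Atom α ι) (v : Word α) :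
    IsPath r (u ++ A.src ++ v) [⟨u, A, v⟩] (u ++ A.tgt r ++ v) := ⟨rfl, rfl⟩

/-- A piece can be moved past a stack of slabs to its right. -/
theorem exchange_path (u : Word α) (A : Atom α ι) (v : Word α) {c c' : Word α}
    {M : List (Step α ι)} (hM : IsPath r c M c') :
    LocalEquiv r (u ++ A.src ++ v ++ c) (u ++ A.tgt r ++ v ++ c')
      (⟨u, A, v ++ c⟩ :: pad (u ++ A.tgt r ++ v) [] M)
      (pad (u ++ A.src ++ v) [] M ++ [⟨u, A, v ++ c'⟩]) := by
  induction M generalizing c with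
  | nil =>
    simp only [IsPath] at hM; subst hM
    have := isPath_singleton (r := r) u A (v ++ c)
    exact .refl (by simpa [pad] using this)
  | cons s M ih =>
    obtain ⟨p, B, q⟩ := s
    obtain ⟨h1, h2⟩ := hM
    simp only [Step.src] at h1
    subst h1
    have ih := ih h2
    simp only [Step.tgt] at ih h2
    have e := LocalMove.exchange (r := r) u A (v ++ p) B q
    have e1 : LocalEquiv r (u ++ A.src ++ v ++ (p ++ B.src ++ q)) (u ++ A.tgt r ++ v ++ (p ++ B.tgt r ++ q))
        [⟨u, A, v ++ (p ++ B.src ++ q)⟩, ⟨u ++ A.tgt r ++ (v ++ p), B, q⟩]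
        [⟨u ++ A.src ++ (v ++ p), B, q⟩, ⟨u, A, v ++ (p ++ B.tgt r ++ q)⟩] := by
      refine .of_move (by simpa using e) ?_ ?_
      · simp [IsPath, Step.src, Step.tgt]
      · simp [IsPath, Step.src, Step.tgt]
    have e2 := e1.right (isPath_pad (u ++ A.tgt r ++ v) [] h2 |> fun h => by simpa using h)
    have e3 := LocalEquiv.left (a := u ++ A.src ++ v ++ (p ++ B.src ++ q))
      (k := [⟨u ++ A.src ++ (v ++ p), B, q⟩]) (by simp [IsPath, Step.src, Step.tgt]) ih
    have e4 := LocalEquiv.trans (by simpa using e2) (by simpa using e3)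
    simpa [pad, Step.pad] using e4

/-- Two stacks of slabs that stand side by side can change their heights. -/
theorem exchange_paths {a a' c c' : Word α} {L M : List (Step α ι)} (hL : IsPath r a L a')
    (hM : IsPath r c M c') :
    LocalEquiv r (a ++ c) (a' ++ c') (pad [] c L ++ pad a' [] M) (pad a [] M ++ pad [] c' L) := by
  induction L generalizing a with
  | nil =>
    simp only [IsPath] at hL; subst hL
    have h := isPath_pad a [] hM
    simp only [List.append_nil] at h
    simpa [pad] using LocalEquiv.refl h
  | cons s L ih =>
    obtain ⟨u, A, v⟩ := s
    obtain ⟨h1, h2⟩ := hL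
    simp only [Step.src] at h1
    subst h1
    have ih := ih h2
    simp only [Step.tgt] at ih h2
    have e1 := exchange_path (r := r) u A v hM
    have e2 := e1.right (by simpa using isPath_pad [] c' h2)
    have e3 := LocalEquiv.left (a := u ++ A.src ++ v ++ c)
      (k := [⟨u, A, v ++ c⟩]) (by simp [IsPath, Step.src, Step.tgt]) ih
    have e4 := LocalEquiv.trans (by simpa using e3) (by simpa using e2)
    simpa [pad, Step.pad] using e4

/-- The picture, turned upside down, of a slab. -/
def Step.undo (r : ι → Word α) : Step α ι → List (Step α ι)
  | ⟨u, .cup a, v⟩ => [⟨u, .cap a, v⟩]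
  | ⟨u, .cap a, v⟩ => [⟨u, .cup a, v⟩]
  | ⟨u, .disk i ε, v⟩ => ⟨u ++ diskWord r i ε, .disk i (!ε), v⟩ :: caps ι u (diskWord r i ε) v

/-- A stack of slabs that undoes the stack `l`: it is turned upside down, and the signs of its
disks are changed. -/
def undo (r : ι → Word α) : List (Step α ι) → List (Step α ι)
  | [] => []
  | s :: l => undo r l ++ s.undo r

theorem diskWord_not (i : ι) (ε : Bool) : diskWord r i (!ε) = winv (diskWord r i ε) := by
  cases ε <;> simp [diskWord, winv, FreeGroup.invRev_invRev]

theorem step_undo (s : Step α ι) :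
    IsPath r (s.tgt r) (s.undo r) s.src ∧ LocalEquiv r s.src s.src (s :: s.undo r) [] := by
  obtain ⟨u, A, v⟩ := s
  cases A with
  | cup a =>
    have h : IsPath r (u ++ [a, inv a] ++ v) [⟨u, .cap a, v⟩] (u ++ [] ++ v) :=
      isPath_singleton (r := r) (ι := ι) u (.cap a) v
    exact ⟨h, .of_move (LocalMove.float u a v) ⟨rfl, h⟩ rfl⟩
  | cap a =>
    have h : IsPath r (u ++ [] ++ v) [⟨u, .cup a, v⟩] (u ++ [a, inv a] ++ v) :=
      isPath_singleton (r := r) (ι := ι) u (.cup a) v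
    exact ⟨h, .of_move (LocalMove.bridge u a v) ⟨rfl, h⟩ rfl⟩
  | disk i ε =>
    have h : IsPath r (u ++ diskWord r i ε ++ v)
        (⟨u ++ diskWord r i ε, .disk i (!ε), v⟩ :: caps ι u (diskWord r i ε) v) (u ++ [] ++ v) := by
      refine ⟨by simp [Step.src, Atom.src], ?_⟩
      have := isPath_caps (r := r) (ι := ι) u (diskWord r i ε) v
      simpa [Step.tgt, Atom.tgt, diskWord_not] using this
    exact ⟨h, .of_move (LocalMove.fold u i ε v) ⟨rfl, h⟩ rfl⟩

theorem isPath_undo {a b : Word α} {l : List (Step α ι)} (h : IsPath r a l b) :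
    IsPath r b (undo r l) a := by
  induction l generalizing a with
  | nil => exact Eq.symm h
  | cons s l ih =>
    refine isPath_append (ih h.2) ?_
    rw [h.1]
    exact (step_undo s).1

theorem append_undo {a b : Word α} {l : List (Step α ι)} (h : IsPath r a l b) :
    LocalEquiv r a a (l ++ undo r l) [] := by
  induction l generalizing a with
  | nil => exact .refl rfl
  | cons s l ih =>
    have e := LocalEquiv.context (k := [s]) (a := a) (by exact ⟨h.1, rfl⟩) (ih h.2)
      (l := s.undo r) (b := a) (by rw [h.1]; exact (step_undo s).1)
    have e2 := (step_undo (r := r) s).2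
    rw [← h.1] at e2
    exact .trans (by simpa [undo] using e) (by simpa using e2)

theorem undo_append {a b : Word α} {l : List (Step α ι)} (h : IsPath r a l b) :
    LocalEquiv r b b (undo r l ++ l) [] := by
  have h' := isPath_undo h
  have h'' := isPath_undo h'
  have e1 := append_undo h
  have e2 := append_undo h'
  have e3 := (e1.right h'').symm
  have e4 := LocalEquiv.left h e2
  have e5 : LocalEquiv r a b (undo r (undo r l)) l :=
    .trans (by simpa using e3) (by simpa using e4)
  exact .trans (LocalEquiv.left h' e5).symm e2

end Basic


/-! ### The group of pictures -/

section PictureGroupSection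

variable {α ι : Type*} {r : ι → Word α}

theorem eq_of_move {β : Sort*} (f : Picture r → β) (hf : ∀ B D, Picture.Move B D → f B = f D)
    (B D : Picture r) (h : (pictureSetoid r).r B D) : f B = f D := by
  induction h with
  | rel B D h => exact hf B D h
  | refl B => rfl
  | symm B D _ ih => exact ih.symm
  | trans B C D _ _ ih1 ih2 => exact ih1.trans ih2

/-- The class of a picture. -/
def Picture.cls (B : Picture r) : PictureGroup r := Quotient.mk (pictureSetoid r) B

theorem cls_eq_of_move {B D : Picture r} (h : Picture.Move B D) : B.cls = D.cls :=
  Quotient.sound (Relation.EqvGen.rel B D h)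

theorem cls_eq_of_local {B D : Picture r} {w : Word α} (h : LocalEquiv r [] w B.steps D.steps) :
    B.cls = D.cls := by
  have h1 : w = B.word := isPath_unique h.isPath.1 B.valid
  have h2 : w = D.word := isPath_unique h.isPath.2 D.valid
  subst h1
  exact cls_eq_of_move (Or.inl ⟨h2, h⟩)

/-- A slab without a disk. -/
def Step.NoDisk (s : Step α ι) : Prop := ∀ i ε, s.atom ≠ .disk i ε

theorem noDisk_cups (u w v : Word α) : ∀ s ∈ cups ι u w v, s.NoDisk := by
  induction w generalizing u v with
  | nil => simp [cups]
  | cons a w ih =>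
    intro s hs
    simp only [cups, List.mem_cons] at hs
    rcases hs with rfl | hs
    · intro i ε; simp
    · exact ih _ _ s hs

theorem noDisk_caps (u w v : Word α) : ∀ s ∈ caps ι u w v, s.NoDisk := by
  induction w generalizing u v with
  | nil => simp [caps]
  | cons a w ih =>
    intro s hs
    simp only [caps, List.mem_append, List.mem_singleton] at hs
    rcases hs with hs | rfl
    · exact ih _ _ s hs
    · intro i ε; simp

/-- Arcs near the boundary of the ambient disk can be added and removed. -/
theorem cls_append_noDisk {B D : Picture r} {m : List (Step α ι)} (hm : ∀ s ∈ m, s.NoDisk)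
    (h : D.steps = B.steps ++ m) : D.cls = B.cls := by
  induction m generalizing B with
  | nil =>
    refine cls_eq_of_local (w := D.word) ?_
    rw [← List.append_nil B.steps, ← h]
    exact .refl D.valid
  | cons s m ih =>
    have hv := D.valid
    rw [h] at hv
    obtain ⟨b, hb1, hb2⟩ := isPath_split hv
    have hb : b = B.word := isPath_unique hb1 B.valid
    subst hb
    obtain ⟨hs, hb3⟩ := hb2
    have hv' : IsPath r [] (B.steps ++ [s]) (s.tgt r) := isPath_append hb1 ⟨hs, rfl⟩
    have key := ih (B := ⟨B.steps ++ [s], s.tgt r, hv'⟩) (fun t ht => hm t (List.mem_cons_of_mem _ ht))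
      (by simp [h])
    rw [key]
    obtain ⟨u, A, v⟩ := s
    cases A with
    | cup a =>
      refine cls_eq_of_move (Or.inr ⟨u, a, v, ?_, rfl⟩)
      simpa [Step.src, Atom.src] using hs
    | cap a =>
      have hv2 : IsPath r [] ((B.steps ++ [⟨u, .cap a, v⟩]) ++ [⟨u, .cup a, v⟩]) B.word := by
        refine isPath_append hv' ⟨by simp [Step.src, Step.tgt, Atom.src, Atom.tgt], ?_⟩
        rw [hs]; rfl
      have e1 : Picture.cls (r := r) ⟨_, _, hv2⟩ = Picture.cls ⟨_, _, hv'⟩ := by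
        refine cls_eq_of_move (Or.inr ⟨u, a, v, ?_, rfl⟩)
        simp [Step.tgt, Atom.tgt]
      rw [← e1]
      refine cls_eq_of_local (w := B.word) ?_
      have e2 := LocalEquiv.left B.valid (LocalEquiv.of_move (r := r) (a := B.word) (b := B.word)
        (LocalMove.bridge u a v) ?_ rfl)
      · simpa using e2
      · rw [hs]
        exact ⟨rfl, by simp [IsPath, Step.src, Step.tgt, Atom.src, Atom.tgt]⟩
    | disk i ε => exact absurd rfl (hm _ (List.mem_cons_self) i ε)

/-- The empty picture. -/
def Picture.empty (r : ι → Word α) : Picture r := ⟨[], [], rfl⟩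

/-- The product of two pictures: `D` is put to the right of `B`. -/
def Picture.mul (B D : Picture r) : Picture r :=
  ⟨B.steps ++ pad B.word [] D.steps, B.word ++ D.word,
    isPath_append B.valid (by simpa using isPath_pad B.word [] D.valid)⟩

/-- A picture that represents the inverse of the class of `B`: it is `B` turned upside down
with the signs of its disks changed, its boundary arcs being bent upwards. -/
def Picture.inverse (B : Picture r) : Picture r :=
  ⟨cups ι [] (winv B.word) [] ++ pad (winv B.word) [] (undo r B.steps), winv B.word,
    isPath_append (b := winv B.word ++ B.word)
      (by simpa [winv, FreeGroup.invRev_invRev] using isPath_cups (r := r) (ι := ι) [] (winv B.word) [])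
      (by simpa using isPath_pad (winv B.word) [] (isPath_undo B.valid))⟩

/-- The picture `w · D`: the ambient basepoint of `D` is surrounded by arcs that spell `w`. -/
def Picture.act (w : Word α) (D : Picture r) : Picture r :=
  ⟨cups ι [] w [] ++ pad w (winv w) D.steps, w ++ D.word ++ winv w,
    isPath_append (b := w ++ [] ++ winv w)
      (by simpa using isPath_cups (r := r) (ι := ι) [] w [])
      (isPath_pad w (winv w) D.valid)⟩

theorem cls_mul_left (B : Picture r) {D D' : Picture r} (h : Picture.Move D D') :
    (B.mul D).cls = (B.mul D').cls := by
  rcases h with ⟨hw, h⟩ | ⟨u, a, v, hw, h⟩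
  · have e := LocalEquiv.left B.valid (by simpa using h.pad B.word [])
    exact cls_eq_of_local e
  · refine cls_append_noDisk (m := pad B.word [] [⟨u, .cup a, v⟩]) ?_ ?_
    · intro s hs i ε
      simp only [pad, List.map_cons, List.map_nil, List.mem_singleton] at hs
      subst hs; simp [Step.pad]
    · simp [Picture.mul, h, pad_append]

theorem cls_mul_right {B B' : Picture r} (D : Picture r) (h : Picture.Move B B') :
    (B.mul D).cls = (B'.mul D).cls := by
  rcases h with ⟨hw, h⟩ | ⟨u, a, v, hw, h⟩
  · have e := LocalEquiv.right h (b := B.word ++ D.word)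
      (l := pad B.word [] D.steps) (by simpa using isPath_pad B.word [] D.valid)
    refine cls_eq_of_local (w := B.word ++ D.word) ?_
    have : (B'.mul D).steps = B'.steps ++ pad B.word [] D.steps := by simp [Picture.mul, hw]
    rw [this]; exact e
  · have hv := B.valid
    rw [h] at hv
    obtain ⟨b, hb1, hb2⟩ := isPath_split hv
    have hB : B.word = u ++ (Atom.cup a : Atom α ι).tgt r ++ v := hb2.2.symm
    have e1 := exchange_path (r := r) u (.cup a) v D.valid
    have e2 := LocalEquiv.left (a := []) (k := B'.steps) (by
      have := B'.valid
      rw [hw] at this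
      simpa [Atom.src] using this) e1
    have hp := e2.isPath.2
    have e3 : (B.mul D).cls = Picture.cls ⟨_, _, hp⟩ := by
      refine cls_eq_of_local (w := u ++ (Atom.cup a : Atom α ι).tgt r ++ v ++ D.word) ?_
      have : (B.mul D).steps = B'.steps ++ (⟨u, .cup a, v⟩ ::
          pad (u ++ (Atom.cup a : Atom α ι).tgt r ++ v) [] D.steps) := by
        simp [Picture.mul, h, hB]
      rw [this]
      simpa using e2
    rw [e3]
    refine cls_append_noDisk (m := [⟨u, .cup a, v ++ D.word⟩]) ?_ ?_
    · intro s hs i ε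
      simp only [List.mem_singleton] at hs
      subst hs; simp
    · simp [Picture.mul, hw, Atom.src]

instance : Mul (PictureGroup r) :=
  ⟨Quotient.lift₂ (fun B D => (B.mul D).cls) (fun B D B' D' h h' =>
    (eq_of_move (fun X => (X.mul D).cls) (fun _ _ hm => cls_mul_right D hm) B B' h).trans
      (eq_of_move (fun X => (B'.mul X).cls) (fun _ _ hm => cls_mul_left B' hm) D D' h'))⟩

instance : One (PictureGroup r) := ⟨(Picture.empty r).cls⟩

theorem cls_mul (B D : Picture r) : B.cls * D.cls = (B.mul D).cls := rfl

theorem one_def : (1 : PictureGroup r) = (Picture.empty r).cls := rfl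

theorem picture_ext {B D : Picture r} (h : B.steps = D.steps) : B = D := by
  obtain ⟨l, w, hB⟩ := B
  obtain ⟨l', w', hD⟩ := D
  dsimp only at h
  subst h
  have := isPath_unique hB hD
  subst this
  rfl

theorem pg_mul_assoc (a b c : PictureGroup r) : a * b * c = a * (b * c) := by
  induction a using Quotient.inductionOn with | _ A
  induction b using Quotient.inductionOn with | _ B
  induction c using Quotient.inductionOn with | _ C
  change ((A.mul B).mul C).cls = (A.mul (B.mul C)).cls
  congr 1
  exact picture_ext (by simp [Picture.mul, pad_append, pad_pad])

theorem pg_one_mul (a : PictureGroup r) : 1 * a = a := by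
  induction a using Quotient.inductionOn with | _ A
  change ((Picture.empty r).mul A).cls = A.cls
  congr 1
  exact picture_ext (by simp [Picture.mul, Picture.empty, pad_nil])

theorem pg_inv_mul (B : Picture r) : B.inverse.cls * B.cls = 1 := by
  rw [cls_mul]
  have h1 : IsPath r [] (cups ι [] (winv B.word) []) (winv B.word ++ B.word) := by
    simpa [winv, FreeGroup.invRev_invRev] using isPath_cups (r := r) (ι := ι) [] (winv B.word) []
  have e1 := LocalEquiv.left h1 (by simpa using (undo_append B.valid).pad (winv B.word) [])
  have e2 : (B.inverse.mul B).cls = Picture.cls ⟨_, _, h1⟩ := by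
    refine cls_eq_of_local (w := winv B.word ++ B.word) ?_
    have : (B.inverse.mul B).steps =
        cups ι [] (winv B.word) [] ++ pad (winv B.word) [] (undo r B.steps ++ B.steps) := by
      simp [Picture.mul, Picture.inverse, pad_append]
    rw [this]
    simpa [pad] using e1
  rw [e2]
  exact cls_append_noDisk (noDisk_cups [] (winv B.word) []) (by simp [Picture.empty])

theorem inverse_congr (B D : Picture r) (h : (pictureSetoid r).r B D) :
    B.inverse.cls = D.inverse.cls := by
  have hBD : B.cls = D.cls := Quotient.sound h
  have right (X : Picture r) : X.cls * X.inverse.cls = 1 := by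
    have h1 := pg_inv_mul X
    have h2 := pg_inv_mul X.inverse
    calc X.cls * X.inverse.cls
        = X.inverse.inverse.cls * X.inverse.cls * (X.cls * X.inverse.cls) := by rw [h2, pg_one_mul]
      _ = X.inverse.inverse.cls * (X.inverse.cls * X.cls * X.inverse.cls) := by
          simp only [pg_mul_assoc]
      _ = 1 := by rw [h1, pg_one_mul, h2]
  have mul_one (a : PictureGroup r) : a * 1 = a := by
    induction a using Quotient.inductionOn with | _ A
    change (A.mul (Picture.empty r)).cls = A.cls
    congr 1
    exact picture_ext (by simp [Picture.mul, Picture.empty, pad])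
  calc B.inverse.cls = B.inverse.cls * (D.cls * D.inverse.cls) := by rw [right, mul_one]
    _ = B.inverse.cls * B.cls * D.inverse.cls := by rw [← hBD, pg_mul_assoc]
    _ = D.inverse.cls := by rw [pg_inv_mul, pg_one_mul]

instance : Inv (PictureGroup r) := ⟨Quotient.lift (fun B => B.inverse.cls) inverse_congr⟩

theorem cls_inv (B : Picture r) : (B.cls)⁻¹ = B.inverse.cls := rfl

/-- The group `Σ` of pictures. -/
instance : Group (PictureGroup r) :=
  Group.ofLeftAxioms pg_mul_assoc pg_one_mul
    (fun a => Quotient.inductionOn a fun B => pg_inv_mul B)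

/-- The group of spherical pictures, `π₂` of the standard 2-complex of the presentation. -/
def sphericalGroup (r : ι → Word α) : Subgroup (PictureGroup r) where
  carrier := {σ | ∃ P : Picture r, P.IsSpherical ∧ P.cls = σ}
  one_mem' := ⟨Picture.empty r, rfl, rfl⟩
  mul_mem' := by
    rintro _ _ ⟨P, hP, rfl⟩ ⟨Q, hQ, rfl⟩
    refine ⟨P.mul Q, ?_, rfl⟩
    simp only [Picture.IsSpherical] at hP hQ
    simp [Picture.IsSpherical, Picture.mul, hP, hQ]
  inv_mem' := by
    rintro _ ⟨P, hP, rfl⟩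
    refine ⟨P.inverse, ?_, rfl⟩
    simp only [Picture.IsSpherical] at hP
    simp [Picture.IsSpherical, Picture.inverse, hP, winv]

/-! ### The action of the presented group on the spherical pictures -/

theorem mul_comm_of_spherical {P : Picture r} (hP : P.IsSpherical) (D : Picture r) :
    P.cls * D.cls = D.cls * P.cls := by
  have hv := P.valid
  rw [show P.word = [] from hP] at hv
  have e := exchange_paths (r := r) D.valid hv
  rw [cls_mul, cls_mul]
  refine (cls_eq_of_local (w := D.word ++ []) ?_).symm
  have h1 : (D.mul P).steps = pad [] [] D.steps ++ pad D.word [] P.steps := by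
    simp [Picture.mul, pad_nil]
  have h2 : (P.mul D).steps = pad [] [] P.steps ++ pad [] [] D.steps := by
    simp [Picture.mul, pad_nil, show P.word = [] from hP]
  rw [h1, h2]
  exact e

instance : CommGroup (sphericalGroup r) where
  mul_comm := by
    rintro ⟨_, P, hP, rfl⟩ ⟨_, Q, hQ, rfl⟩
    exact Subtype.ext (mul_comm_of_spherical hP Q)

theorem cls_act_congr (w : Word α) (B D : Picture r) (h : Picture.Move B D) :
    (B.act w).cls = (D.act w).cls := by
  have hc : IsPath r [] (cups ι [] w []) (w ++ [] ++ winv w) := by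
    simpa using isPath_cups (r := r) (ι := ι) [] w []
  rcases h with ⟨hw, h⟩ | ⟨u, a, v, hw, h⟩
  · exact cls_eq_of_local (LocalEquiv.left hc (h.pad w (winv w)))
  · refine cls_append_noDisk (m := pad w (winv w) [⟨u, .cup a, v⟩]) ?_ ?_
    · intro s hs i ε
      simp only [pad, List.map_cons, List.map_nil, List.mem_singleton] at hs
      subst hs; simp [Step.pad]
    · simp [Picture.act, h, pad_append]

/-- The map `[D] ↦ [w · D]` on classes of pictures. -/
def actCls (w : Word α) : PictureGroup r → PictureGroup r :=
  Quotient.lift (fun D => (D.act w).cls) (eq_of_move _ (cls_act_congr w))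

theorem actCls_cls (w : Word α) (D : Picture r) : actCls w D.cls = (D.act w).cls := rfl

theorem actCls_nil (σ : PictureGroup r) : actCls [] σ = σ := by
  induction σ using Quotient.inductionOn with | _ D
  change (D.act []).cls = D.cls
  congr 1
  exact picture_ext (by simp [Picture.act, cups, winv, pad_nil])

theorem actCls_append (w w' : Word α) (σ : PictureGroup r) :
    actCls (w ++ w') σ = actCls w (actCls w' σ) := by
  induction σ using Quotient.inductionOn with | _ D
  change (D.act (w ++ w')).cls = ((D.act w').act w).cls
  congr 1
  exact picture_ext (by
    simp [Picture.act, cups_append, pad_append, pad_cups, pad_pad, winv, FreeGroup.invRev_append])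

theorem actCls_inv (a : α × Bool) (σ : PictureGroup r) : actCls [a, inv a] σ = σ := by
  induction σ using Quotient.inductionOn with | _ D
  change (D.act [a, inv a]).cls = D.cls
  have hw : winv [a, inv a] = [a, inv a] := by simp [winv, FreeGroup.invRev, inv]
  have hM : IsPath r [a, inv a] (pad [] [a, inv a] D.steps) (D.word ++ [a, inv a]) := by
    simpa using isPath_pad [] [a, inv a] D.valid
  have hcup : IsPath r [] [(⟨[], .cup a, []⟩ : Step α ι)] [a, inv a] :=
    isPath_singleton (r := r) (ι := ι) [] (.cup a) []
  have hcups : IsPath r [] (cups ι [] [a, inv a] []) [a, inv a, a, inv a] := by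
    have := isPath_cups (r := r) (ι := ι) [] [a, inv a] []
    rw [hw] at this
    exact this
  have e1 := (exchange_path (r := r) [] (.cap a) [] hM).symm.left (k := cups ι [] [a, inv a] [])
    (a := []) hcups
  have hX := e1.isPath.1
  have c1 : Picture.cls ⟨_, _, hX⟩ = (D.act [a, inv a]).cls := by
    refine cls_append_noDisk (m := [⟨[], .cap a, D.word ++ [a, inv a]⟩]) ?_ ?_
    · intro s hs i ε
      simp only [List.mem_singleton] at hs
      subst hs; simp
    · simp [Picture.act, hw, Atom.src, pad_pad]
  have e2 : LocalEquiv r [a, inv a] [a, inv a]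
      [⟨[a], .cup (inv a), [inv a]⟩, ⟨[], .cap a, [a, inv a]⟩] [] := by
    refine .of_move (LocalMove.straighten_right [] a [inv a]) ?_ rfl
    simp [IsPath, Step.src, Step.tgt, Atom.src, Atom.tgt, inv_inv]
  have e3 := LocalEquiv.context hcup e2 hM
  have e4 := (exchange_paths (r := r) D.valid hcup).symm
  have e5 : LocalEquiv r [] (D.word ++ [a, inv a])
      (cups ι [] [a, inv a] [] ++ (pad [a, inv a] [] (pad [] [a, inv a] D.steps) ++
        [⟨[], .cap a, D.word ++ [a, inv a]⟩]))
      (D.steps ++ [⟨D.word, .cup a, []⟩]) := by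
    refine .trans (by simpa [Atom.src, Atom.tgt] using e1) (.trans (l' := [⟨[], .cup a, []⟩] ++
      pad [] [a, inv a] D.steps) ?_ ?_)
    · simpa [cups, pad_nil] using e3
    · have h1 : pad [] [] D.steps = D.steps := pad_nil _
      rw [h1] at e4
      simpa [pad, Step.pad] using e4
  have c2 : Picture.cls ⟨_, _, hX⟩ = Picture.cls ⟨_, _, e5.isPath.2⟩ :=
    cls_eq_of_local (w := D.word ++ [a, inv a]) (by simpa [Atom.src, Atom.tgt] using e5)
  rw [← c1, c2]
  refine cls_append_noDisk (m := [⟨D.word, .cup a, []⟩]) ?_ rfl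
  intro s hs i ε
  simp only [List.mem_singleton] at hs
  subst hs; simp

theorem actCls_letter_mul (a : α × Bool) (σ τ : PictureGroup r) :
    actCls [a] (σ * τ) = actCls [a] σ * actCls [a] τ := by
  induction σ using Quotient.inductionOn with | _ B
  induction τ using Quotient.inductionOn with | _ D
  change ((B.mul D).act [a]).cls = ((B.act [a]).mul (D.act [a])).cls
  have hw : winv [a] = [inv a] := by simp [winv, FreeGroup.invRev, inv]
  have hM : IsPath r [inv a] (pad [] [inv a] D.steps) (D.word ++ [inv a]) := by
    simpa using isPath_pad [] [inv a] D.valid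
  have hB : IsPath r [] (B.act [a]).steps ([a] ++ B.word ++ [inv a]) := by
    have := (B.act [a]).valid
    simpa [Picture.act, hw] using this
  have hk : IsPath r [] ((B.act [a]).steps ++ [⟨[a] ++ B.word ++ [inv a], .cup a, []⟩])
      ([a] ++ B.word ++ [inv a, a] ++ [inv a]) := by
    refine isPath_append hB ?_
    simp [IsPath, Step.src, Step.tgt, Atom.src, Atom.tgt]
  have e1 := (exchange_path (r := r) ([a] ++ B.word) (.cap (inv a)) [] hM).symm.left
    (k := (B.act [a]).steps ++ [⟨[a] ++ B.word ++ [inv a], .cup a, []⟩])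
    (a := []) (by simpa [Atom.src, inv_inv] using hk)
  have hX := e1.isPath.1
  have c1 : Picture.cls ⟨_, _, hX⟩ = ((B.act [a]).mul (D.act [a])).cls := by
    refine cls_append_noDisk (m := [⟨[a] ++ B.word, .cap (inv a), D.word ++ [inv a]⟩]) ?_ ?_
    · intro s hs i ε
      simp only [List.mem_singleton] at hs
      subst hs; simp
    · have h3 : pad (a :: (B.word ++ [inv a])) []
          ((⟨[], .cup a, []⟩ : Step α ι) :: pad [a] [inv a] D.steps) =
          ⟨a :: (B.word ++ [inv a]), .cup a, []⟩ ::
            pad (a :: (B.word ++ [inv a])) [] (pad [a] [inv a] D.steps) := by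
        simp [pad, Step.pad]
      simp only [pad_pad] at h3
      simp [Picture.mul, Picture.act, hw, Atom.src, pad_pad, inv_inv, cups, h3]
  have e2 : LocalEquiv r ([a] ++ B.word ++ [inv a]) ([a] ++ B.word ++ [inv a])
      [⟨[a] ++ B.word ++ [inv a], .cup a, []⟩, ⟨[a] ++ B.word, .cap (inv a), [inv a]⟩] [] := by
    have h := LocalMove.straighten_right (r := r) ([a] ++ B.word) (inv a) []
    rw [inv_inv] at h
    refine .of_move h ?_ rfl
    simp [IsPath, Step.src, Step.tgt, Atom.src, Atom.tgt, inv_inv]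
  have e3 := LocalEquiv.context hB e2 (l := pad ([a] ++ B.word) [inv a] D.steps)
    (b := [a] ++ B.word ++ (D.word ++ [inv a]))
    (by simpa using isPath_pad ([a] ++ B.word) [inv a] D.valid)
  rw [← c1]
  refine (cls_eq_of_local (w := [a] ++ B.word ++ (D.word ++ [inv a])) ?_).symm
  refine .trans (by simpa [Atom.src, Atom.tgt] using e1) ?_
  have h2 : ((B.mul D).act [a]).steps =
      (B.act [a]).steps ++ [] ++ pad ([a] ++ B.word) [inv a] D.steps := by
    simp [Picture.mul, Picture.act, hw, pad_append, pad_pad]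
  rw [h2]
  simpa [pad_pad] using e3

/-- A spherical picture can be pushed through a picture with boundary word `w`. -/
theorem push_spherical {w : Word α} {B : List (Step α ι)} (hB : IsPath r [] B w)
    {P : List (Step α ι)} (hP : IsPath r [] P []) :
    LocalEquiv r w w (pad w [] P) (pad [] w P) := by
  have e1 := exchange_paths hB hP
  have e2 := exchange_paths hP hB
  have hu := isPath_undo hB
  have hBP : LocalEquiv r [] w (B ++ pad w [] P) (B ++ pad [] w P) := by
    simp only [pad_nil, List.append_nil, List.nil_append] at e1 e2
    exact .trans e1 e2
  have e3 := LocalEquiv.left hu hBP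
  have r1 := (undo_append hB).right (by simpa using isPath_pad w [] hP)
  have r2 := (undo_append hB).right (by simpa using isPath_pad [] w hP)
  refine .trans (.symm (by simpa using r1)) (.trans (by simpa using e3) (by simpa using r2))

theorem actCls_relator (i : ι) {P : Picture r} (hP : P.IsSpherical) :
    actCls (r i) P.cls = P.cls := by
  change (P.act (r i)).cls = P.cls
  have hv := P.valid
  rw [show P.word = [] from hP] at hv
  have hB : IsPath r [] [(⟨[], .disk i true, []⟩ : Step α ι)] (r i) := by
    simp [IsPath, Step.src, Step.tgt, Atom.src, Atom.tgt, diskWord]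
  have hc : IsPath r [] (cups ι [] (r i) []) (r i ++ winv (r i)) := by
    simpa using isPath_cups (r := r) (ι := ι) [] (r i) []
  have e1 := (push_spherical hB hv).pad [] (winv (r i))
  simp only [pad_pad, List.nil_append, List.append_nil] at e1
  have e2 := LocalEquiv.left hc e1
  have e3 := (exchange_paths (r := r) hv hc).symm
  simp only [pad_nil, List.nil_append] at e3
  have e4 := LocalEquiv.trans e2 e3
  have c1 : (P.act (r i)).cls = Picture.cls ⟨_, _, e4.isPath.2⟩ := cls_eq_of_local e4
  rw [c1]
  exact cls_append_noDisk (noDisk_cups [] (r i) []) rfl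

/-- A letter acts on the group of pictures by an automorphism. -/
def letterAut (r : ι → Word α) (a : α) : MulAut (PictureGroup r) where
  toFun := actCls [(a, true)]
  invFun := actCls [(a, false)]
  left_inv σ := by
    rw [← actCls_append]; exact actCls_inv (a, false) σ
  right_inv σ := by
    rw [← actCls_append]; exact actCls_inv (a, true) σ
  map_mul' := actCls_letter_mul _

/-- The action of the free group on the group of pictures, `w · [D] = [w · D]`. -/
def freeAction (r : ι → Word α) : FreeGroup α →* MulAut (PictureGroup r) :=
  FreeGroup.lift (letterAut r)

theorem freeAction_mk (w : Word α) (σ : PictureGroup r) :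
    freeAction r (FreeGroup.mk w) σ = actCls w σ := by
  induction w with
  | nil => rw [actCls_nil, ← FreeGroup.one_eq_mk, map_one]; rfl
  | cons a w ih =>
    have h1 : actCls (a :: w) σ = actCls [a] (actCls w σ) := actCls_append [a] w σ
    have h2 : FreeGroup.mk (a :: w) = FreeGroup.mk [a] * FreeGroup.mk w := by
      rw [FreeGroup.mul_mk]; rfl
    rw [h1, h2, map_mul, MulAut.mul_apply, ih]
    obtain ⟨a, ε⟩ := a
    cases ε with
    | true => simp [freeAction, letterAut]
    | false => simp [freeAction, letterAut, MulAut.inv_def]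

theorem freeAction_mem (g : FreeGroup α) {σ : PictureGroup r} (hσ : σ ∈ sphericalGroup r) :
    freeAction r g σ ∈ sphericalGroup r := by
  obtain ⟨w, rfl⟩ := Quot.exists_rep g
  change freeAction r (FreeGroup.mk w) σ ∈ _
  obtain ⟨P, hP, rfl⟩ := hσ
  rw [freeAction_mk, actCls_cls]
  have hv := (P.act w).valid
  have hw : (P.act w).word = [] ++ w ++ winv w ++ [] := by
    simp [Picture.act, show P.word = [] from hP]
  rw [hw] at hv
  have h := isPath_append hv (isPath_caps [] w [])
  exact ⟨⟨_, _, h⟩, rfl, cls_append_noDisk (noDisk_caps [] w []) rfl⟩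

/-- `π₂` of the standard 2-complex, written additively. -/
abbrev Pi2 (r : ι → Word α) := Additive (sphericalGroup r)

theorem mul_inv_mem {B D : Picture r} (hw : D.word = B.word) :
    B.cls * D.cls⁻¹ ∈ sphericalGroup r := by
  have hv := (B.mul D.inverse).valid
  have hb : (B.mul D.inverse).word = [] ++ B.word ++ winv B.word ++ [] := by
    simp [Picture.mul, Picture.inverse, hw]
  rw [hb] at hv
  have h := isPath_append hv (isPath_caps [] B.word [])
  exact ⟨⟨_, _, h⟩, rfl, cls_append_noDisk (noDisk_caps [] B.word []) rfl⟩

/-- For two pictures with the same boundary word, the class of `B · D⁻¹` as an element of `π₂`. -/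
def quotientPicture (B D : Picture r) (hw : D.word = B.word) : Pi2 r :=
  Additive.ofMul ⟨B.cls * D.cls⁻¹, mul_inv_mem hw⟩

/-- The group given by the presentation. -/
abbrev PresGroup (r : ι → Word α) := PresentedGroup (Set.range fun i => FreeGroup.mk (r i))

/-- The action of the free group on `π₂`. -/
def freeActionPi2 (r : ι → Word α) : FreeGroup α →* Module.End ℤ (Pi2 r) where
  toFun g := AddMonoidHom.toIntLinearMap
    { toFun := fun x => Additive.ofMul ⟨freeAction r g x.toMul.1, freeAction_mem g x.toMul.2⟩
      map_zero' := by
        apply Additive.toMul.injective; apply Subtype.ext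
        simp
      map_add' := fun x y => by
        apply Additive.toMul.injective; apply Subtype.ext
        simp }
  map_one' := by
    ext x; simp
  map_mul' g g' := by
    ext x; simp

theorem freeActionPi2_apply (g : FreeGroup α) (x : Pi2 r) :
    (freeActionPi2 r g x).toMul.1 = freeAction r g x.toMul.1 := rfl

/-- The induced action of the presented group `G` on `π₂`. -/
def groupAction (r : ι → Word α) : PresGroup r →* Module.End ℤ (Pi2 r) :=
  QuotientGroup.lift _ (freeActionPi2 r) (by
    refine Subgroup.normalClosure_le_normal ?_
    rintro _ ⟨i, rfl⟩
    refine LinearMap.ext fun x => ?_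
    apply Additive.toMul.injective; apply Subtype.ext
    obtain ⟨P, hP, hx⟩ := x.toMul.2
    rw [freeActionPi2_apply, freeAction_mk, ← hx, actCls_relator i hP, hx]
    rfl)

/-- The left `ℤG`-module structure of `π₂`. -/
noncomputable instance pi2Module (r : ι → Word α) :
    Module (MonoidAlgebra ℤ (PresGroup r)) (Pi2 r) :=
  Module.compHom (Pi2 r)
    (MonoidAlgebra.lift ℤ (Module.End ℤ (Pi2 r)) (PresGroup r) (groupAction r)).toRingHom

/-- In this module structure the class of a word `w` acts by `[P] ↦ [w · P]`. -/
theorem single_mk_smul (w : Word α) (x : Pi2 r) :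
    ((MonoidAlgebra.single (PresentedGroup.mk _ (FreeGroup.mk w)) (1 : ℤ) :
      MonoidAlgebra ℤ (PresGroup r)) • x).toMul.1 = actCls w x.toMul.1 := by
  change ((MonoidAlgebra.lift ℤ (Module.End ℤ (Pi2 r)) (PresGroup r) (groupAction r)
    (MonoidAlgebra.single (PresentedGroup.mk _ (FreeGroup.mk w)) (1 : ℤ))) x).toMul.1 = _
  rw [MonoidAlgebra.lift_single, one_smul]
  exact freeAction_mk w x.toMul.1

end PictureGroupSection

/-! ### Cellular homology and the Hurewicz homomorphism -/

section Homology

variable {α ι : Type*} {r : ι → Word α}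

/-- The exponent sums of the generators in a word, as a cellular 1-chain. -/
noncomputable def expSum (w : Word α) : α →₀ ℤ :=
  (w.map fun a => Finsupp.single a.1 (if a.2 then (1 : ℤ) else -1)).sum

/-- The cellular boundary map `C₂ → C₁` of the standard 2-complex of a presentation. The group `C₂`
is free on the relators, `C₁` is free on the generators, and the 2-cell of a relator is attached
along the loop that spells the relator. -/
noncomputable def cellBoundary (r : ι → Word α) : (ι →₀ ℤ) →ₗ[ℤ] (α →₀ ℤ) :=
  Finsupp.linearCombination ℤ fun i => expSum (r i)

/-- The second cellular homology group of the standard 2-complex (it has no 3-cells). -/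
noncomputable abbrev H2 (r : ι → Word α) : Submodule ℤ (ι →₀ ℤ) := LinearMap.ker (cellBoundary r)

/-- The signed 2-cell of a slab. -/
noncomputable def Step.chain (s : Step α ι) : ι →₀ ℤ :=
  match s.atom with
  | .cup _ => 0
  | .cap _ => 0
  | .disk i ε => Finsupp.single i (if ε then 1 else -1)

/-- The 2-chain whose coefficient at `i` is the number of disks labelled `i` with exponent `+1`
minus the number of disks labelled `i` with exponent `-1`. -/
noncomputable def diskChain (l : List (Step α ι)) : ι →₀ ℤ := (l.map Step.chain).sum

theorem diskChain_append (l m : List (Step α ι)) :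
    diskChain (l ++ m) = diskChain l + diskChain m := by simp [diskChain]

theorem diskChain_cons (s : Step α ι) (l : List (Step α ι)) :
    diskChain (s :: l) = s.chain + diskChain l := by simp [diskChain]

theorem diskChain_nil : diskChain ([] : List (Step α ι)) = 0 := rfl

theorem diskChain_pad (x y : Word α) (l : List (Step α ι)) :
    diskChain (pad x y l) = diskChain l := by
  simp only [diskChain, pad, List.map_map]
  rfl

theorem diskChain_noDisk {l : List (Step α ι)} (h : ∀ s ∈ l, s.NoDisk) : diskChain l = 0 := by
  induction l with
  | nil => rfl
  | cons s l ih =>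
    rw [diskChain_cons, ih fun t ht => h t (List.mem_cons_of_mem _ ht), add_zero]
    have := h s List.mem_cons_self
    obtain ⟨u, A, v⟩ := s
    cases A with
    | cup a => rfl
    | cap a => rfl
    | disk i ε => exact absurd rfl (this i ε)

theorem diskChain_localMove {m m' : List (Step α ι)} (h : LocalMove r m m') :
    diskChain m = diskChain m' := by
  cases h with
  | exchange u A v B w =>
    simp only [diskChain_cons, diskChain_nil, add_zero]
    exact add_comm _ _
  | straighten_left u a v => simp [diskChain_cons, diskChain_nil, Step.chain]
  | straighten_right u a v => simp [diskChain_cons, diskChain_nil, Step.chain]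
  | rotate u i ε v =>
    rw [diskChain_append, diskChain_append, diskChain_noDisk (noDisk_cups _ _ _),
      diskChain_noDisk (noDisk_caps _ _ _)]
    simp [diskChain_cons, diskChain_nil, Step.chain]
  | float u a v => simp [diskChain_cons, diskChain_nil, Step.chain]
  | bridge u a v => simp [diskChain_cons, diskChain_nil, Step.chain]
  | fold u i ε v =>
    rw [diskChain_append, diskChain_noDisk (noDisk_caps _ _ _)]
    cases ε <;> simp [diskChain_cons, diskChain_nil, Step.chain]

theorem diskChain_localEquiv {a b : Word α} {l l' : List (Step α ι)} (h : LocalEquiv r a b l l') :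
    diskChain l = diskChain l' := by
  induction h with
  | move h _ _ => simp only [diskChain_append, diskChain_localMove h]
  | refl _ => rfl
  | symm _ ih => exact ih.symm
  | trans _ _ ih1 ih2 => exact ih1.trans ih2

theorem diskChain_move {B D : Picture r} (h : Picture.Move B D) :
    diskChain B.steps = diskChain D.steps := by
  rcases h with ⟨_, h⟩ | ⟨u, a, v, _, h⟩
  · exact diskChain_localEquiv h
  · rw [h, diskChain_append]; simp [diskChain_cons, diskChain_nil, Step.chain]

theorem expSum_append (w w' : Word α) : expSum (w ++ w') = expSum w + expSum w' := by
  simp [expSum]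

theorem expSum_winv (w : Word α) : expSum (winv w) = -expSum w := by
  induction w with
  | nil => simp [expSum, winv]
  | cons a w ih =>
    rw [winv_cons, expSum_append, ih]
    obtain ⟨a, ε⟩ := a
    cases ε <;> simp [expSum, inv]

theorem expSum_path {a b : Word α} {l : List (Step α ι)} (h : IsPath r a l b) :
    expSum b = expSum a + cellBoundary r (diskChain l) := by
  induction l generalizing a with
  | nil => simp only [IsPath] at h; subst h; simp [diskChain_nil]
  | cons s l ih =>
    rw [ih h.2, h.1, diskChain_cons, map_add, ← add_assoc]
    congr 1
    obtain ⟨u, A, v⟩ := s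
    have hc : ∀ a : α × Bool, expSum [a, inv a] = 0 := by
      rintro ⟨a, ε⟩
      cases ε <;> simp [expSum, inv]
    have hz : expSum ([] : Word α) = 0 := by simp [expSum]
    cases A with
    | cup a => simp only [Step.src, Step.tgt, Atom.src, Atom.tgt, Step.chain, expSum_append, hc, hz,
        map_zero, add_zero]
    | cap a => simp only [Step.src, Step.tgt, Atom.src, Atom.tgt, Step.chain, expSum_append, hc, hz,
        map_zero, add_zero]
    | disk i ε =>
      simp only [Step.src, Step.tgt, Atom.src, Atom.tgt, Step.chain, expSum_append, hz, add_zero]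
      cases ε <;> simp [cellBoundary, diskWord, expSum_winv] <;> abel

/-- The net numbers of disks, as a homomorphism on the group of pictures. -/
noncomputable def pictureChain (r : ι → Word α) : PictureGroup r →* Multiplicative (ι →₀ ℤ) where
  toFun := Quotient.lift (fun B => Multiplicative.ofAdd (diskChain B.steps))
    (eq_of_move _ fun _ _ h => congrArg Multiplicative.ofAdd (diskChain_move h))
  map_one' := rfl
  map_mul' σ τ := by
    induction σ using Quotient.inductionOn with | _ B
    induction τ using Quotient.inductionOn with | _ D
    change Multiplicative.ofAdd (diskChain (B.steps ++ pad B.word [] D.steps)) =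
      Multiplicative.ofAdd (diskChain B.steps + diskChain D.steps)
    rw [diskChain_append, diskChain_pad]

theorem pictureChain_mem (x : Pi2 r) : (pictureChain r x.toMul.1).toAdd ∈ H2 r := by
  obtain ⟨P, hP, hx⟩ := x.toMul.2
  rw [← hx]
  change cellBoundary r (diskChain P.steps) = 0
  have h := expSum_path P.valid
  rw [show P.word = [] from hP] at h
  simpa using h.symm

/-- The Hurewicz homomorphism `h : π₂ → H₂`. It sends the class of a spherical picture to the
2-cycle in which the 2-cell of each relator occurs as often as the relator labels a disk of the
picture, disks with exponent `-1` being counted negatively. -/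
noncomputable def hurewicz (r : ι → Word α) : Pi2 r →+ H2 r where
  toFun x := ⟨(pictureChain r x.toMul.1).toAdd, pictureChain_mem x⟩
  map_zero' := by apply Subtype.ext; simp
  map_add' x y := by apply Subtype.ext; simp

end Homology

/-! ### Tiles, regions and tilings in the square lattice -/

/-- The two generators: `x` is a unit step to the east, `y` a unit step to the north. -/
inductive Gen
  | x
  | y

/-- The closed unit square of the lattice with lower left corner `c`. -/
def square (c : ℤ × ℤ) : Set (ℝ × ℝ) :=
  Set.Icc (c.1 : ℝ) (c.1 + 1) ×ˢ Set.Icc (c.2 : ℝ) (c.2 + 1)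

/-- A finite set of lattice squares (named by their lower left corners) has a union that is
homeomorphic to a closed disk. -/
def IsDisk (S : Finset (ℤ × ℤ)) : Prop :=
  Nonempty ((⋃ c ∈ S, square c : Set (ℝ × ℝ)) ≃ₜ
    Metric.closedBall (0 : EuclideanSpace ℝ (Fin 2)) 1)

/-- The lattice vector of a letter. -/
def letterVec : Gen × Bool → ℤ × ℤ
  | (.x, true) => (1, 0)
  | (.x, false) => (-1, 0)
  | (.y, true) => (0, 1)
  | (.y, false) => (0, -1)

/-- A directed unit edge of the lattice: its starting point and its letter. -/
abbrev Edge := (ℤ × ℤ) × (Gen × Bool)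

/-- The square on the right-hand side of a directed edge. -/
def Edge.rightSquare : Edge → ℤ × ℤ
  | (p, (.x, true)) => (p.1, p.2 - 1)
  | (p, (.x, false)) => (p.1 - 1, p.2)
  | (p, (.y, true)) => p
  | (p, (.y, false)) => (p.1 - 1, p.2 - 1)

/-- The square on the left-hand side of a directed edge. -/
def Edge.leftSquare : Edge → ℤ × ℤ
  | (p, (.x, true)) => p
  | (p, (.x, false)) => (p.1 - 1, p.2 - 1)
  | (p, (.y, true)) => (p.1 - 1, p.2)
  | (p, (.y, false)) => (p.1, p.2 - 1)

/-- The directed edges that are traversed by the lattice path from `p` that spells a word. -/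
def trace : ℤ × ℤ → Word Gen → List Edge
  | _, [] => []
  | p, a :: w => (p, a) :: trace (p + letterVec a) w

/-- The end of the lattice path from `p` that spells a word. -/
def endpoint : ℤ × ℤ → Word Gen → ℤ × ℤ
  | p, [] => p
  | p, a :: w => endpoint (p + letterVec a) w

/-- The word `w` is spelled by the clockwise path around the boundary of the disk `S` that starts
at the point `p`: a closed path that traverses exactly once each edge between a square of `S`
and a square outside `S`, with the square of `S` on its right-hand side, and no other edge. -/
def IsBoundaryWord (S : Finset (ℤ × ℤ)) (p : ℤ × ℤ) (w : Word Gen) : Prop :=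
  endpoint p w = p ∧ (trace p w).Nodup ∧
    ∀ e : Edge, e ∈ trace p w ↔ e.rightSquare ∈ S ∧ e.leftSquare ∉ S

section Tilings

variable {n : ℕ}

/-- The square `c` lies in the copy of a tile that is given by a pair `q`: the index of the tile
and the vector by which it is translated. -/
def Covers (t : Fin n → Finset (ℤ × ℤ)) (q : Fin n × (ℤ × ℤ)) (c : ℤ × ℤ) : Prop :=
  c - q.2 ∈ t q.1

/-- `A` is a tiling of the region `Γ` by translated copies of the tiles `t`, without gaps or
overlaps. -/
def IsTiling (t : Fin n → Finset (ℤ × ℤ)) (Γ : Finset (ℤ × ℤ)) (A : Finset (Fin n × (ℤ × ℤ))) :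
    Prop :=
  (∀ q ∈ A, ∀ c, Covers t q c → c ∈ Γ) ∧ ∀ c ∈ Γ, ∃! q, q ∈ A ∧ Covers t q c

/-- The number of copies of the tile `i` in a tiling. -/
def tileCount (A : Finset (Fin n × (ℤ × ℤ))) (i : Fin n) : ℕ := (A.filter fun q => q.1 = i).card

/-- The formal sum of the tiles of a tiling. -/
noncomputable def tileSum (A : Finset (Fin n × (ℤ × ℤ))) : Fin n →₀ ℤ :=
  ∑ i, Finsupp.single i (tileCount A i : ℤ)

/-- The span of all differences of formal sums of the tiles of two tilings of one region, for all
regions that are homeomorphic to a disk. -/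
noncomputable def tileRelations (t : Fin n → Finset (ℤ × ℤ)) : AddSubgroup (Fin n →₀ ℤ) :=
  AddSubgroup.closure {z | ∃ (Γ : Finset (ℤ × ℤ)) (A A' : Finset (Fin n × (ℤ × ℤ))),
    IsDisk Γ ∧ IsTiling t Γ A ∧ IsTiling t Γ A' ∧ z = tileSum A - tileSum A'}

/-- The tile counting group, for the family of all regions that are homeomorphic to a disk. -/
abbrev TileCountingGroup (t : Fin n → Finset (ℤ × ℤ)) := (Fin n →₀ ℤ) ⧸ tileRelations t

/-! ### The pictures of tilings -/

/-- The directed edge `e` lies on the boundary of some tile of the tiling `A`. -/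
def OnTileBoundary (t : Fin n → Finset (ℤ × ℤ)) (A : Finset (Fin n × (ℤ × ℤ))) (e : Edge) : Prop :=
  ∃ q ∈ A, ¬ (Covers t q e.rightSquare ↔ Covers t q e.leftSquare)

/-- The disks of a stack of slabs, from bottom to top: the label, the exponent, and the word spelled
by the arcs to the left of the disk, that is, by a path from the ambient basepoint to the basepoint
of the disk. -/
def diskList {α ι : Type*} (l : List (Step α ι)) : List (ι × Bool × Word α) :=
  l.filterMap fun s => match s.atom with
    | .cup _ => none
    | .cap _ => none
    | .disk i ε => some (i, ε, s.pre)

/-- The picture `B` is the planar dual of the tiling `A`, seen from the ambient basepoint `p`. Here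
`b i` is the basepoint on the boundary of the tile `i`. Each component of the complement of the arcs
and disks of `B` is developed to a point of the lattice: the component of the ambient basepoint to
`p`, and crossing an arc corresponds to traversing a lattice edge. The conditions say that all arcs
of `B` are dual to edges of tiles of `A` (an edge inside a tile, or outside of the region, is not
allowed), that all disks have positive exponent, and that the disks correspond bijectively to the
tiles of `A`, the label of a disk being the index of its tile and the component at its basepoint
being developed to the basepoint of the tile. -/
def IsDualPicture (t : Fin n → Finset (ℤ × ℤ)) (b : Fin n → ℤ × ℤ) {r : Fin n → Word Gen}
    (A : Finset (Fin n × (ℤ × ℤ))) (p : ℤ × ℤ) (B : Picture r) : Prop :=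
  (∀ s ∈ B.steps, ∀ e ∈ trace p (s.tgt r), OnTileBoundary t A e) ∧
  (∀ d ∈ diskList B.steps, d.2.1 = true) ∧
  ((diskList B.steps).map fun d => (d.1, endpoint p d.2.2 - b d.1)).Nodup ∧
  ∀ q, q ∈ (diskList B.steps).map (fun d => (d.1, endpoint p d.2.2 - b d.1)) ↔ q ∈ A

/-- The submodule `J` of `π₂` generated by the elements `[B · D⁻¹]`, where `B` and `D` are the
pictures of two tilings of one region that is homeomorphic to a disk, both read from one basepoint
`p` on the boundary of the region. -/
noncomputable def tilingSubmodule (t : Fin n → Finset (ℤ × ℤ)) (b : Fin n → ℤ × ℤ)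
    (r : Fin n → Word Gen) : Submodule (MonoidAlgebra ℤ (PresGroup r)) (Pi2 r) :=
  Submodule.span _ {x | ∃ (Γ : Finset (ℤ × ℤ)) (A A' : Finset (Fin n × (ℤ × ℤ))) (p : ℤ × ℤ)
    (B D : Picture r) (hw : D.word = B.word), IsDisk Γ ∧ IsTiling t Γ A ∧ IsTiling t Γ A' ∧
      IsBoundaryWord Γ p B.word ∧ IsDualPicture t b A p B ∧ IsDualPicture t b A' p D ∧
      x = quotientPicture B D hw}

end Tilings

end TilePictures

namespace TilePictures

/-! ### Lattice paths and winding numbers -/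

/-! Every tile boundary is a closed lattice path, so each relator has exponent sum zero in both
generators. The cellular boundary therefore vanishes and `H2 r` is the whole free group on the tiles
(`expSum_eq_zero`, `H2_eq_top`). The Hurewicz map does not see the action of the presented group,
since surrounding a picture by arcs adds no disks. Hence the image of `J` is the subgroup generated
by the images of the elements `[B · D⁻¹]` (`map_hurewicz_span`). A dual picture has exactly one
positive disk for each tile, so such an image is the difference of two tile sums
(`IsDualPicture.diskChain`). Thus `h(J)` lies in `I`, and it equals `I` as soon as every disk region
has a boundary word and each of its tilings has a dual picture with that boundary word.

The dual picture comes from a van Kampen argument. The boundary word is freely equal to a product of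
conjugates of tile boundary words, one for each tile, with conjugating paths along tile edges
(`Encloses.exists_filling`). The induction looks at the first edge of a closed path. If a tile lies
on its right, the path is rerouted around the other side of that tile, which is thereby removed.
Otherwise a winding number count shows that the path comes back through the same edge, and it splits
into two shorter closed paths. Such a product is drawn as disks under nested arcs, and free equality
is realised by caps and cups (`exists_path_of_conjugates`, `exists_path_of_red`).

Topology enters only through two facts about a disk made of squares. It is edge-connected, because a
closed disk minus a countable set is connected (`IsDisk.edgeConn`). Its complement is
edge-connected, because a disk avoiding a point carries a continuous logarithm of the vector from
that point, which is incompatible with a bounded complementary component (`IsDisk.edgeConn_compl`).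
With both facts, the winding number jump formula `wind_jump` shows that a closed path which follows
boundary edges without repetition traverses all of them (`exists_isBoundaryWord`). -/

instance : DecidableEq Gen := fun a b => by
  cases a <;> cases b <;> first | exact isTrue rfl | exact isFalse (by intro h; cases h)

/-- The same edge, traversed in the opposite direction. -/
def Edge.rev (e : Edge) : Edge := (e.1 + letterVec e.2, inv e.2)

theorem letterVec_inv (a : Gen × Bool) : letterVec (inv a) = -letterVec a := by
  obtain ⟨a, ε⟩ := a
  cases a <;> cases ε <;> simp [inv, letterVec]

theorem Edge.rev_rev (e : Edge) : e.rev.rev = e := by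
  obtain ⟨p, a⟩ := e
  simp [Edge.rev, letterVec_inv, inv_inv]

theorem Edge.rev_injective : Function.Injective Edge.rev :=
  Function.LeftInverse.injective Edge.rev_rev

theorem Edge.rightSquare_rev (e : Edge) : e.rev.rightSquare = e.leftSquare := by
  obtain ⟨⟨i, j⟩, a, ε⟩ := e
  cases a <;> cases ε <;> simp [Edge.rev, Edge.rightSquare, Edge.leftSquare, inv, letterVec] <;>
    omega

theorem Edge.leftSquare_rev (e : Edge) : e.rev.leftSquare = e.rightSquare := by
  rw [← Edge.rightSquare_rev, Edge.rev_rev]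

theorem Edge.rev_ne (e : Edge) : e.rev ≠ e := by
  obtain ⟨p, a, ε⟩ := e
  cases ε <;> simp [Edge.rev, inv]

theorem endpoint_append (p : ℤ × ℤ) (v w : Word Gen) :
    endpoint p (v ++ w) = endpoint (endpoint p v) w := by
  induction v generalizing p with
  | nil => rfl
  | cons a v ih => exact ih _

theorem trace_append (p : ℤ × ℤ) (v w : Word Gen) :
    trace p (v ++ w) = trace p v ++ trace (endpoint p v) w := by
  induction v generalizing p with
  | nil => rfl
  | cons a v ih => exact congrArg (_ :: ·) (ih _)

theorem endpoint_winv (p : ℤ × ℤ) (w : Word Gen) : endpoint (endpoint p w) (winv w) = p := by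
  induction w generalizing p with
  | nil => rfl
  | cons a w ih =>
    rw [winv_cons, endpoint_append]
    simp [endpoint, ih, letterVec_inv]

theorem trace_winv (p : ℤ × ℤ) (w : Word Gen) :
    trace (endpoint p w) (winv w) = ((trace p w).map Edge.rev).reverse := by
  induction w generalizing p with
  | nil => rfl
  | cons a w ih =>
    rw [winv_cons, trace_append]
    simp only [endpoint, ih, endpoint_winv, trace, List.map_cons, List.reverse_cons]
    rfl

theorem endpoint_add (p v : ℤ × ℤ) (w : Word Gen) : endpoint (p + v) w = endpoint p w + v := by
  induction w generalizing p with
  | nil => rfl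
  | cons a w ih => simp only [endpoint]; rw [← ih, add_right_comm]

theorem trace_add (p v : ℤ × ℤ) (w : Word Gen) :
    trace (p + v) w = (trace p w).map fun e => (e.1 + v, e.2) := by
  induction w generalizing p with
  | nil => rfl
  | cons a w ih =>
    simp only [trace, List.map_cons]
    rw [← ih, add_right_comm]

theorem Edge.rightSquare_add (e : Edge) (v : ℤ × ℤ) :
    Edge.rightSquare (e.1 + v, e.2) = e.rightSquare + v := by
  obtain ⟨⟨i, j⟩, a, ε⟩ := e
  obtain ⟨k, l⟩ := v
  cases a <;> cases ε <;> simp [Edge.rightSquare] <;> omega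

theorem Edge.leftSquare_add (e : Edge) (v : ℤ × ℤ) :
    Edge.leftSquare (e.1 + v, e.2) = e.leftSquare + v := by
  obtain ⟨⟨i, j⟩, a, ε⟩ := e
  obtain ⟨k, l⟩ := v
  cases a <;> cases ε <;> simp [Edge.leftSquare] <;> omega

/-- An edge of a path splits the path. -/
theorem exists_split_of_mem_trace {p : ℤ × ℤ} {w : Word Gen} {e : Edge} (h : e ∈ trace p w) :
    ∃ u v, w = u ++ e.2 :: v ∧ endpoint p u = e.1 := by
  induction w generalizing p with
  | nil => simp [trace] at h
  | cons a w ih =>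
    rcases List.mem_cons.1 h with rfl | h
    · exact ⟨[], w, rfl, rfl⟩
    · obtain ⟨u, v, rfl, hu⟩ := ih h
      exact ⟨a :: u, v, rfl, hu⟩

/-- The contribution of a directed edge to the (clockwise) winding number around a square: count
the horizontal edges above the square. -/
def edgeWind : Edge → ℤ × ℤ → ℤ
  | (p, (.x, true)), c => if p.1 = c.1 ∧ c.2 < p.2 then 1 else 0
  | (p, (.x, false)), c => if p.1 - 1 = c.1 ∧ c.2 < p.2 then -1 else 0
  | (_, (.y, _)), _ => 0

/-- The clockwise winding number of a lattice path around a square. -/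
def wind (p : ℤ × ℤ) : Word Gen → ℤ × ℤ → ℤ
  | [], _ => 0
  | a :: w, c => edgeWind (p, a) c + wind (p + letterVec a) w c

/-- The potential whose differences measure the failure of the jump formula for open paths. -/
def windPotential : Edge → ℤ × ℤ → ℤ
  | (p, (.y, true)), v => if v.1 = p.1 ∧ p.2 < v.2 then 1 else 0
  | (p, (.y, false)), v => if v.1 = p.1 ∧ p.2 - 1 < v.2 then -1 else 0
  | (_, (.x, _)), _ => 0

/-- For horizontal `e` the upward rays from its two sides differ exactly by crossing `e`. For
vertical `e` the rays run in adjacent columns, and a horizontal edge `f` that meets only one of them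
may have an end on the lattice line between. `windPotential` is the signed indicator of the vertices
of that line strictly above the lower end of `e`. It accounts for such ends, and among vertical
edges it changes only along `e` and its reverse. -/
theorem edgeWind_jump (f e : Edge) :
    edgeWind f e.rightSquare - edgeWind f e.leftSquare =
      (if f = e then 1 else 0) - (if f = e.rev then 1 else 0) +
        windPotential e f.1 - windPotential e (f.1 + letterVec f.2) := by
  obtain ⟨⟨i, j⟩, a, ε⟩ := f
  obtain ⟨⟨k, l⟩, b, δ⟩ := e
  cases a <;> cases ε <;> cases b <;> cases δ <;>
    simp only [edgeWind, Edge.rightSquare, Edge.leftSquare, Edge.rev, windPotential, letterVec,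
      inv, Prod.mk.injEq, reduceCtorEq, and_false, and_true, if_false,
      Prod.mk_add_mk, Bool.not_true, Bool.not_false] <;>
    grind

theorem wind_jump_aux (p : ℤ × ℤ) (w : Word Gen) (e : Edge) :
    wind p w e.rightSquare - wind p w e.leftSquare =
      (trace p w).count e - (trace p w).count e.rev +
        windPotential e p - windPotential e (endpoint p w) := by
  induction w generalizing p with
  | nil => simp [wind, trace, endpoint]
  | cons a w ih =>
    have h1 := ih (p + letterVec a)
    have h2 := edgeWind_jump (p, a) e
    simp only [wind, trace, endpoint, List.count_cons, beq_iff_eq]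
    push_cast
    split_ifs at h2 ⊢ <;> linarith

/-- Crossing an edge changes the winding number of a closed path by the net number of traversals. -/
theorem wind_jump {p : ℤ × ℤ} {w : Word Gen} (hw : endpoint p w = p) (e : Edge) :
    wind p w e.rightSquare - wind p w e.leftSquare =
      (trace p w).count e - (trace p w).count e.rev := by
  rw [wind_jump_aux, hw]; ring

/-- A square high enough has no edge of the path above it, and such squares can be chosen outside
any finite set. -/
theorem exists_wind_eq_zero (p : ℤ × ℤ) (w : Word Gen) (S : Finset (ℤ × ℤ)) :
    ∃ c ∉ S, wind p w c = 0 := by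
  have key : ∀ w : Word Gen, ∀ p : ℤ × ℤ, ∃ N : ℤ, ∀ c : ℤ × ℤ, N ≤ c.2 → wind p w c = 0 := by
    intro w
    induction w with
    | nil => exact fun _ => ⟨0, fun _ _ => rfl⟩
    | cons a w ih =>
      intro p
      obtain ⟨N, hN⟩ := ih (p + letterVec a)
      refine ⟨max N p.2, fun c hc => ?_⟩
      rw [wind, hN c (le_trans (le_max_left _ _) hc)]
      have : ¬ c.2 < p.2 := not_lt.2 (le_trans (le_max_right _ _) hc)
      obtain ⟨a, ε⟩ := a
      cases a <;> cases ε <;> simp [edgeWind, this]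
  obtain ⟨N, hN⟩ := key w p
  obtain ⟨M, hM⟩ := (S.image Prod.snd).bddAbove
  refine ⟨(0, max N (M + 1)), fun h => ?_, hN _ (le_max_left _ _)⟩
  have := hM (Finset.mem_coe.2 (Finset.mem_image_of_mem Prod.snd h))
  have h2 := le_max_right N (M + 1)
  simp only at this
  omega

/-! ### Edge-connected sets of squares -/

/-- A set `P` of squares is connected by unit steps that do not cross the edges in `E`: it is not
the disjoint union of two nonempty sets that are not joined by such steps. -/
def ConnAvoiding (P : Set (ℤ × ℤ)) (E : Set Edge) : Prop :=
  ∀ Q : Set (ℤ × ℤ), (∀ e : Edge, e.leftSquare ∈ P → e.rightSquare ∈ P → e ∉ E → e.rev ∉ E →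
    e.leftSquare ∈ Q → e.rightSquare ∈ Q) → ∀ a ∈ P, ∀ b ∈ P, a ∈ Q → b ∈ Q

/-- A set of squares is edge-connected if it is not the disjoint union of two nonempty sets without
a common edge. -/
def EdgeConn (P : Set (ℤ × ℤ)) : Prop := ConnAvoiding P ∅

theorem EdgeConn.avoiding {P : Set (ℤ × ℤ)} (hP : EdgeConn P) {E : Set Edge}
    (hE : ∀ e ∈ E, e.leftSquare ∈ P → e.rightSquare ∉ P) : ConnAvoiding P E := by
  intro Q hQ
  refine hP Q fun e h1 h2 _ _ => hQ e h1 h2 (fun h => hE e h h1 h2) fun h => ?_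
  have := hE _ h
  rw [Edge.leftSquare_rev, Edge.rightSquare_rev] at this
  exact this h2 h1

theorem ConnAvoiding.mono {P : Set (ℤ × ℤ)} {E E' : Set Edge} (hP : ConnAvoiding P E)
    (hE : ∀ e ∈ E', e.leftSquare ∈ P → e.rightSquare ∈ P → e ∈ E) : ConnAvoiding P E' := by
  intro Q hQ
  refine hP Q fun e h1 h2 h3 h4 => hQ e h1 h2 (fun h => h3 (hE e h h1 h2)) fun h => h4 ?_
  have := hE _ h
  rw [Edge.leftSquare_rev, Edge.rightSquare_rev] at this
  exact this h2 h1

/-- Connectedness applied to a level set of `f`. Mostly used with winding numbers, which do not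
change across edges that the path avoids. -/
theorem ConnAvoiding.eq {P : Set (ℤ × ℤ)} {E : Set Edge} (hP : ConnAvoiding P E) {β : Type*}
    (f : ℤ × ℤ → β) (hf : ∀ e : Edge, e.leftSquare ∈ P → e.rightSquare ∈ P → e ∉ E → e.rev ∉ E →
      f e.leftSquare = f e.rightSquare)
    {a b : ℤ × ℤ} (ha : a ∈ P) (hb : b ∈ P) : f a = f b :=
  (hP {c | f c = f a} (fun e h1 h2 h3 h4 h => (hf e h1 h2 h3 h4).symm.trans h) a ha b hb rfl).symm

theorem ConnAvoiding.union {P R : Set (ℤ × ℤ)} {E : Set Edge} (hP : ConnAvoiding P E)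
    (hR : ConnAvoiding R E) {e : Edge} (h1 : e.leftSquare ∈ P) (h2 : e.rightSquare ∈ R)
    (he : e ∉ E) (he' : e.rev ∉ E) : ConnAvoiding (P ∪ R) E := by
  intro Q hQ a ha b hb haQ
  have hP' := hP Q fun e h1 h2 => hQ e (Or.inl h1) (Or.inl h2)
  have hR' := hR Q fun e h1 h2 => hQ e (Or.inr h1) (Or.inr h2)
  have h3 := hQ e (Or.inl h1) (Or.inr h2) he he'
  have h4 := hQ e.rev (by rw [Edge.leftSquare_rev]; exact Or.inr h2)
    (by rw [Edge.rightSquare_rev]; exact Or.inl h1) he' (by rwa [Edge.rev_rev])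
  rw [Edge.leftSquare_rev, Edge.rightSquare_rev] at h4
  rcases ha with ha | ha <;> rcases hb with hb | hb
  · exact hP' a ha b hb haQ
  · exact hR' _ h2 b hb (h3 (hP' a ha _ h1 haQ))
  · exact hP' _ h1 b hb (h4 (hR' a ha _ h2 haQ))
  · exact hR' a ha b hb haQ

theorem EdgeConn.translate {P : Set (ℤ × ℤ)} (hP : EdgeConn P) (v : ℤ × ℤ) :
    EdgeConn {c | c - v ∈ P} := by
  intro Q hQ a ha b hb haQ
  have := hP {c | c + v ∈ Q} (fun e h1 h2 _ _ h3 => ?_) (a - v) ha (b - v) hb (by simpa using haQ)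
  · simpa using this
  · have := hQ (e.1 + v, e.2)
    rw [Edge.leftSquare_add, Edge.rightSquare_add] at this
    exact this (by simpa using h1) (by simpa using h2) (by simp) (by simp) h3

/-- From every square of a finite set one can go east until one leaves the set. -/
theorem induction_east {S : Finset (ℤ × ℤ)} (C : ℤ × ℤ → Prop) (hout : ∀ c ∉ S, C c)
    (hstep : ∀ c ∈ S, C (c.1 + 1, c.2) → C c) (c : ℤ × ℤ) : C c := by
  obtain ⟨M, hM⟩ := (S.image Prod.fst).bddAbove
  have key : ∀ k : ℕ, ∀ c : ℤ × ℤ, M < c.1 + k → C c := by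
    intro k
    induction k with
    | zero =>
      intro c hc
      refine hout c fun h => ?_
      have := hM (Finset.mem_coe.2 (Finset.mem_image_of_mem Prod.fst h))
      simp at hc
      omega
    | succ k ih =>
      intro c hc
      by_cases h : c ∈ S
      · exact hstep c h (ih _ (by push_cast at hc; simp only; omega))
      · exact hout c h
  exact key (M + 1 - c.1).toNat c (by omega)

/-- The complement of a union of components of `S` is connected if the complement of `S` is. -/
theorem ConnAvoiding.compl_of_components {S T : Finset (ℤ × ℤ)} {E E' : Set Edge}
    (hS : ConnAvoiding (↑S : Set (ℤ × ℤ))ᶜ E) (hTS : T ⊆ S)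
    (hT : ∀ e : Edge, e.leftSquare ∈ S → e.rightSquare ∈ T → e.leftSquare ∈ T)
    (hE : E' ⊆ E) (hleft : ∀ e ∈ E', e.leftSquare ∉ S)
    (hright : ∀ e ∈ E', e.rightSquare ∈ S → e.rightSquare ∈ T) :
    ConnAvoiding (↑T : Set (ℤ × ℤ))ᶜ E' := by
  intro Q hQ a ha b hb haQ
  have hQ' : ∀ e : Edge, e.leftSquare ∉ T → e.rightSquare ∉ T → e ∉ E' → e.rev ∉ E' →
      (e.leftSquare ∈ Q ↔ e.rightSquare ∈ Q) := by
    intro e h1 h2 h3 h4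
    refine ⟨hQ e (by simpa using h1) (by simpa using h2) h3 h4, ?_⟩
    have := hQ e.rev
    rw [Edge.leftSquare_rev, Edge.rightSquare_rev, Edge.rev_rev] at this
    exact this (by simpa using h2) (by simpa using h1) h4 h3
  obtain ⟨o, ho, -⟩ := exists_wind_eq_zero 0 [] S
  have hSQ : ∀ c ∉ S, (c ∈ Q ↔ o ∈ Q) := by
    intro c hc
    have hS' := hS Q fun e h1 h2 h3 h4 => (hQ' e (fun h => h1 (hTS h)) (fun h => h2 (hTS h))
      (fun h => h3 (hE h)) (fun h => h4 (hE h))).1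
    exact ⟨hS' c (by simpa using hc) o (by simpa using ho), hS' o (by simpa using ho) c
      (by simpa using hc)⟩
  -- A square of `S` outside `T` leaves `S` by going east. These steps never enter `T`, a union of
  -- components of `S`. They do not cross `E'` either, since its edges have their left square
  -- outside `S` and their right square in `T` or outside `S`.
  have key : ∀ c : ℤ × ℤ, c ∉ T → (c ∈ Q ↔ o ∈ Q) := by
    refine induction_east (S := S) _ (fun c hc _ => hSQ c hc) fun c hc ih hcT => ?_
    have hl : Edge.leftSquare ((c.1 + 1, c.2), (Gen.y, true)) = c := by simp [Edge.leftSquare]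
    have hr : Edge.rightSquare ((c.1 + 1, c.2), (Gen.y, true)) = (c.1 + 1, c.2) := rfl
    have h1 := hT ((c.1 + 1, c.2), (Gen.y, true))
    have h2 := hQ' ((c.1 + 1, c.2), (Gen.y, true))
    have h3 := hleft (Edge.rev ((c.1 + 1, c.2), (Gen.y, true)))
    have h4 := hright (Edge.rev ((c.1 + 1, c.2), (Gen.y, true)))
    have h5 := hleft ((c.1 + 1, c.2), (Gen.y, true))
    rw [Edge.rightSquare_rev] at h4
    rw [hl] at h1 h2 h4 h5
    rw [hr] at h1 h2
    have hcT' : (c.1 + 1, c.2) ∉ T := fun h => hcT (h1 hc h)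
    exact (h2 hcT hcT' (fun h => h5 h hc) fun h => hcT (h4 h hc)).trans (ih hcT')
  exact (key b (by simpa using hb)).2 ((key a (by simpa using ha)).1 haQ)

/-- A nonempty finite set of squares has a boundary edge. -/
theorem exists_boundary_edge {S : Finset (ℤ × ℤ)} (hS : S.Nonempty) :
    ∃ e : Edge, e.rightSquare ∈ S ∧ e.leftSquare ∉ S := by
  by_contra! h
  obtain ⟨c, hc⟩ := hS
  refine induction_east (S := S) (fun c => c ∉ S) (fun _ h => h) (fun c hc ih _ => ih ?_) c hc
  have := h (Edge.rev ((c.1 + 1, c.2), (Gen.y, true)))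
  rw [Edge.leftSquare_rev, Edge.rightSquare_rev] at this
  exact this (by simpa [Edge.leftSquare] using hc)

/-- A closed path does not wind around the squares of a set with finite complement that is
connected by unit steps that do not cross the path. -/
theorem wind_eq_zero {S : Finset (ℤ × ℤ)} {E : Set Edge}
    (hS : ConnAvoiding (↑S : Set (ℤ × ℤ))ᶜ E) {p : ℤ × ℤ} {w : Word Gen} (hw : endpoint p w = p)
    (hE : ∀ e ∈ trace p w, e ∈ E) {c : ℤ × ℤ} (hc : c ∉ S) : wind p w c = 0 := by
  obtain ⟨o, ho, h0⟩ := exists_wind_eq_zero p w S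
  rw [← h0]
  refine hS.eq _ (fun e _ _ h3 h4 => ?_) (by simpa using hc) (by simpa using ho)
  have := wind_jump hw e
  rw [List.count_eq_zero_of_not_mem fun h => h3 (hE e h),
    List.count_eq_zero_of_not_mem fun h => h4 (hE _ h)] at this
  linarith

/-! ### Filling a closed path with tiles -/

section Filling

variable {n : ℕ} {t : Fin n → Finset (ℤ × ℤ)} {b : Fin n → ℤ × ℤ} {r : Fin n → Word Gen}

/-- The pairs in `L` (a path `g` from `p` in the set `K` of edges, and a tile) are paths to the
basepoints of the tiles in `A`, one for each tile, and the closed path `w` from `p` is freely equal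
to the product of the boundary words of these tiles, conjugated by the paths. -/
def IsFilling (b : Fin n → ℤ × ℤ) (r : Fin n → Word Gen) (K : Set Edge)
    (A : Finset (Fin n × (ℤ × ℤ))) (p : ℤ × ℤ) (w : Word Gen) (L : List (Word Gen × Fin n)) :
    Prop :=
  FreeGroup.mk w = (L.map fun x =>
    FreeGroup.mk x.1 * FreeGroup.mk (r x.2) * (FreeGroup.mk x.1)⁻¹).prod ∧
  (∀ x ∈ L, ∀ e ∈ trace p x.1, e ∈ K) ∧
  (L.map fun x => (x.2, endpoint p x.1 - b x.2)).Nodup ∧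
  ∀ q, q ∈ L.map (fun x => (x.2, endpoint p x.1 - b x.2)) ↔ q ∈ A

/-- Conjugating a product by `g` conjugates each factor. Prefixing the paths by `g` moves their
start from `endpoint p g` to `p` and keeps their ends, so the tiles stay where they are. -/
theorem IsFilling.mul_conj {K : Set Edge} {A A' : Finset (Fin n × (ℤ × ℤ))} {p : ℤ × ℤ}
    {g v v' w : Word Gen} {L L' : List (Word Gen × Fin n)}
    (h : IsFilling b r K A (endpoint p g) v L) (h' : IsFilling b r K A' p v' L')
    (hd : Disjoint A A') (hg : ∀ e ∈ trace p g, e ∈ K)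
    (hw : FreeGroup.mk w =
      FreeGroup.mk g * FreeGroup.mk v * (FreeGroup.mk g)⁻¹ * FreeGroup.mk v') :
    IsFilling b r K (A ∪ A') p w (L.map (fun x => (g ++ x.1, x.2)) ++ L') := by
  obtain ⟨h1, h2, h3, h4⟩ := h
  obtain ⟨h1', h2', h3', h4'⟩ := h'
  have hL : (L.map (fun x => (g ++ x.1, x.2))).map (fun x => (x.2, endpoint p x.1 - b x.2)) =
      L.map fun x => (x.2, endpoint (endpoint p g) x.1 - b x.2) := by
    simp [Function.comp_def, endpoint_append]
  refine ⟨?_, ?_, ?_, ?_⟩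
  · rw [hw, h1, h1', List.map_append, List.prod_append, List.map_map]
    congr 1
    clear h1 h2 h3 h4 hL
    induction L with
    | nil => rw [List.map_nil, List.prod_nil, mul_one, mul_inv_cancel]; rfl
    | cons x L ih =>
      rw [List.map_cons, List.prod_cons, List.map_cons, List.prod_cons, ← ih]
      simp only [Function.comp_def, ← FreeGroup.mul_mk]
      group
  · intro x hx e he
    rcases List.mem_append.1 hx with hx | hx
    · obtain ⟨y, hy, rfl⟩ := List.mem_map.1 hx
      rw [trace_append] at he
      rcases List.mem_append.1 he with he | he
      · exact hg e he
      · exact h2 y hy e he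
    · exact h2' x hx e he
  · rw [List.map_append, hL, List.nodup_append']
    exact ⟨h3, h3', fun q hq hq' => Finset.disjoint_left.1 hd ((h4 q).1 hq) ((h4' q).1 hq')⟩
  · intro q
    rw [List.map_append, hL, List.mem_append, h4, h4', Finset.mem_union]

theorem isBoundaryWord_translate {S : Finset (ℤ × ℤ)} {p : ℤ × ℤ} {w : Word Gen}
    (h : IsBoundaryWord S p w) (v : ℤ × ℤ) :
    endpoint (p + v) w = p + v ∧ (trace (p + v) w).Nodup ∧
      ∀ e : Edge, e ∈ trace (p + v) w ↔ e.rightSquare - v ∈ S ∧ e.leftSquare - v ∉ S := by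
  refine ⟨by rw [endpoint_add, h.1], ?_, fun e => ?_⟩
  · rw [trace_add]
    refine h.2.1.map fun e e' he => ?_
    simp only [Prod.mk.injEq, add_left_inj] at he
    exact Prod.ext he.1 he.2
  · have h1 := Edge.rightSquare_add e (-v)
    have h2 := Edge.leftSquare_add e (-v)
    rw [sub_eq_add_neg, sub_eq_add_neg, ← h1, ← h2, ← h.2.2, trace_add, List.mem_map]
    constructor
    · rintro ⟨e', he', rfl⟩
      simpa using he'
    · intro he
      exact ⟨_, he, by simp⟩

/-- `S'` is a union of components of `S` and tiles are connected, so a tile that meets `S'` lies in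
it. -/
theorem IsTiling.restrict {S S' : Finset (ℤ × ℤ)} {A A' : Finset (Fin n × (ℤ × ℤ))}
    (ht : ∀ i, EdgeConn (t i : Set (ℤ × ℤ))) (h : IsTiling t S A) (hS : S' ⊆ S)
    (hS' : ∀ e : Edge, e.leftSquare ∈ S' → e.rightSquare ∈ S → e.rightSquare ∈ S')
    (hA : ∀ q, q ∈ A' ↔ q ∈ A ∧ ∃ c ∈ S', Covers t q c) : IsTiling t S' A' := by
  constructor
  · intro q hq c hc
    obtain ⟨hqA, c₀, hc₀, hqc⟩ := (hA q).1 hq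
    refine (ht q.1).translate q.2 S' (fun e h1 h2 _ _ h3 => hS' e h3 (h.1 q hqA _ h2)) c₀ hqc c hc hc₀
  · intro c hc
    obtain ⟨q, ⟨hqA, hqc⟩, hu⟩ := h.2 c (hS hc)
    exact ⟨q, ⟨(hA q).2 ⟨hqA, c, hc, hqc⟩, hqc⟩, fun q' hq' => hu q' ⟨((hA q').1 hq'.1).1, hq'.2⟩⟩

/-! ### Closed paths around tiled sets and the induction that fills them -/

/-- The set `S` is tiled by `A`, all edges of the tiles lie in `K`, and `w` spells a closed path from
`p` in `K` without repeated edges that encloses exactly the squares of `S`. It may pass in both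
directions through an edge with no square of `S` on either side. -/
structure Encloses (t : Fin n → Finset (ℤ × ℤ)) (K : Set Edge) (A : Finset (Fin n × (ℤ × ℤ)))
    (S : Finset (ℤ × ℤ)) (p : ℤ × ℤ) (w : Word Gen) : Prop where
  tiling : IsTiling t S A
  tile_edges : ∀ q ∈ A, ∀ e : Edge, Covers t q e.rightSquare → ¬ Covers t q e.leftSquare → e ∈ K
  conn : ConnAvoiding (↑S : Set (ℤ × ℤ))ᶜ {e | e ∈ trace p w}
  closed : endpoint p w = p
  nodup : (trace p w).Nodup
  edges : ∀ e ∈ trace p w, e ∈ K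
  left : ∀ e ∈ trace p w, e.leftSquare ∉ S
  boundary : ∀ e : Edge, e.rightSquare ∈ S → e.leftSquare ∉ S → e ∈ trace p w

theorem IsTiling.erase {S S' : Finset (ℤ × ℤ)} {A : Finset (Fin n × (ℤ × ℤ))}
    [DecidableEq (Fin n × (ℤ × ℤ))] (hA : IsTiling t S A) {q : Fin n × (ℤ × ℤ)} (hqA : q ∈ A)
    (hmS' : ∀ c, c ∈ S' ↔ c ∈ S ∧ ¬ Covers t q c) : IsTiling t S' (A.erase q) := by
  constructor
  · intro q' hq' c hc
    obtain ⟨h1, h2⟩ := Finset.mem_erase.1 hq'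
    have hcS := hA.1 q' h2 c hc
    refine (hmS' c).2 ⟨hcS, fun h => h1 ?_⟩
    obtain ⟨q'', -, hu'⟩ := hA.2 c hcS
    rw [hu' q' ⟨h2, hc⟩, hu' q ⟨hqA, h⟩]
  · intro c hc
    obtain ⟨h1, h2⟩ := (hmS' c).1 hc
    obtain ⟨q', ⟨h3, h4⟩, hu'⟩ := hA.2 c h1
    refine ⟨q', ⟨Finset.mem_erase.2 ⟨fun h => h2 (h ▸ h4), h3⟩, h4⟩, fun q'' h => ?_⟩
    exact hu' q'' ⟨Finset.mem_of_mem_erase h.1, h.2⟩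

theorem mem_trace_winv {p : ℤ × ℤ} {w : Word Gen} {e : Edge} :
    e ∈ trace (endpoint p w) (winv w) ↔ e.rev ∈ trace p w := by
  rw [trace_winv, List.mem_reverse, List.mem_map]
  constructor
  · rintro ⟨e', he', rfl⟩
    rwa [Edge.rev_rev]
  · intro h
    exact ⟨_, h, Edge.rev_rev e⟩

/-- The boundary path of a tile, started with a given edge: the rest of it, traversed backwards. -/
theorem exists_backward_path {q : ℤ × ℤ} {w : Word Gen} (hq : endpoint q w = q)
    (hnd : (trace q w).Nodup) {p : ℤ × ℤ} {a : Gen × Bool} (h : (p, a) ∈ trace q w) :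
    ∃ u y, w = u ++ a :: y ∧ endpoint q u = p ∧ endpoint p (winv (y ++ u)) = p + letterVec a ∧
      (trace p (winv (y ++ u))).Nodup ∧
      ∀ e, e ∈ trace p (winv (y ++ u)) ↔ e.rev ∈ trace q w ∧ e.rev ≠ (p, a) := by
  obtain ⟨u, y, rfl, hu⟩ := exists_split_of_mem_trace h
  simp only at hq hnd hu ⊢
  rw [endpoint_append, hu] at hq
  simp only [endpoint] at hq
  rw [trace_append, hu] at hnd ⊢
  simp only [trace] at hnd ⊢
  rw [List.nodup_middle] at hnd
  obtain ⟨h1, h2⟩ := List.nodup_cons.1 hnd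
  have hback : endpoint (p + letterVec a) (y ++ u) = p := by rw [endpoint_append, hq, hu]
  have htr : trace (p + letterVec a) (y ++ u) = trace (p + letterVec a) y ++ trace q u := by
    rw [trace_append, hq]
  refine ⟨u, y, rfl, hu, ?_, ?_, fun e => ?_⟩
  · have := endpoint_winv (p + letterVec a) (y ++ u)
    rwa [hback] at this
  · have := trace_winv (p + letterVec a) (y ++ u)
    rw [hback] at this
    rw [this, List.nodup_reverse, htr]
    exact (List.nodup_append_comm.1 h2).map Edge.rev_injective
  · have := mem_trace_winv (p := p + letterVec a) (w := y ++ u) (e := e)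
    rw [hback, htr] at this
    rw [this]
    simp only [List.mem_append, List.mem_cons] at h1 ⊢
    constructor
    · intro h
      exact ⟨by tauto, fun he => h1 (by rw [← he]; tauto)⟩
    · tauto

/-- The induction step that removes the tile on the right of the first edge. -/
theorem Encloses.fill_of_right_mem (ht : ∀ i, EdgeConn (t i : Set (ℤ × ℤ)))
    (hr : ∀ i, IsBoundaryWord (t i) (b i) (r i)) {K : Set Edge} (hKrev : ∀ e ∈ K, e.rev ∈ K)
    {A : Finset (Fin n × (ℤ × ℤ))} {S : Finset (ℤ × ℤ)} {p : ℤ × ℤ} {a : Gen × Bool} {v : Word Gen}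
    (h : Encloses t K A S p (a :: v)) (hfr : Edge.rightSquare (p, a) ∈ S)
    (ih : ∀ A' S' w', A'.card < A.card → Encloses t K A' S' p w' → ∃ L, IsFilling b r K A' p w' L) :
    ∃ L, IsFilling b r K A p (a :: v) L := by
  classical
  obtain ⟨hA, hAK, hconn, hw, hnd, hK, hleft, hbd⟩ := h
  simp only [trace, endpoint] at hw hnd hK hleft hbd hconn
  obtain ⟨hnd1, hnd2⟩ := List.nodup_cons.1 hnd
  have hfl : Edge.leftSquare (p, a) ∉ S := hleft (p, a) List.mem_cons_self
  obtain ⟨q, ⟨hqA, hqf⟩, -⟩ := hA.2 _ hfr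
  have hqS : ∀ c, Covers t q c → c ∈ S := hA.1 q hqA
  obtain ⟨hq1, hq2, hq3⟩ := isBoundaryWord_translate (hr q.1) q.2
  have hfq : (p, a) ∈ trace (b q.1 + q.2) (r q.1) := (hq3 _).2 ⟨hqf, fun h => hfl (hqS _ h)⟩
  -- The tile's boundary word is `u a y`. The new path replaces the first edge `a` by the rest of
  -- this boundary, run backwards from `p` to the end of `a`.
  obtain ⟨u, y, huy, hu, hback, hnd', hmem⟩ := exists_backward_path hq1 hq2 hfq
  have hmem' : ∀ e : Edge, e ∈ trace p (winv (y ++ u) ++ v) ↔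
      ((Covers t q e.leftSquare ∧ ¬ Covers t q e.rightSquare) ∧ e.rev ≠ (p, a)) ∨
        e ∈ trace (p + letterVec a) v := by
    intro e
    rw [trace_append, hback, List.mem_append, hmem, hq3, Edge.rightSquare_rev, Edge.leftSquare_rev]
    rfl
  have hconn' := hconn.mono (E' := {e | e ∈ trace p (winv (y ++ u) ++ v)}) (fun e he h1 h2 => by
    rcases (hmem' e).1 he with h | h
    · exact absurd (hqS _ h.1.1) h1
    · exact List.mem_cons_of_mem _ h)
  have hleft' : ∀ e ∈ trace (p + letterVec a) v, ¬ Covers t q e.leftSquare := fun e he h =>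
    hleft e (List.mem_cons_of_mem _ he) (hqS _ h)
  have hconnq : ConnAvoiding {c | Covers t q c} {e | e ∈ trace p (winv (y ++ u) ++ v)} :=
    ((ht q.1).translate q.2).avoiding fun e he h1 h2 => by
      rcases (hmem' e).1 he with h | h
      · exact h.1.2 h2
      · exact hleft' e h h1
  -- The new complement is the old one together with the tile. They are joined across the first
  -- edge, which the new path traverses in neither direction.
  have hU := hconn'.union hconnq (e := (p, a)) (by simpa using hfl) hqf
    (fun h => by
      rcases (hmem' _).1 h with h | h
      · exact hfl (hqS _ h.1.1)
      · exact hnd1 h)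
    (fun h => by
      rcases (hmem' _).1 h with h | h
      · exact h.2 (Edge.rev_rev _)
      · exact hleft' _ h (by rwa [Edge.leftSquare_rev]))
  have hmS' : ∀ c, c ∈ S.filter (fun c => ¬ Covers t q c) ↔ c ∈ S ∧ ¬ Covers t q c :=
    fun c => Finset.mem_filter
  have henc : Encloses t K (A.erase q) (S.filter fun c => ¬ Covers t q c) p
      (winv (y ++ u) ++ v) := by
    refine ⟨hA.erase hqA hmS', fun q' hq' => hAK q' (Finset.mem_of_mem_erase hq'), ?_, ?_, ?_,
      fun e he => ?_, fun e he h => ?_, fun e h1 h2 => ?_⟩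
    · convert! hU using 1
      ext c
      simp only [Set.mem_compl_iff, Finset.mem_coe, hmS', Set.mem_union, Set.mem_ofPred_eq]
      tauto
    · rw [endpoint_append, hback, hw]
    · rw [trace_append, hback, List.nodup_append']
      refine ⟨hnd', hnd2, fun e h1 h2 => hleft' e h2 ?_⟩
      have := ((hq3 _).1 ((hmem e).1 h1).1).1
      rwa [Edge.rightSquare_rev] at this
    · rcases (hmem' e).1 he with h | h
      · rw [← Edge.rev_rev e]
        refine hKrev _ (hAK q hqA _ ?_ ?_)
        · rw [Edge.rightSquare_rev]; exact h.1.1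
        · rw [Edge.leftSquare_rev]; exact h.1.2
      · exact hK e (List.mem_cons_of_mem _ h)
    · obtain ⟨h1, h2⟩ := (hmS' _).1 h
      rcases (hmem' e).1 he with h | h
      · exact h2 h.1.1
      · exact hleft e (List.mem_cons_of_mem _ h) h1
    · obtain ⟨h3, h4⟩ := (hmS' _).1 h1
      rw [hmem']
      by_cases h5 : e.leftSquare ∈ S
      · left
        refine ⟨⟨by_contra fun h => h2 ((hmS' _).2 ⟨h5, h⟩), h4⟩, fun h => hfl ?_⟩
        rw [← h, Edge.leftSquare_rev]
        exact h3
      · right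
        rcases List.mem_cons.1 (hbd e h3 h5) with h | h
        · exact absurd (h ▸ hqf) h4
        · exact h
  obtain ⟨L, hL⟩ := ih _ _ _ (Finset.card_erase_lt_of_mem hqA) henc
  have hu' : endpoint p (winv u) = b q.1 + q.2 := by
    have := endpoint_winv (b q.1 + q.2) u
    rwa [hu] at this
  have hone : IsFilling b r K {q} (endpoint p (winv u)) (r q.1) [([], q.1)] := by
    refine ⟨?_, by simp [trace], by simp, fun q' => ?_⟩
    · rw [List.map_singleton, List.prod_singleton, ← FreeGroup.one_eq_mk, one_mul, inv_one, mul_one]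
    · simp [hu', endpoint]
  -- In the free group, `a v = u⁻¹ (u a y) u · (y u)⁻¹ v`: one conjugate of the tile's word, times
  -- the new path.
  have hres := hone.mul_conj hL (w := a :: v) (by simp)
    (fun e he => by
      have h1 := mem_trace_winv (p := b q.1 + q.2) (w := u) (e := e)
      rw [hu] at h1
      have h2 := h1.1 he
      have h3 : e.rev ∈ trace (b q.1 + q.2) (r q.1) := by
        rw [huy, trace_append]
        exact List.mem_append_left _ h2
      obtain ⟨h4, h5⟩ := (hq3 _).1 h3
      rw [← Edge.rev_rev e]
      exact hKrev _ (hAK q hqA _ h4 h5))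
    (by
      rw [huy, ← List.singleton_append, ← List.singleton_append (l := y)]
      simp only [winv, ← FreeGroup.mul_mk, ← FreeGroup.inv_mk]
      group)
  rw [← Finset.insert_eq, Finset.insert_erase hqA] at hres
  exact ⟨_, hres⟩

/-- The induction step that splits the path at the first edge, which is traversed again in the
opposite direction. -/
theorem Encloses.fill_of_right_notMem (ht : ∀ i, EdgeConn (t i : Set (ℤ × ℤ)))
    (ht' : ∀ i, (t i).Nonempty) {K : Set Edge}
    {A : Finset (Fin n × (ℤ × ℤ))} {S : Finset (ℤ × ℤ)} {p : ℤ × ℤ} {a : Gen × Bool} {v : Word Gen}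
    (h : Encloses t K A S p (a :: v)) (hfr : Edge.rightSquare (p, a) ∉ S)
    (ih : ∀ A' S' p' w', A'.card ≤ A.card → w'.length ≤ v.length → Encloses t K A' S' p' w' →
      ∃ L, IsFilling b r K A' p' w' L) :
    ∃ L, IsFilling b r K A p (a :: v) L := by
  classical
  obtain ⟨hA, hAK, hconn, hw, hnd, hK, hleft, hbd⟩ := h
  simp only [trace, endpoint] at hw hnd hK hleft hbd hconn
  obtain ⟨hnd1, hnd2⟩ := List.nodup_cons.1 hnd
  set f : Edge := (p, a) with hf
  have hfl : f.leftSquare ∉ S := hleft f List.mem_cons_self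
  have hwind : ∀ c ∉ S, wind p (a :: v) c = 0 := fun c hc =>
    wind_eq_zero hconn (w := a :: v) hw (fun e he => he) hc
  -- Both sides of the first edge lie outside `S`, where the winding number vanishes. So the path
  -- runs through this edge equally often in both directions.
  have hcount := wind_jump (w := a :: v) hw f
  rw [hwind _ hfl, hwind _ hfr] at hcount
  have hfv : f.rev ∈ trace (p + letterVec a) v := by
    have h1 : 0 < List.count f (trace p (a :: v)) :=
      List.count_pos_iff.2 List.mem_cons_self
    have h2 : f.rev ∈ trace p (a :: v) := List.count_pos_iff.1 (by omega)
    rcases List.mem_cons.1 h2 with h | h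
    · exact absurd h (Edge.rev_ne f)
    · exact h
  obtain ⟨x, y, hxy, hx⟩ := exists_split_of_mem_trace hfv
  have hx' : endpoint (p + letterVec a) x = p + letterVec a := hx
  have hvec : p + letterVec a + letterVec (inv a) = p := by simp [letterVec_inv]
  have hxy' : v = x ++ inv a :: y := hxy
  have htv : trace (p + letterVec a) v = trace (p + letterVec a) x ++ f.rev :: trace p y := by
    rw [hxy', trace_append, hx']
    simp only [trace, hvec]
    rfl
  have hy : endpoint p y = p := by
    rw [hxy', endpoint_append, hx'] at hw
    simpa only [endpoint, hvec] using hw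
  rw [htv] at hnd1 hnd2 hK hleft hbd hconn
  obtain ⟨hndx, hndy, hdisj⟩ := List.nodup_append'.1 hnd2
  obtain ⟨hndr, hndy⟩ := List.nodup_cons.1 hndy
  have hxw : ∀ e ∈ trace (p + letterVec a) x,
      e ∈ f :: (trace (p + letterVec a) x ++ f.rev :: trace p y) := fun e he =>
    List.mem_cons_of_mem _ (List.mem_append_left _ he)
  have hyw : ∀ e ∈ trace p y,
      e ∈ f :: (trace (p + letterVec a) x ++ f.rev :: trace p y) := fun e he =>
    List.mem_cons_of_mem _ (List.mem_append_right _ (List.mem_cons_of_mem _ he))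
  -- The path is `a x a⁻¹ y` with `x` and `y` closed. The winding number of `x` is constant on the
  -- components of `S` and tells which of them `x` encloses; `y` gets the others.
  set W := wind (p + letterVec a) x with hW
  have hWout : ∀ c ∉ S, W c = 0 := fun c hc => wind_eq_zero hconn hx' hxw hc
  have hWin : ∀ e : Edge, e.leftSquare ∈ S → e.rightSquare ∈ S →
      W e.rightSquare = W e.leftSquare := by
    intro e h1 h2
    have := wind_jump hx' e
    rw [List.count_eq_zero_of_not_mem fun h => hleft e (hxw e h) h1,
      List.count_eq_zero_of_not_mem (a := e.rev) fun h => hleft _ (hxw _ h)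
        (by rwa [Edge.leftSquare_rev])] at this
    simp only [hW]
    linarith
  -- Outside `S` the value is 0, and the edge is traversed at most once and never backwards. So the
  -- value just inside is 1 or 0 according to whether `x` uses the edge.
  have hWbd : ∀ e : Edge, e.leftSquare ∉ S → e.rightSquare ∈ S →
      (e ∈ trace (p + letterVec a) x ↔ W e.rightSquare = 1) := by
    intro e h1 h2
    have := wind_jump hx' e
    rw [List.count_eq_zero_of_not_mem (a := e.rev) fun h => hleft _ (hxw _ h)
        (by rwa [Edge.leftSquare_rev]), ← hW, hWout _ h1, hndx.count] at this
    split_ifs at this with h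
    · exact ⟨fun _ => by simpa using this, fun _ => h⟩
    · exact ⟨fun h' => absurd h' h, fun h' => by simp [h'] at this⟩
  set S₁ := S.filter fun c => W c = 1 with hS₁
  set S₂ := S.filter fun c => ¬ W c = 1 with hS₂
  have hm₁ : ∀ c, c ∈ S₁ ↔ c ∈ S ∧ W c = 1 := fun c => by rw [hS₁, Finset.mem_filter]
  have hm₂ : ∀ c, c ∈ S₂ ↔ c ∈ S ∧ ¬ W c = 1 := fun c => by rw [hS₂, Finset.mem_filter]
  set A₁ := A.filter fun q => ∃ c ∈ S₁, Covers t q c with hA₁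
  set A₂ := A.filter fun q => ∃ c ∈ S₂, Covers t q c with hA₂
  have ht₁ : IsTiling t S₁ A₁ := hA.restrict ht (Finset.filter_subset _ _)
    (fun e h1 h2 => by
      obtain ⟨h3, h4⟩ := (hm₁ _).1 h1
      exact (hm₁ _).2 ⟨h2, by rw [hWin e h3 h2, h4]⟩)
    (fun q => by rw [hA₁, Finset.mem_filter])
  have ht₂ : IsTiling t S₂ A₂ := hA.restrict ht (Finset.filter_subset _ _)
    (fun e h1 h2 => by
      obtain ⟨h3, h4⟩ := (hm₂ _).1 h1
      exact (hm₂ _).2 ⟨h2, by rwa [hWin e h3 h2]⟩)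
    (fun q => by rw [hA₂, Finset.mem_filter])
  have hdA : Disjoint A₁ A₂ := by
    refine Finset.disjoint_left.2 fun q h1 h2 => ?_
    obtain ⟨-, c, hc, hqc⟩ := Finset.mem_filter.1 h2
    exact ((hm₂ c).1 hc).2 ((hm₁ c).1 (ht₁.1 q h1 c hqc)).2
  -- Nonemptiness of the tiles is what assigns each of them to at least one of the two parts.
  have hUA : A₁ ∪ A₂ = A := by
    refine Finset.Subset.antisymm
      (Finset.union_subset (Finset.filter_subset _ _) (Finset.filter_subset _ _)) fun q hq => ?_
    obtain ⟨c, hc⟩ := ht' q.1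
    have hc' : Covers t q (c + q.2) := by simpa [Covers] using hc
    have hcS := hA.1 q hq _ hc'
    by_cases h : W (c + q.2) = 1
    · exact Finset.mem_union_left _
        (Finset.mem_filter.2 ⟨hq, _, (hm₁ _).2 ⟨hcS, h⟩, hc'⟩)
    · exact Finset.mem_union_right _
        (Finset.mem_filter.2 ⟨hq, _, (hm₂ _).2 ⟨hcS, h⟩, hc'⟩)
  have hcard₁ : A₁.card ≤ A.card := Finset.card_filter_le _ _
  have hcard₂ : A₂.card ≤ A.card := Finset.card_filter_le _ _
  have hlen : v.length = x.length + (y.length + 1) := by rw [hxy']; simp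
  have henc₁ : Encloses t K A₁ S₁ (p + letterVec a) x := by
    refine ⟨ht₁, fun q hq => hAK q (Finset.mem_of_mem_filter q hq), ?_, hx', hndx,
      fun e he => hK e (hxw e he), fun e he h => hleft e (hxw e he) ((hm₁ _).1 h).1,
      fun e h1 h2 => ?_⟩
    · refine hconn.compl_of_components (Finset.filter_subset _ _) (fun e h1 h2 => ?_) hxw
        (fun e he => hleft e (hxw e he))
        (fun e he h => (hm₁ _).2 ⟨h, (hWbd e (hleft e (hxw e he)) h).1 he⟩)
      obtain ⟨h3, h4⟩ := (hm₁ _).1 h2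
      exact (hm₁ _).2 ⟨h1, by rw [← hWin e h1 h3, h4]⟩
    · obtain ⟨h3, h4⟩ := (hm₁ _).1 h1
      have h5 : e.leftSquare ∉ S := fun h => h2 ((hm₁ _).2 ⟨h, by rw [← hWin e h h3, h4]⟩)
      exact (hWbd e h5 h3).2 h4
  have henc₂ : Encloses t K A₂ S₂ p y := by
    refine ⟨ht₂, fun q hq => hAK q (Finset.mem_of_mem_filter q hq), ?_, hy, hndy,
      fun e he => hK e (hyw e he), fun e he h => hleft e (hyw e he) ((hm₂ _).1 h).1,
      fun e h1 h2 => ?_⟩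
    · refine hconn.compl_of_components (Finset.filter_subset _ _) (fun e h1 h2 => ?_) hyw
        (fun e he => hleft e (hyw e he))
        (fun e he h => (hm₂ _).2 ⟨h, fun h' => hdisj
          ((hWbd e (hleft e (hyw e he)) h).2 h') (List.mem_cons_of_mem _ he)⟩)
      obtain ⟨h3, h4⟩ := (hm₂ _).1 h2
      exact (hm₂ _).2 ⟨h1, by rwa [← hWin e h1 h3]⟩
    · obtain ⟨h3, h4⟩ := (hm₂ _).1 h1
      have h5 : e.leftSquare ∉ S := fun h => h2 ((hm₂ _).2 ⟨h, by rwa [← hWin e h h3]⟩)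
      -- The edge is on the path `a x a⁻¹ y`. It is neither `a` nor its reverse, which have no
      -- square of `S` on the right, and it is not in `x`, because `W` is not 1 there.
      rcases List.mem_cons.1 (hbd e h3 h5) with h | h
      · exact absurd (h ▸ h3) hfr
      rcases List.mem_append.1 h with h | h
      · exact absurd ((hWbd e h5 h3).1 h) h4
      rcases List.mem_cons.1 h with h | h
      · rw [h, Edge.rightSquare_rev] at h3
        exact absurd h3 hfl
      · exact h
  obtain ⟨L₁, hL₁⟩ := ih A₁ S₁ (p + letterVec a) x hcard₁ (by omega) henc₁
  obtain ⟨L₂, hL₂⟩ := ih A₂ S₂ p y hcard₂ (by omega) henc₂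
  have hres := hL₁.mul_conj (p := p) (g := [a]) (w := a :: v) hL₂ hdA
    (fun e he => hK e (by
      rw [List.mem_singleton.1 he]; exact List.mem_cons_self))
    (by
      rw [hxy', ← List.singleton_append, ← List.singleton_append (l := y)]
      simp only [← FreeGroup.mul_mk]
      have : FreeGroup.mk [inv a] = (FreeGroup.mk [a])⁻¹ := by
        rw [FreeGroup.inv_mk]; rfl
      rw [this]
      group)
  rw [hUA] at hres
  exact ⟨_, hres⟩

/-- Lexicographic induction on the number of tiles and the length of the path. Removing a tile may
lengthen the path but lowers the first entry; splitting does not raise the number of tiles and gives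
shorter paths. -/
theorem Encloses.exists_filling (ht : ∀ i, EdgeConn (t i : Set (ℤ × ℤ)))
    (ht' : ∀ i, (t i).Nonempty) (hr : ∀ i, IsBoundaryWord (t i) (b i) (r i)) {K : Set Edge}
    (hKrev : ∀ e ∈ K, e.rev ∈ K) (A : Finset (Fin n × (ℤ × ℤ))) (S : Finset (ℤ × ℤ)) (p : ℤ × ℤ)
    (w : Word Gen) (h : Encloses t K A S p w) : ∃ L, IsFilling b r K A p w L := by
  match w with
  | [] =>
    have hS : S = ∅ := by
      by_contra hS
      obtain ⟨e, h1, h2⟩ := exists_boundary_edge (Finset.nonempty_iff_ne_empty.2 hS)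
      exact absurd (h.boundary e h1 h2) (by simp [trace])
    have hA' : A = ∅ := by
      refine Finset.eq_empty_of_forall_notMem fun q hq => ?_
      obtain ⟨c, hc⟩ := ht' q.1
      have := h.tiling.1 q hq (c + q.2) (by simpa [Covers] using hc)
      simp [hS] at this
    subst hA'
    exact ⟨[], by simp [IsFilling, FreeGroup.one_eq_mk]⟩
  | a :: v =>
    by_cases hfr : Edge.rightSquare (p, a) ∈ S
    · exact h.fill_of_right_mem ht hr hKrev hfr fun A' S' w' hA' h' =>
        exists_filling ht ht' hr hKrev A' S' p w' h'
    · exact h.fill_of_right_notMem ht ht' hfr fun A' S' p' w' hA' hw' h' =>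
        exists_filling ht ht' hr hKrev A' S' p' w' h'
termination_by (A.card, w.length)
decreasing_by
  all_goals simp only [Prod.lex_def, List.length_cons]
  all_goals omega

end Filling

/-! ### The boundary word of a region -/

/-- Consider the four squares around the end of `e`. If no outgoing edge were a boundary edge with
`S` on its right, membership in `S` would pass counterclockwise from square to square, from the
right of `e` round to its left. -/
theorem exists_next_boundary_edge {S : Finset (ℤ × ℤ)} {e : Edge}
    (h : e.rightSquare ∈ S ∧ e.leftSquare ∉ S) :
    ∃ f : Edge, (f.rightSquare ∈ S ∧ f.leftSquare ∉ S) ∧ f.1 = e.1 + letterVec e.2 := by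
  obtain ⟨⟨i, j⟩, a⟩ := e
  by_contra! hf
  have key : ∀ c, Edge.rightSquare ((i, j) + letterVec a, c) ∈ S →
      Edge.leftSquare ((i, j) + letterVec a, c) ∈ S := fun c hc => by
    by_contra hc'
    exact hf _ ⟨hc, hc'⟩ rfl
  have h1 := key (.x, true)
  have h2 := key (.x, false)
  have h3 := key (.y, true)
  have h4 := key (.y, false)
  obtain ⟨a, ε⟩ := a
  cases a <;> cases ε <;>
    simp [Edge.rightSquare, Edge.leftSquare, letterVec] at h h1 h2 h3 h4 <;> grind

theorem Edge.ext_rightSquare {e f : Edge} (h : e.rightSquare = f.rightSquare) (h' : e.2 = f.2) :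
    e = f := by
  obtain ⟨⟨i, j⟩, a, ε⟩ := e
  obtain ⟨⟨k, l⟩, b, δ⟩ := f
  simp only at h'
  obtain ⟨rfl, rfl⟩ := Prod.mk.inj h'
  cases a <;> cases ε <;> simp [Edge.rightSquare] at h ⊢ <;> omega

theorem trace_of_chain {e : ℕ → Edge} (he : ∀ k, (e (k + 1)).1 = (e k).1 + letterVec (e k).2)
    (m i : ℕ) :
    trace (e i).1 ((List.range' i m).map fun k => (e k).2) = (List.range' i m).map e ∧
      endpoint (e i).1 ((List.range' i m).map fun k => (e k).2) = (e (i + m)).1 := by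
  induction m generalizing i with
  | zero => exact ⟨rfl, rfl⟩
  | succ m ih =>
    simp only [List.range'_succ, List.map_cons, trace, endpoint, ← he]
    refine ⟨by rw [(ih (i + 1)).1], ?_⟩
    rw [(ih (i + 1)).2]
    congr 2
    omega

/-- Following boundary edges until one repeats gives a closed path without repeated edges. Its
winding number is 0 outside `S` and constant on `S`. By the jump formula this constant is the number
of times that the path uses any given boundary edge, so using one means using all. The choice of
continuation at a vertex is irrelevant. -/
theorem exists_isBoundaryWord {S : Finset (ℤ × ℤ)} (hne : S.Nonempty)
    (hS : EdgeConn (S : Set (ℤ × ℤ))) (hS' : EdgeConn (S : Set (ℤ × ℤ))ᶜ) :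
    ∃ p w, IsBoundaryWord S p w := by
  obtain ⟨e₀, he₀⟩ := exists_boundary_edge hne
  choose! F hF hF' using fun e : Edge => exists_next_boundary_edge (S := S) (e := e)
  let e : ℕ → Edge := fun k => F^[k] e₀
  have hb : ∀ k, (e k).rightSquare ∈ S ∧ (e k).leftSquare ∉ S := by
    intro k
    induction k with
    | zero => exact he₀
    | succ k ih =>
      simp only [e, Function.iterate_succ_apply']
      exact hF _ ih
  have hnext : ∀ k, (e (k + 1)).1 = (e k).1 + letterVec (e k).2 := by
    intro k
    simp only [e, Function.iterate_succ_apply']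
    exact hF' _ (hb k)
  have hex : ∃ j, ∃ i < j, e i = e j := by
    have : Finite Gen := ⟨Equiv.ofBijective (fun g : Gen => if g = .x then (0 : Fin 2) else 1) (by
      constructor
      · intro a b; cases a <;> cases b <;> simp
      · intro k; fin_cases k
        · exact ⟨.x, by simp⟩
        · exact ⟨.y, by simp⟩)⟩
    obtain ⟨i, j, hij, h⟩ := Finite.exists_ne_map_eq_of_infinite
      (fun k => ((⟨_, (hb k).1⟩ : S), (e k).2))
    obtain ⟨h1, h2⟩ := Prod.mk.inj h
    have h3 := Edge.ext_rightSquare (Subtype.ext_iff.1 h1) h2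
    rcases lt_or_gt_of_ne hij with h | h
    · exact ⟨j, i, h, h3⟩
    · exact ⟨i, j, h, h3.symm⟩
  classical
  -- `j` is the first index at which an earlier edge recurs, so the edges with indices from `i` to
  -- `j - 1` are distinct.
  obtain ⟨i, hij, heq⟩ := Nat.find_spec hex
  have hmin := fun k => Nat.find_min hex (m := k)
  set j := Nat.find hex
  obtain ⟨h1, h2⟩ := trace_of_chain hnext (j - i) i
  rw [Nat.add_sub_cancel' hij.le, ← heq] at h2
  set w := (List.range' i (j - i)).map fun k => (e k).2
  have hmem : ∀ f ∈ trace (e i).1 w, f.rightSquare ∈ S ∧ f.leftSquare ∉ S := by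
    intro f hf
    rw [h1] at hf
    obtain ⟨k, -, rfl⟩ := List.mem_map.1 hf
    exact hb k
  have hnd : (trace (e i).1 w).Nodup := by
    rw [h1]
    refine List.Nodup.map_on ?_ List.nodup_range'
    intro k hk l hl hkl
    rw [List.mem_range'_1] at hk hl
    rcases lt_trichotomy k l with h | h | h
    · exact absurd ⟨k, h, hkl⟩ (hmin l (by omega))
    · exact h
    · exact absurd ⟨l, h, hkl.symm⟩ (hmin k (by omega))
  have hjump : ∀ f : Edge, f.rightSquare ∈ S → f.leftSquare ∉ S →
      wind (e i).1 w f.rightSquare = (trace (e i).1 w).count f := by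
    intro f hf hf'
    have h3 := wind_jump h2 f
    rw [wind_eq_zero (E := {f | f ∈ trace (e i).1 w})
      (hS'.avoiding fun f hf _ h => absurd (hmem f hf).1 h) h2 (fun _ h => h) hf',
      List.count_eq_zero_of_not_mem (a := f.rev)
        (fun h => hf' (by rw [← Edge.rightSquare_rev]; exact (hmem _ h).1))] at h3
    simpa using h3
  have hi : e i ∈ trace (e i).1 w := by
    rw [h1]
    exact List.mem_map_of_mem (by rw [List.mem_range'_1]; omega)
  refine ⟨(e i).1, w, h2, hnd, fun f => ⟨hmem f, fun ⟨hf, hf'⟩ => ?_⟩⟩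
  have h3 : wind (e i).1 w (e i).rightSquare = wind (e i).1 w f.rightSquare := by
    refine hS.eq _ (fun g hg hg' _ _ => ?_) (hb i).1 hf
    have := wind_jump h2 g
    rw [List.count_eq_zero_of_not_mem fun h => (hmem _ h).2 hg,
      List.count_eq_zero_of_not_mem (a := g.rev) fun h => (hmem _ h).2
        (by rwa [Edge.leftSquare_rev])] at this
    linarith
  rw [hjump _ (hb i).1 (hb i).2, hjump f hf hf'] at h3
  have h4 := List.count_pos_iff.2 hi
  exact List.count_pos_iff.1 (by omega)

/-! ### From fillings to pictures -/

section Pictures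

variable {ι : Type*} {r : ι → Word Gen}

theorem diskList_append {α : Type*} (l m : List (Step α ι)) :
    diskList (l ++ m) = diskList l ++ diskList m := by
  simp [diskList]

theorem diskList_noDisk {α : Type*} {l : List (Step α ι)} (h : ∀ s ∈ l, s.NoDisk) :
    diskList l = [] := by
  rw [diskList, List.filterMap_eq_nil_iff]
  intro s hs
  have := h s hs
  obtain ⟨u, A, v⟩ := s
  cases A with
  | cup a => rfl
  | cap a => rfl
  | disk i ε => exact absurd rfl (this i ε)

theorem endpoint_eq_add (p : ℤ × ℤ) (w : Word Gen) :
    endpoint p w = p + (expSum w .x, expSum w .y) := by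
  induction w generalizing p with
  | nil => simp [endpoint, expSum]
  | cons a w ih =>
    rw [← List.singleton_append, expSum_append, endpoint_append, ih]
    obtain ⟨a, ε⟩ := a
    cases a <;> cases ε <;> ext <;> simp [endpoint, expSum, letterVec] <;> ring

theorem expSum_eq_zero {p : ℤ × ℤ} {w : Word Gen} (h : endpoint p w = p) : expSum w = 0 := by
  rw [endpoint_eq_add, add_eq_left, Prod.mk_eq_zero] at h
  ext a
  cases a
  · exact h.1
  · exact h.2

theorem trace_cancel (p : ℤ × ℤ) (u : Word Gen) (a : Gen × Bool) (v : Word Gen) :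
    trace p (u ++ a :: inv a :: v) =
      trace p u ++ (endpoint p u, a) :: Edge.rev (endpoint p u, a) ::
        trace (endpoint p u) v := by
  rw [trace_append]
  simp only [trace]
  rw [add_assoc, letterVec_inv, add_neg_cancel, add_zero]
  rfl

/-- All words along the tops of the slabs develop to paths in `K`. -/
def TopsIn (r : ι → Word Gen) (K : Set Edge) (p : ℤ × ℤ) (l : List (Step Gen ι)) : Prop :=
  ∀ s ∈ l, ∀ e ∈ trace p (s.tgt r), e ∈ K

theorem TopsIn.append {K : Set Edge} {p : ℤ × ℤ} {l m : List (Step Gen ι)}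
    (hl : TopsIn r K p l) (hm : TopsIn r K p m) : TopsIn r K p (l ++ m) := fun s hs =>
  (List.mem_append.1 hs).elim (hl s) (hm s)

theorem TopsIn.singleton {K : Set Edge} {p : ℤ × ℤ} {s : Step Gen ι}
    (h : ∀ e ∈ trace p (s.tgt r), e ∈ K) : TopsIn r K p [s] := fun s' hs' => by
  rw [List.mem_singleton.1 hs']; exact h

/-- A cancellation is a cap, and its inverse is a cup. Both directions are needed because freely
equal words are connected through a common reduct. All intermediate words arise from `u` by
cancellation, so they stay in `K`. -/
theorem exists_path_of_red {K : Set Edge} {p : ℤ × ℤ} {u v : Word Gen} (h : FreeGroup.Red u v)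
    (hu : ∀ e ∈ trace p u, e ∈ K) :
    (∀ e ∈ trace p v, e ∈ K) ∧
      (∃ l : List (Step Gen ι), IsPath r u l v ∧ (∀ s ∈ l, s.NoDisk) ∧ TopsIn r K p l) ∧
      ∃ l : List (Step Gen ι), IsPath r v l u ∧ (∀ s ∈ l, s.NoDisk) ∧ TopsIn r K p l := by
  induction h with
  | refl => exact ⟨hu, ⟨[], rfl, by simp, by simp [TopsIn]⟩, [], rfl, by simp, by simp [TopsIn]⟩
  | @tail v v' _ hstep ih =>
    obtain ⟨hv, ⟨l, hl1, hl2, hl3⟩, m, hm1, hm2, hm3⟩ := ih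
    obtain @⟨x, y, a, ε⟩ := hstep
    have hv1 : ∀ e ∈ trace p (x ++ (a, ε) :: inv (a, ε) :: y), e ∈ K := hv
    have hv' : ∀ e ∈ trace p (x ++ y), e ∈ K := by
      intro e he
      apply hv1
      rw [trace_cancel]
      rw [trace_append] at he
      simp only [List.mem_append, List.mem_cons] at he ⊢
      tauto
    refine ⟨hv', ⟨l ++ [⟨x, .cap (a, ε), y⟩], isPath_append hl1 ?_, ?_, hl3.append (.singleton ?_)⟩,
      [⟨x, .cup (a, ε), y⟩] ++ m, isPath_append ?_ hm1, ?_, TopsIn.append (.singleton ?_) hm3⟩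
    · simp [IsPath, Step.src, Step.tgt, Atom.src, Atom.tgt, inv]
    · intro s hs
      rcases List.mem_append.1 hs with hs | hs
      · exact hl2 s hs
      · rw [List.mem_singleton.1 hs]; intro i ε; simp
    · simpa [Step.tgt, Atom.tgt] using hv'
    · simp [IsPath, Step.src, Step.tgt, Atom.src, Atom.tgt, inv]
    · intro s hs
      rcases List.mem_append.1 hs with hs | hs
      · rw [List.mem_singleton.1 hs]; intro i ε; simp
      · exact hm2 s hs
    · simpa [Step.tgt, Atom.tgt] using hv1

/-- The right halves of the nested arcs retrace `g` backwards, so `K` has to be closed under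
reversal. -/
theorem topsIn_cups {K : Set Edge} (hK : ∀ e ∈ K, e.rev ∈ K) {p : ℤ × ℤ} (g u v : Word Gen)
    (hu : ∀ e ∈ trace p (u ++ g), e ∈ K) (hv : ∀ e ∈ trace (endpoint p u) v, e ∈ K) :
    TopsIn r K p (cups ι u g v) := by
  induction g generalizing u v with
  | nil => simp [cups, TopsIn]
  | cons a g ih =>
    have h1 : ∀ e ∈ trace p (u ++ [a] ++ g), e ∈ K := by simpa using hu
    have h2 : (endpoint p u, a) ∈ K := hu _ (by simp [trace_append, trace])
    have h3 : endpoint p (u ++ [a]) = endpoint p u + letterVec a := by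
      rw [endpoint_append]; rfl
    have h4 : ∀ e ∈ trace (endpoint p (u ++ [a])) (inv a :: v), e ∈ K := by
      intro e he
      rw [h3] at he
      simp only [trace] at he
      rw [add_assoc, letterVec_inv, add_neg_cancel, add_zero] at he
      rcases List.mem_cons.1 he with rfl | he
      · exact hK _ h2
      · exact hv e he
    refine TopsIn.append (l := [_]) (.singleton fun e he => ?_) (ih (u ++ [a]) (inv a :: v) h1 h4)
    have h5 : Step.tgt r ⟨u, .cup a, v⟩ = (u ++ [a]) ++ inv a :: v := by
      simp [Step.tgt, Atom.tgt]
    rw [h5, trace_append] at he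
    rcases List.mem_append.1 he with he | he
    · refine h1 e ?_
      rw [trace_append]
      exact List.mem_append_left _ he
    · exact h4 e he

/-- A picture of a product of conjugates of relators. -/
theorem exists_path_of_conjugates {K : Set Edge} (hK : ∀ e ∈ K, e.rev ∈ K) {p : ℤ × ℤ}
    (L : List (Word Gen × ι)) (hL : ∀ x ∈ L, (∀ e ∈ trace p (x.1 ++ r x.2), e ∈ K) ∧
      endpoint (endpoint p x.1) (r x.2) = endpoint p x.1)
    (u : Word Gen) (hu : ∀ e ∈ trace p u, e ∈ K) (hu' : endpoint p u = p) :
    ∃ l u', IsPath r u l u' ∧ TopsIn r K p l ∧ (∀ e ∈ trace p u', e ∈ K) ∧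
      FreeGroup.mk u' = FreeGroup.mk u * (L.map fun x =>
        FreeGroup.mk x.1 * FreeGroup.mk (r x.2) * (FreeGroup.mk x.1)⁻¹).prod ∧
      (diskList l).map (fun d => (d.1, d.2.1, endpoint p d.2.2)) =
        L.map fun x => (x.2, true, endpoint p x.1) := by
  induction L generalizing u with
  | nil => exact ⟨[], u, rfl, by simp [TopsIn], hu, by simp, rfl⟩
  | cons x L ih =>
    obtain ⟨g, i⟩ := x
    obtain ⟨h1, h2⟩ := hL _ List.mem_cons_self
    simp only at h1 h2
    have hg : ∀ e ∈ trace p g, e ∈ K := fun e he => h1 e (by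
      rw [trace_append]; exact List.mem_append_left _ he)
    have hug : ∀ e ∈ trace p (u ++ g), e ∈ K := by
      intro e he
      rw [trace_append, hu'] at he
      exact (List.mem_append.1 he).elim (hu e) (hg e)
    have hug' : endpoint p (u ++ g) = endpoint p g := by rw [endpoint_append, hu']
    have hinv : ∀ e ∈ trace (endpoint p g) (winv g), e ∈ K := fun e he => by
      rw [← Edge.rev_rev e]
      exact hK _ (hg _ (mem_trace_winv.1 he))
    have hall : ∀ e ∈ trace p (u ++ g ++ r i ++ winv g), e ∈ K := by
      intro e he
      rw [trace_append p (u ++ g ++ r i), trace_append p (u ++ g), endpoint_append p (u ++ g), hug',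
        h2] at he
      rcases List.mem_append.1 he with he | he
      · rcases List.mem_append.1 he with he | he
        · exact hug e he
        · exact h1 e (by rw [trace_append]; exact List.mem_append_right _ he)
      · exact hinv e he
    have hend : endpoint p (u ++ g ++ r i ++ winv g) = p := by
      rw [endpoint_append, endpoint_append, hug', h2, endpoint_winv]
    obtain ⟨l, u', hl1, hl2, hl3, hl4, hl5⟩ :=
      ih (fun x hx => hL x (List.mem_cons_of_mem _ hx)) _ hall hend
    have hdisk : Step.tgt r ⟨u ++ g, .disk i true, winv g⟩ = u ++ g ++ r i ++ winv g := by
      simp [Step.tgt, Atom.tgt, diskWord]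
    -- The disk sits between the two halves of nested arcs spelling `g`, to the right of `u`. As `u`
    -- is closed, the disk's basepoint develops to the end of `g`.
    refine ⟨cups ι u g [] ++ ([⟨u ++ g, .disk i true, winv g⟩] ++ l), u', ?_, ?_, hl3, ?_, ?_⟩
    · refine isPath_append (by simpa using isPath_cups (r := r) (ι := ι) u g []) ?_
      refine ⟨by simp [Step.src, Atom.src], ?_⟩
      rw [hdisk]
      exact hl1
    · refine (topsIn_cups hK g u [] hug (by simp [trace])).append (.append (.singleton ?_) hl2)
      rw [hdisk]
      exact hall
    · rw [hl4, List.map_cons, List.prod_cons]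
      simp only [winv, ← FreeGroup.mul_mk, ← FreeGroup.inv_mk]
      group
    · rw [diskList_append, diskList_append, diskList_noDisk (noDisk_cups _ _ _), List.nil_append,
        List.map_append, hl5]
      simp [diskList, hug']

end Pictures

section DualPictures

variable {n : ℕ} {t : Fin n → Finset (ℤ × ℤ)} {b : Fin n → ℤ × ℤ} {r : Fin n → Word Gen}

theorem OnTileBoundary.rev {A : Finset (Fin n × (ℤ × ℤ))} {e : Edge} (h : OnTileBoundary t A e) :
    OnTileBoundary t A e.rev := by
  obtain ⟨q, hq, h⟩ := h
  refine ⟨q, hq, ?_⟩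
  rw [Edge.rightSquare_rev, Edge.leftSquare_rev]
  tauto

/-- The planar dual of a tiling of a region with connected complement. -/
theorem exists_isDualPicture (ht : ∀ i, EdgeConn (t i : Set (ℤ × ℤ))) (ht' : ∀ i, (t i).Nonempty)
    (hr : ∀ i, IsBoundaryWord (t i) (b i) (r i)) {Γ : Finset (ℤ × ℤ)}
    (hΓ : EdgeConn (Γ : Set (ℤ × ℤ))ᶜ) {p : ℤ × ℤ} {w : Word Gen} (hw : IsBoundaryWord Γ p w)
    {A : Finset (Fin n × (ℤ × ℤ))} (hA : IsTiling t Γ A) :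
    ∃ B : Picture r, B.word = w ∧ IsDualPicture t b A p B := by
  -- Keeping every path in this set yields the first condition on a dual picture: its arcs are dual
  -- to tile edges only.
  set K : Set Edge := {e | OnTileBoundary t A e}
  have hK : ∀ e ∈ K, e.rev ∈ K := fun e he => OnTileBoundary.rev he
  obtain ⟨hw1, hw2, hw3⟩ := hw
  have hwK : ∀ e ∈ trace p w, e ∈ K := by
    intro e he
    obtain ⟨h1, h2⟩ := (hw3 e).1 he
    obtain ⟨q, ⟨hq, hqe⟩, -⟩ := hA.2 _ h1
    exact ⟨q, hq, fun h => h2 (hA.1 q hq _ (h.1 hqe))⟩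
  have henc : Encloses t K A Γ p w := by
    refine ⟨hA, fun q hq e h1 h2 => ⟨q, hq, fun h => h2 (h.1 h1)⟩,
      hΓ.avoiding fun e he _ h => absurd ((hw3 e).1 he).1 h, hw1, hw2, hwK,
      fun e he => ((hw3 e).1 he).2, fun e h1 h2 => (hw3 e).2 ⟨h1, h2⟩⟩
  obtain ⟨L, hL1, hL2, hL3, hL4⟩ := henc.exists_filling ht ht' hr hK
  have hLr : ∀ x ∈ L, (∀ e ∈ trace p (x.1 ++ r x.2), e ∈ K) ∧
      endpoint (endpoint p x.1) (r x.2) = endpoint p x.1 := by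
    intro x hx
    have hq := (hL4 _).1 (List.mem_map_of_mem hx)
    have hend : b x.2 + (endpoint p x.1 - b x.2) = endpoint p x.1 := by abel
    obtain ⟨h1, -, h2⟩ := isBoundaryWord_translate (hr x.2) (endpoint p x.1 - b x.2)
    rw [hend] at h1 h2
    refine ⟨fun e he => ?_, h1⟩
    rw [trace_append] at he
    rcases List.mem_append.1 he with he | he
    · exact hL2 x hx e he
    · obtain ⟨h3, h4⟩ := (h2 e).1 he
      exact ⟨_, hq, fun h => h4 (h.1 h3)⟩
  obtain ⟨l, u, hl1, hl2, hl3, hl4, hl5⟩ :=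
    exists_path_of_conjugates hK L hLr [] (by simp [trace]) rfl
  rw [← FreeGroup.one_eq_mk, one_mul, ← hL1] at hl4
  -- The product of conjugates and `w` are freely equal. Caps lead down to a common reduct `z`, cups
  -- lead up to `w`, and no disk is added.
  obtain ⟨z, hz1, hz2⟩ := FreeGroup.Red.exact.1 hl4
  obtain ⟨-, ⟨m, hm1, hm2, hm3⟩, -⟩ := exists_path_of_red (r := r) hz1 hl3
  obtain ⟨-, -, m', hm1', hm2', hm3'⟩ := exists_path_of_red (r := r) hz2 hwK
  have hdl : diskList (l ++ (m ++ m')) = diskList l := by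
    rw [diskList_append, diskList_append, diskList_noDisk hm2, diskList_noDisk hm2']
    simp
  have hpos : (diskList l).map (fun d => (d.1, endpoint p d.2.2 - b d.1)) =
      L.map fun x => (x.2, endpoint p x.1 - b x.2) := by
    have := congrArg (List.map fun y : Fin n × Bool × (ℤ × ℤ) => (y.1, y.2.2 - b y.1)) hl5
    simpa [Function.comp_def] using this
  refine ⟨⟨l ++ (m ++ m'), w, isPath_append hl1 (isPath_append hm1 hm1')⟩, rfl,
    hl2.append (hm3.append hm3'), fun d hd => ?_, ?_, fun q => ?_⟩
  · simp only [hdl] at hd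
    have h1 := List.mem_map_of_mem (f := fun d => (d.1, d.2.1, endpoint p d.2.2)) hd
    rw [hl5, List.mem_map] at h1
    obtain ⟨x, -, hx⟩ := h1
    exact (congrArg (fun y : Fin n × Bool × (ℤ × ℤ) => y.2.1) hx).symm
  · simp only [hdl, hpos]
    exact hL3
  · simp only [hdl, hpos]
    exact hL4 q

/-! ### Counting the disks of a dual picture -/

theorem diskChain_eq_sum_diskList {α ι : Type*} (l : List (Step α ι)) :
    diskChain l = ((diskList l).map fun d => Finsupp.single d.1 (if d.2.1 then (1 : ℤ) else -1)).sum := by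
  induction l with
  | nil => rfl
  | cons s l ih =>
    rw [diskChain_cons, ih, ← List.singleton_append (l := l), diskList_append, List.map_append,
      List.sum_append]
    congr 1
    obtain ⟨u, A, v⟩ := s
    cases A <;> simp [diskList, Step.chain]

/-- All signs are positive, and the developed positions enumerate the tiles of `A` without
repetition, so the sum over disks is a sum over tiles. -/
theorem IsDualPicture.diskChain {A : Finset (Fin n × (ℤ × ℤ))} {p : ℤ × ℤ} {B : Picture r}
    (h : IsDualPicture t b A p B) : diskChain B.steps = tileSum A := by
  obtain ⟨-, h1, h2, h3⟩ := h
  classical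
  have hA : A = ((diskList B.steps).map fun d => (d.1, endpoint p d.2.2 - b d.1)).toFinset := by
    ext q
    rw [List.mem_toFinset, h3]
  have h4 : TilePictures.diskChain B.steps = ∑ q ∈ A, Finsupp.single q.1 (1 : ℤ) := by
    rw [hA, List.sum_toFinset _ h2, diskChain_eq_sum_diskList, List.map_map]
    congr 1
    refine List.map_congr_left fun d hd => ?_
    simp [h1 d hd]
  rw [h4, tileSum]
  ext i
  simp [Finsupp.finsetSum_apply, Finsupp.single_apply, tileCount]

end DualPictures

/-! ### Regions homeomorphic to a disk -/

/-- The open ball is homeomorphic to the plane, where complements of countable sets are connected.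
The remaining points of the closed ball are limits of the open ball minus `C`, since the complement
of `C` is dense. -/
theorem isPreconnected_closedBall_diff_countable {C : Set (EuclideanSpace ℝ (Fin 2))}
    (hC : C.Countable) :
    IsPreconnected (Metric.closedBall (0 : EuclideanSpace ℝ (Fin 2)) 1 \ C) := by
  set φ := OpenPartialHomeomorph.univUnitBall (E := EuclideanSpace ℝ (Fin 2))
  have hsource : ∀ x, x ∈ φ.source := fun _ => trivial
  have hinj : Function.Injective φ := fun x y h => φ.injOn (hsource x) (hsource y) h
  have hrank : 1 < Module.rank ℝ (EuclideanSpace ℝ (Fin 2)) := by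
    rw [← Module.finrank_eq_rank]; simp
  have h1 : IsPreconnected (φ '' (φ ⁻¹' C)ᶜ) := by
    refine (((hC.preimage hinj).isConnected_compl_of_one_lt_rank hrank).isPreconnected).image _ ?_
    have := φ.continuousOn
    exact this.mono fun x _ => hsource x
  have h2 : φ '' (φ ⁻¹' C)ᶜ = Metric.ball 0 1 ∩ Cᶜ := by
    ext x
    constructor
    · rintro ⟨y, hy, rfl⟩
      exact ⟨φ.map_source (hsource y), hy⟩
    · rintro ⟨hx, hxC⟩
      have : φ (φ.symm x) = x := φ.right_inv hx
      exact ⟨φ.symm x, by simpa [this] using hxC, this⟩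
  rw [h2] at h1
  refine h1.subset_closure (fun x hx => ⟨Metric.ball_subset_closedBall hx.1, hx.2⟩) fun x hx => ?_
  have h3 := (hC.dense_compl ℝ).open_subset_closure_inter
    (Metric.isOpen_ball (x := (0 : EuclideanSpace ℝ (Fin 2))) (ε := 1))
  have h4 := closure_minimal h3 isClosed_closure
  rw [closure_ball _ one_ne_zero] at h4
  exact h4 hx.1

theorem IsDisk.isPreconnected_diff_countable {S : Finset (ℤ × ℤ)} (hS : IsDisk S)
    {Z : Set (ℝ × ℝ)} (hZ : Z.Countable) :
    IsPreconnected ((⋃ c ∈ S, square c : Set (ℝ × ℝ)) \ Z) := by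
  obtain ⟨h⟩ := hS
  set X : Set (ℝ × ℝ) := ⋃ c ∈ S, square c
  have hC : (Subtype.val '' (h '' (Subtype.val ⁻¹' Z))).Countable :=
    ((hZ.preimage Subtype.val_injective).image _).image _
  have h1 := isPreconnected_closedBall_diff_countable hC
  have h2 : Metric.closedBall (0 : EuclideanSpace ℝ (Fin 2)) 1 \
      (Subtype.val '' (h '' (Subtype.val ⁻¹' Z))) = Subtype.val '' (h '' (Subtype.val ⁻¹' Z))ᶜ := by
    ext x
    constructor
    · rintro ⟨hx, hx'⟩
      exact ⟨⟨x, hx⟩, fun h' => hx' ⟨_, h', rfl⟩, rfl⟩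
    · rintro ⟨y, hy, rfl⟩
      refine ⟨y.2, ?_⟩
      rintro ⟨z, hz, hzy⟩
      rw [Subtype.val_injective hzy] at hz
      exact hy hz
  rw [h2, Topology.IsInducing.subtypeVal.isPreconnected_image] at h1
  have h3 := h1.image (fun y => (h.symm y : ℝ × ℝ)) (by fun_prop)
  convert h3 using 1
  ext x
  constructor
  · rintro ⟨hx, hx'⟩
    refine ⟨h ⟨x, hx⟩, ?_, by simp⟩
    rintro ⟨y, hy, hxy⟩
    rw [h.injective hxy] at hy
    exact hx' hy
  · rintro ⟨y, hy, rfl⟩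
    exact ⟨(h.symm y).2, fun hx => hy ⟨h.symm y, hx, by simp⟩⟩

theorem IsDisk.nonempty {S : Finset (ℤ × ℤ)} (hS : IsDisk S) : S.Nonempty := by
  obtain ⟨h⟩ := hS
  have := (h.symm ⟨0, by simp⟩).2
  simp only [Set.mem_iUnion] at this
  obtain ⟨c, hc, -⟩ := this
  exact ⟨c, hc⟩

theorem mem_square {c : ℤ × ℤ} {z : ℝ × ℝ} : z ∈ square c ↔
    ((c.1 : ℝ) ≤ z.1 ∧ z.1 ≤ c.1 + 1) ∧ ((c.2 : ℝ) ≤ z.2 ∧ z.2 ≤ c.2 + 1) := Iff.rfl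

theorem isClosed_square (c : ℤ × ℤ) : IsClosed (square c) := isClosed_Icc.prod isClosed_Icc

/-- Applied to both coordinates of a common point of two squares: they coincide, share an edge, or
meet at a lattice point. -/
theorem eq_or_of_mem_Icc {i j : ℤ} {x : ℝ} (h1 : (i : ℝ) ≤ x) (h2 : x ≤ i + 1) (h3 : (j : ℝ) ≤ x)
    (h4 : x ≤ j + 1) : i = j ∨ ((j = i + 1 ∨ j = i - 1) ∧ ∃ k : ℤ, x = k) := by
  have h5 : (i : ℝ) ≤ j + 1 := h1.trans h4
  have h6 : (j : ℝ) ≤ i + 1 := h3.trans h2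
  have h5' : i ≤ j + 1 := by exact_mod_cast h5
  have h6' : j ≤ i + 1 := by exact_mod_cast h6
  have h7 : i = j ∨ j = i + 1 ∨ j = i - 1 := by omega
  rcases h7 with rfl | rfl | rfl
  · exact Or.inl rfl
  · push_cast at h3
    exact Or.inr ⟨Or.inl rfl, i + 1, by push_cast; linarith⟩
  · push_cast at h4
    exact Or.inr ⟨Or.inr rfl, i, by linarith⟩

/-- A disk of squares is edge-connected. -/
theorem IsDisk.edgeConn {S : Finset (ℤ × ℤ)} (hS : IsDisk S) : EdgeConn (S : Set (ℤ × ℤ)) := by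
  classical
  intro Q hQ a ha b hb haQ
  by_contra hbQ
  -- With the lattice points removed, distinct squares can only meet along a common edge. The
  -- squares in `Q` and those not in `Q` form two closed sets covering a connected space, so they
  -- have a common point.
  set Z : Set (ℝ × ℝ) := Set.range fun c : ℤ × ℤ => ((c.1 : ℝ), (c.2 : ℝ))
  have hpre := hS.isPreconnected_diff_countable (Set.countable_range _ : Z.Countable)
  rw [isPreconnected_closed_iff] at hpre
  have hcenter : ∀ c ∈ S, (((c.1 : ℝ) + 1 / 2, (c.2 : ℝ) + 1 / 2) : ℝ × ℝ) ∈
      (⋃ c ∈ S, square c : Set (ℝ × ℝ)) \ Z := by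
    intro c hc
    refine ⟨Set.mem_biUnion hc ?_, ?_⟩
    · rw [mem_square]; constructor <;> constructor <;> simp only <;> linarith
    · rintro ⟨d, hd⟩
      have h1 : (d.1 : ℝ) = c.1 + 1 / 2 := congrArg Prod.fst hd
      have h2 : ((2 * d.1 : ℤ) : ℝ) = ((2 * c.1 + 1 : ℤ) : ℝ) := by push_cast; linarith
      have h3 : 2 * d.1 = 2 * c.1 + 1 := by exact_mod_cast h2
      omega
  have hclosed : ∀ T : Finset (ℤ × ℤ), IsClosed (⋃ c ∈ T, square c) := fun T =>
    T.finite_toSet.isClosed_biUnion fun c _ => isClosed_square c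
  have hmem : ∀ c : ℤ × ℤ, (((c.1 : ℝ) + 1 / 2, (c.2 : ℝ) + 1 / 2) : ℝ × ℝ) ∈ square c := by
    intro c
    rw [mem_square]; constructor <;> constructor <;> simp only <;> linarith
  obtain ⟨z, ⟨hzX, hzZ⟩, hz1, hz2⟩ := hpre (⋃ c ∈ S.filter (· ∈ Q), square c)
    (⋃ c ∈ S.filter (· ∉ Q), square c) (hclosed _) (hclosed _)
    (by
      rintro z ⟨hz, -⟩
      simp only [Set.mem_iUnion] at hz
      obtain ⟨c, hc, hzc⟩ := hz
      by_cases h : c ∈ Q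
      · exact Or.inl (Set.mem_biUnion (Finset.mem_filter.2 ⟨hc, h⟩) hzc)
      · exact Or.inr (Set.mem_biUnion (Finset.mem_filter.2 ⟨hc, h⟩) hzc))
    ⟨_, hcenter a ha, Set.mem_biUnion (Finset.mem_filter.2 ⟨ha, haQ⟩) (hmem a)⟩
    ⟨_, hcenter b hb, Set.mem_biUnion (Finset.mem_filter.2 ⟨hb, hbQ⟩) (hmem b)⟩
  simp only [Set.mem_iUnion, Finset.mem_filter] at hz1 hz2
  obtain ⟨⟨i, j⟩, ⟨hc, hcQ⟩, ⟨hi1, hi2⟩, hj1, hj2⟩ := hz1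
  obtain ⟨⟨k, l⟩, ⟨hd, hdQ⟩, ⟨hk1, hk2⟩, hl1, hl2⟩ := hz2
  have hstep := fun e : Edge => fun h1 h2 h3 => hQ e h1 h2 (by simp) (by simp) h3
  simp only at hi1 hi2 hj1 hj2 hk1 hk2 hl1 hl2
  rcases eq_or_of_mem_Icc hi1 hi2 hk1 hk2 with rfl | ⟨h1, m, hm⟩ <;>
    rcases eq_or_of_mem_Icc hj1 hj2 hl1 hl2 with rfl | ⟨h2, m', hm'⟩
  · exact hdQ hcQ
  · rcases h2 with rfl | rfl
    · have := hstep ((i + 1, j + 1), (.x, false))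
      simp only [Edge.leftSquare, Edge.rightSquare, add_sub_cancel_right] at this
      exact hdQ (this hc hd hcQ)
    · exact hdQ (hstep ((i, j), (.x, true)) hc hd hcQ)
  · rcases h1 with rfl | rfl
    · have := hstep ((i + 1, j), (.y, true))
      simp only [Edge.leftSquare, Edge.rightSquare, add_sub_cancel_right] at this
      exact hdQ (this hc hd hcQ)
    · have := hstep ((i, j + 1), (.y, false))
      simp only [Edge.leftSquare, Edge.rightSquare, add_sub_cancel_right] at this
      exact hdQ (this hc hd hcQ)
  · exact hzZ ⟨(m, m'), Prod.ext hm.symm hm'.symm⟩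

/-! ### Continuous logarithms, angles, and the complement of a disk -/

/-- The vector from the centre of the square `o` to a point of the plane, as a complex number. -/
noncomputable def fromCentre (o : ℤ × ℤ) (z : ℝ × ℝ) : ℂ :=
  ⟨z.1 - (o.1 + 1 / 2), z.2 - (o.2 + 1 / 2)⟩

theorem continuous_fromCentre (o : ℤ × ℤ) : Continuous (fromCentre o) := by
  have : fromCentre o = fun z : ℝ × ℝ => ((z.1 - (o.1 + 1 / 2) : ℝ) : ℂ) +
      ((z.2 - (o.2 + 1 / 2) : ℝ) : ℂ) * Complex.I := by
    ext z
    apply Complex.ext <;> simp [fromCentre]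
  rw [this]
  fun_prop

theorem fromCentre_ne_zero {o c : ℤ × ℤ} (hc : c ≠ o) {z : ℝ × ℝ} (hz : z ∈ square c) :
    fromCentre o z ≠ 0 := by
  intro h
  have h1 : z.1 = o.1 + 1 / 2 := sub_eq_zero.1 (congrArg Complex.re h)
  have h2 : z.2 = o.2 + 1 / 2 := sub_eq_zero.1 (congrArg Complex.im h)
  obtain ⟨⟨h3, h4⟩, h5, h6⟩ := mem_square.1 hz
  rw [h1] at h3 h4
  rw [h2] at h5 h6
  have key : ∀ i j : ℤ, (i : ℝ) ≤ j + 1 / 2 → (j : ℝ) + 1 / 2 ≤ i + 1 → i = j := by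
    intro i j h h'
    have h7 : (i : ℝ) < ((j + 1 : ℤ) : ℝ) := by push_cast; linarith
    have h8 : (j : ℝ) < ((i + 1 : ℤ) : ℝ) := by push_cast; linarith
    rw [Int.cast_lt] at h7 h8
    omega
  exact hc (Prod.ext (key _ _ h3 h4) (key _ _ h5 h6))

/-- On a disk that does not contain the square `o` there is a continuous logarithm of the distance
vector from the centre of `o`. -/
theorem IsDisk.exists_log {S : Finset (ℤ × ℤ)} (hS : IsDisk S) {o : ℤ × ℤ} (ho : o ∉ S) :
    ∃ g : ℝ × ℝ → ℂ, ContinuousOn g (⋃ c ∈ S, square c) ∧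
      ∀ z ∈ (⋃ c ∈ S, square c : Set (ℝ × ℝ)), Complex.exp (g z) = fromCentre o z := by
  classical
  obtain ⟨h⟩ := hS
  set X : Set (ℝ × ℝ) := ⋃ c ∈ S, square c with hX
  have hne : ∀ z ∈ X, fromCentre o z ≠ 0 := by
    intro z hz
    simp only [hX, Set.mem_iUnion] at hz
    obtain ⟨c, hc, hzc⟩ := hz
    exact fromCentre_ne_zero (by rintro rfl; exact ho hc) hzc
  -- The radial retraction onto the closed disk extends the map to the whole plane, where it lifts
  -- through the covering `exp`.
  let ρ : EuclideanSpace ℝ (Fin 2) → Metric.closedBall (0 : EuclideanSpace ℝ (Fin 2)) 1 :=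
    fun x => ⟨(max 1 ‖x‖)⁻¹ • x, by
      rw [mem_closedBall_zero_iff, norm_smul, norm_inv, Real.norm_of_nonneg (by positivity)]
      exact inv_mul_le_one_of_le₀ (le_max_right _ _) (by positivity)⟩
  have hρ : Continuous ρ := by
    have h1 : Continuous fun x : EuclideanSpace ℝ (Fin 2) => max 1 ‖x‖ := by fun_prop
    have h2 : ∀ x : EuclideanSpace ℝ (Fin 2), max 1 ‖x‖ ≠ 0 := fun x => by positivity
    exact Continuous.subtype_mk ((h1.inv₀ h2).smul continuous_id) _
  have hρ' : ∀ x : Metric.closedBall (0 : EuclideanSpace ℝ (Fin 2)) 1, ρ x = x := by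
    intro x
    apply Subtype.ext
    have : ‖(x : EuclideanSpace ℝ (Fin 2))‖ ≤ 1 := mem_closedBall_zero_iff.1 x.2
    simp [ρ, max_eq_left this]
  let f : C(EuclideanSpace ℝ (Fin 2), ℂ) :=
    ⟨fun x => fromCentre o (h.symm (ρ x)), (continuous_fromCentre o).comp
      (continuous_subtype_val.comp (h.symm.continuous.comp hρ))⟩
  have hf : ∀ x, f x ∈ ({0}ᶜ : Set ℂ) := fun x => hne _ (h.symm (ρ x)).2
  obtain ⟨F, ⟨-, hF⟩, -⟩ := Complex.isCoveringMapOn_exp.existsUnique_continuousMap_lifts f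
    (a₀ := 0) (e₀ := Complex.log (f 0)) (Complex.exp_log (hf 0)) hf
  refine ⟨fun z => if hz : z ∈ X then F (h ⟨z, hz⟩ : EuclideanSpace ℝ (Fin 2)) else 0, ?_, ?_⟩
  · rw [continuousOn_iff_continuous_domRestrict]
    have : X.domRestrict (fun z => if hz : z ∈ X then F (h ⟨z, hz⟩ : EuclideanSpace ℝ (Fin 2)) else 0) =
        fun z : X => F (h z : EuclideanSpace ℝ (Fin 2)) := by
      ext z
      simp
    rw [this]
    fun_prop
  · intro z hz
    simp only [hz, dif_pos]
    have := congrFun hF (h ⟨z, hz⟩ : EuclideanSpace ℝ (Fin 2))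
    simp only [Function.comp_apply] at this
    rw [this]
    simp [f, hρ']

/-- A lattice point as a point of the plane. -/
def latticePoint (v : ℤ × ℤ) : ℝ × ℝ := (v.1, v.2)

/-- The angle (times the imaginary unit) under which an edge is seen from the centre of `o`. -/
noncomputable def edgeAngle (o : ℤ × ℤ) (e : Edge) : ℂ :=
  Complex.log (fromCentre o (latticePoint (e.1 + letterVec e.2)) / fromCentre o (latticePoint e.1))

/-- The points of an edge. -/
noncomputable def edgePoint (e : Edge) (s : ℝ) : ℝ × ℝ :=
  (e.1.1 + s * (letterVec e.2).1, e.1.2 + s * (letterVec e.2).2)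

theorem edgePoint_zero (e : Edge) : edgePoint e 0 = latticePoint e.1 := by
  simp [edgePoint, latticePoint]

theorem edgePoint_one (e : Edge) : edgePoint e 1 = latticePoint (e.1 + letterVec e.2) := by
  simp [edgePoint, latticePoint]

theorem edgePoint_mem (e : Edge) {s : ℝ} (h0 : 0 ≤ s) (h1 : s ≤ 1) :
    edgePoint e s ∈ square e.rightSquare := by
  obtain ⟨⟨i, j⟩, a, ε⟩ := e
  rw [mem_square]
  cases a <;> cases ε <;> simp [edgePoint, letterVec, Edge.rightSquare] <;> grind

theorem int_sub_half_ne_zero (i j : ℤ) : (i : ℝ) - (j + 1 / 2) ≠ 0 := by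
  intro h
  have h2 : ((2 * i : ℤ) : ℝ) = ((2 * j + 1 : ℤ) : ℝ) := by push_cast; linarith
  have h3 : 2 * i = 2 * j + 1 := by exact_mod_cast h2
  omega

theorem fromCentre_latticePoint_ne_zero (o v : ℤ × ℤ) : fromCentre o (latticePoint v) ≠ 0 :=
  fun h => int_sub_half_ne_zero _ _ (congrArg Complex.re h)

/-- The line through an edge misses the centre of a square, whose coordinates are half-integers. So
the quotient is 1 at `s = 0` and has nonzero imaginary part otherwise, and its principal logarithm
is continuous along the edge. -/
theorem edgePoint_div_mem_slitPlane (o : ℤ × ℤ) (e : Edge) (s : ℝ) :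
    fromCentre o (edgePoint e s) / fromCentre o (latticePoint e.1) ∈ Complex.slitPlane := by
  have hne := fromCentre_latticePoint_ne_zero o e.1
  by_cases hs : s = 0
  · rw [hs, edgePoint_zero, div_self hne]
    exact Complex.one_mem_slitPlane
  rw [Complex.mem_slitPlane_iff]
  right
  have hN := (Complex.normSq_pos.2 hne).ne'
  rw [Complex.div_im, ← sub_div]
  refine div_ne_zero ?_ hN
  obtain ⟨⟨i, j⟩, a, ε⟩ := e
  have hi := int_sub_half_ne_zero i o.1
  have hj := int_sub_half_ne_zero j o.2
  simp only [fromCentre, edgePoint, latticePoint]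
  set x := (i : ℝ) - (o.1 + 1 / 2) with hx
  set y := (j : ℝ) - (o.2 + 1 / 2) with hy
  have key : ∀ k l : ℝ, ((j : ℝ) + s * l - (o.2 + 1 / 2)) * x - (i + s * k - (o.1 + 1 / 2)) * y =
      s * (l * x - k * y) := by
    intro k l
    rw [hx, hy]; ring
  rw [key]
  refine mul_ne_zero hs ?_
  cases a <;> cases ε <;> simpa [letterVec]

theorem edgeAngle_rev (o : ℤ × ℤ) (e : Edge) : edgeAngle o e.rev = -edgeAngle o e := by
  have h : e.rev.1 + letterVec e.rev.2 = e.1 := by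
    simp [Edge.rev, letterVec_inv]
  have h1 := edgePoint_div_mem_slitPlane o e 1
  rw [edgePoint_one] at h1
  rw [edgeAngle, h, edgeAngle, ← Complex.log_inv _ (Complex.slitPlane_arg_ne_pi h1), inv_div]
  rfl

/-- The angle of an edge is the difference of the values of a continuous logarithm. -/
theorem edgeAngle_eq {o : ℤ × ℤ} {e : Edge} {g : ℝ × ℝ → ℂ}
    (hg : ContinuousOn g (square e.rightSquare)) {κ : ℂ}
    (hexp : ∀ z ∈ square e.rightSquare, Complex.exp (g z) = κ * fromCentre o z) :
    edgeAngle o e = g (latticePoint (e.1 + letterVec e.2)) - g (latticePoint e.1) := by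
  have hcont : Continuous (edgePoint e) := by unfold edgePoint; fun_prop
  have hmaps : Set.MapsTo (edgePoint e) (Set.Icc 0 1) (square e.rightSquare) :=
    fun s hs => edgePoint_mem e hs.1 hs.2
  have h0 : (0 : ℝ) ∈ Set.Icc (0 : ℝ) 1 := by simp
  have h1 : (1 : ℝ) ∈ Set.Icc (0 : ℝ) 1 := by simp
  have hne := fromCentre_latticePoint_ne_zero o e.1
  -- Two lifts of the same path through `exp` that agree at `s = 0`. The factor `κ` cancels in the
  -- quotient, so `g` may be a logarithm of any multiple of the vector.
  have key : Set.EqOn (fun s => g (edgePoint e s))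
      (fun s => Complex.log (fromCentre o (edgePoint e s) / fromCentre o (latticePoint e.1)) +
        g (latticePoint e.1)) (Set.Icc (0 : ℝ) 1) := by
    refine Complex.isCoveringMap_exp.eqOn_of_comp_eqOn isPreconnected_Icc
      (hg.comp hcont.continuousOn hmaps) ?_ ?_ h0 ?_
    · refine (Continuous.continuousOn ?_).add continuousOn_const
      refine continuous_iff_continuousAt.2 fun s => ContinuousAt.clog ?_
        (edgePoint_div_mem_slitPlane o e s)
      exact (((continuous_fromCentre o).comp hcont).div_const _).continuousAt
    · intro s hs
      apply Subtype.ext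
      simp only [Function.comp_apply]
      rw [hexp _ (hmaps hs), Complex.exp_add,
        Complex.exp_log (Complex.slitPlane_ne_zero (edgePoint_div_mem_slitPlane o e s)),
        ← edgePoint_zero, hexp _ (hmaps h0), edgePoint_zero]
      field_simp
    · simp only [edgePoint_zero, div_self hne, Complex.log_one, zero_add]
  have := key h1
  simp only [edgePoint_one] at this
  rw [this, add_sub_cancel_right]
  rfl

/-- The angle under which the clockwise boundary of a square is seen. -/
noncomputable def squareAngle (o c : ℤ × ℤ) : ℂ :=
  edgeAngle o ((c.1, c.2 + 1), (.x, true)) + edgeAngle o ((c.1 + 1, c.2), (.x, false)) +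
    edgeAngle o (c, (.y, true)) + edgeAngle o ((c.1 + 1, c.2 + 1), (.y, false))

/-- Seen from its own centre, each edge of the square is a clockwise quarter turn, so the total is
`-2πi`. -/
theorem squareAngle_self (o : ℤ × ℤ) : squareAngle o o ≠ 0 := by
  have h : ∀ v w : ℤ × ℤ, ∀ a, v + letterVec a = w →
      fromCentre o (latticePoint w) = -Complex.I * fromCentre o (latticePoint v) →
      edgeAngle o (v, a) = -(Real.pi / 2 * Complex.I) := by
    intro v w a hw hq
    rw [edgeAngle, hw, hq, mul_div_cancel_right₀ _ (fromCentre_latticePoint_ne_zero o v),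
      Complex.log_neg_I]
    ring
  rw [squareAngle, h _ (o.1 + 1, o.2 + 1) _ (by simp [letterVec]),
    h _ (o.1, o.2) _ (by simp [letterVec]), h _ (o.1, o.2 + 1) _ (by ext <;> simp [letterVec]),
    h _ (o.1 + 1, o.2) _ (by simp [letterVec])]
  · intro h0
    have : (Real.pi : ℂ) * Complex.I = 0 := by linear_combination (-1 / 2) * h0
    simp [Real.pi_ne_zero] at this
  all_goals
    apply Complex.ext <;> simp [fromCentre, latticePoint]
    ring

theorem squareAngle_eq_zero_of_log {o c : ℤ × ℤ} {g : ℝ × ℝ → ℂ}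
    (hg : ContinuousOn g (square c)) {κ : ℂ}
    (hexp : ∀ z ∈ square c, Complex.exp (g z) = κ * fromCentre o z) : squareAngle o c = 0 := by
  have key : ∀ e : Edge, e.rightSquare = c →
      edgeAngle o e = g (latticePoint (e.1 + letterVec e.2)) - g (latticePoint e.1) := by
    rintro e rfl
    exact edgeAngle_eq hg hexp
  obtain ⟨i, j⟩ := c
  rw [squareAngle, key _ (by simp [Edge.rightSquare]), key _ (by simp [Edge.rightSquare]),
    key _ (by simp [Edge.rightSquare]), key _ (by simp [Edge.rightSquare])]
  simp [letterVec]
  ring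

/-- Let `m` be the vector from the centre of `o` to that of `c`. The square `c` lies in the open
half-plane of vectors with positive inner product with `m`, so the principal logarithm of the
quotient by `m` is continuous on it, and the four angles telescope. -/
theorem squareAngle_eq_zero {o c : ℤ × ℤ} (hc : c ≠ o) : squareAngle o c = 0 := by
  set m : ℂ := ⟨c.1 - o.1, c.2 - o.2⟩ with hm
  have hm0 : m ≠ 0 := by
    intro h
    have h1 : (c.1 : ℝ) - o.1 = 0 := congrArg Complex.re h
    have h2 : (c.2 : ℝ) - o.2 = 0 := congrArg Complex.im h
    exact hc (Prod.ext (by exact_mod_cast sub_eq_zero.1 h1) (by exact_mod_cast sub_eq_zero.1 h2))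
  have hslit : ∀ z ∈ square c, fromCentre o z / m ∈ Complex.slitPlane := by
    intro z hz
    obtain ⟨⟨h1, h2⟩, h3, h4⟩ := mem_square.1 hz
    rw [Complex.mem_slitPlane_iff]
    left
    rw [Complex.div_re, ← add_div]
    refine div_pos ?_ (Complex.normSq_pos.2 hm0)
    simp only [fromCentre, hm]
    obtain ⟨k, hk⟩ : ∃ k : ℤ, k = c.1 - o.1 := ⟨_, rfl⟩
    obtain ⟨l, hl⟩ : ∃ l : ℤ, l = c.2 - o.2 := ⟨_, rfl⟩
    have hk' : (k : ℝ) = c.1 - o.1 := by rw [hk]; push_cast; ring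
    have hl' : (l : ℝ) = c.2 - o.2 := by rw [hl]; push_cast; ring
    have hkl : k ≠ 0 ∨ l ≠ 0 := by
      by_contra! h
      exact hc (Prod.ext (by omega) (by omega))
    -- With `m = (k, l)`, the inner product is at least `k² + l² - (|k| + |l|) / 2`. For integers
    -- not both zero, `|n| ≤ n²` makes this positive.
    have hsq : ∀ n : ℤ, |(n : ℝ)| ≤ n * n := by
      intro n
      have h : |n| ≤ n * n := by
        rw [← abs_mul_abs_self n]
        rcases eq_or_ne n 0 with rfl | hn
        · simp
        · have := Int.one_le_abs hn
          nlinarith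
      exact_mod_cast h
    have hpos : 0 < |(k : ℝ)| + |(l : ℝ)| := by
      rcases hkl with h | h
      · have := abs_pos.2 (Int.cast_ne_zero (α := ℝ).2 h)
        positivity
      · have := abs_pos.2 (Int.cast_ne_zero (α := ℝ).2 h)
        positivity
    have hoff : ∀ n s : ℝ, -(1 / 2) ≤ s → s ≤ 1 / 2 → -(|n| / 2) ≤ s * n := by
      intro n s h h'
      have h5 : |s * n| ≤ 1 / 2 * |n| := by
        rw [abs_mul]
        exact mul_le_mul_of_nonneg_right (abs_le.2 ⟨h, h'⟩) (abs_nonneg n)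
      have := neg_abs_le (s * n)
      linarith
    have e1 := hoff k (z.1 - (c.1 + 1 / 2)) (by linarith) (by linarith)
    have e2 := hoff l (z.2 - (c.2 + 1 / 2)) (by linarith) (by linarith)
    have e3 := hsq k
    have e4 := hsq l
    rw [← hk', ← hl']
    have e5 : (z.1 - (o.1 + 1 / 2)) * k + (z.2 - (o.2 + 1 / 2)) * l =
        (k * k + l * l) + ((z.1 - (c.1 + 1 / 2)) * k + (z.2 - (c.2 + 1 / 2)) * l) := by
      linear_combination (-(k : ℝ)) * hk' - l * hl'
    rw [e5]
    linarith
  refine squareAngle_eq_zero_of_log (g := fun z => Complex.log (fromCentre o z / m)) (κ := m⁻¹)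
    ?_ fun z hz => ?_
  · exact ((continuous_fromCentre o).continuousOn.div_const _).clog hslit
  · rw [Complex.exp_log (Complex.slitPlane_ne_zero (hslit z hz)), div_eq_inv_mul]

/-- Reindexing by the shift is legitimate because the terms at which membership in `H` changes
vanish. It expresses the cancellation of edges shared by two squares of `H`. -/
theorem sum_shift_eq {H : Finset (ℤ × ℤ)} {u : ℤ × ℤ → ℂ} (d : ℤ × ℤ)
    (h : ∀ c, u c ≠ 0 → (c ∈ H ↔ c + d ∈ H)) : ∑ c ∈ H, u c = ∑ c ∈ H, u (c - d) := by
  refine Finset.sum_bij_ne_zero (fun c _ _ => c + d) (fun c hc hu => (h c hu).1 hc)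
    (fun c _ _ c' _ _ hcc => by simpa using hcc) (fun c hc hu => ⟨c - d, ?_, hu, by simp⟩)
    (fun c _ _ => by simp)
  exact (h _ hu).2 (by simpa using hc)

/-- The complement of a disk has no finite component. -/
theorem IsDisk.eq_empty_of_component {S H : Finset (ℤ × ℤ)} (hS : IsDisk S) (hSH : Disjoint S H)
    (hH : ∀ e : Edge, e.leftSquare ∉ S → e.rightSquare ∉ S →
      (e.leftSquare ∈ H ↔ e.rightSquare ∈ H)) : H = ∅ := by
  by_contra hne
  obtain ⟨o, ho⟩ := Finset.nonempty_iff_ne_empty.2 hne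
  have hoS : o ∉ S := Finset.disjoint_right.1 hSH ho
  obtain ⟨g, hg, hexp⟩ := hS.exists_log hoS
  -- The failure of `g` to measure the angle of `e`. It is odd under reversal and vanishes on every
  -- edge of a square of `S`, hence on all edges between `H` and its complement. Values of `g` off
  -- the disk are arbitrary but harmless.
  let φ : Edge → ℂ := fun e =>
    g (latticePoint (e.1 + letterVec e.2)) - g (latticePoint e.1) - edgeAngle o e
  have hrev : ∀ e : Edge, φ e.rev = -φ e := by
    intro e
    have h : e.rev.1 + letterVec e.rev.2 = e.1 := by simp [Edge.rev, letterVec_inv]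
    simp only [φ, h, edgeAngle_rev]
    simp only [Edge.rev]
    ring
  have hright : ∀ e : Edge, e.rightSquare ∈ S → φ e = 0 := by
    intro e he
    have hsub : square e.rightSquare ⊆ ⋃ c ∈ S, square c := Set.subset_biUnion_of_mem
      (u := square) (show e.rightSquare ∈ (S : Set (ℤ × ℤ)) from he)
    simp only [φ]
    rw [edgeAngle_eq (hg.mono hsub) (κ := 1) fun z hz => by rw [hexp z (hsub hz), one_mul]]
    ring
  have hleft : ∀ e : Edge, e.leftSquare ∈ S → φ e = 0 := by
    intro e he
    have := hright e.rev (by rwa [Edge.rightSquare_rev])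
    rw [hrev] at this
    simpa using this
  have hφ : ∀ e : Edge, φ e ≠ 0 → (e.rightSquare ∈ H ↔ e.leftSquare ∈ H) := fun e he =>
    (hH e (fun h => he (hleft e h)) fun h => he (hright e h)).symm
  have h1 := sum_shift_eq (H := H) (u := fun c => φ ((c.1, c.2 + 1), (.x, true))) (0, 1)
    (fun c hc => by
      have := hφ _ hc
      simpa [Edge.rightSquare, Edge.leftSquare, Prod.add_def] using this)
  have h2 := sum_shift_eq (H := H) (u := fun c => φ ((c.1 + 1, c.2 + 1), (.y, false))) (1, 0)
    (fun c hc => by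
      have := hφ _ hc
      simpa [Edge.rightSquare, Edge.leftSquare, Prod.add_def] using this)
  have h3 : ∀ c : ℤ × ℤ, φ ((c.1 + 1, c.2), (.x, false)) = -φ ((c.1, c.2), (.x, true)) := by
    rintro ⟨i, j⟩
    rw [← hrev]
    simp [Edge.rev, inv, letterVec]
  have h4 : ∀ c : ℤ × ℤ, φ (c, (.y, true)) = -φ ((c.1, c.2 + 1), (.y, false)) := by
    rintro ⟨i, j⟩
    rw [← hrev]
    simp [Edge.rev, inv, letterVec]
  have h5 : ∀ c : ℤ × ℤ, φ ((c.1, c.2 + 1), (.x, true)) + φ ((c.1 + 1, c.2), (.x, false)) +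
      φ (c, (.y, true)) + φ ((c.1 + 1, c.2 + 1), (.y, false)) = -squareAngle o c := by
    rintro ⟨i, j⟩
    simp [φ, squareAngle, letterVec]
    ring
  -- Summed over the boundaries of all squares of `H`, the inner edges cancel and the outer ones
  -- contribute zero. But `g` telescopes around each square, so the sum is also minus the total of
  -- the square angles, to which only `o` contributes.
  have h6 : ∑ c ∈ H, (φ ((c.1, c.2 + 1), (.x, true)) + φ ((c.1 + 1, c.2), (.x, false)) +
      φ (c, (.y, true)) + φ ((c.1 + 1, c.2 + 1), (.y, false))) = 0 := by
    simp only [Finset.sum_add_distrib, h3, h4, Finset.sum_neg_distrib]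
    rw [h1, h2]
    simp
  rw [Finset.sum_congr rfl fun c _ => h5 c, Finset.sum_eq_single_of_mem o ho
    fun c _ hc => by rw [squareAngle_eq_zero hc, neg_zero]] at h6
  exact squareAngle_self o (neg_eq_zero.1 h6)

theorem iff_of_forall_iff_succ {f : ℤ → Prop} (h : ∀ i, f i ↔ f (i + 1)) (i j : ℤ) :
    f i ↔ f j := by
  have key : ∀ i, f i ↔ f 0 := by
    intro i
    induction i using Int.induction_on with
    | zero => rfl
    | succ i ih => rw [← h, ih]
    | pred i ih => rw [h, sub_add_cancel, ih]
  rw [key i, key j]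

/-- The complement of a disk is edge-connected. -/
theorem IsDisk.edgeConn_compl {S : Finset (ℤ × ℤ)} (hS : IsDisk S) :
    EdgeConn (S : Set (ℤ × ℤ))ᶜ := by
  classical
  intro Q hQ a ha b hb haQ
  have hstep : ∀ e : Edge, e.leftSquare ∉ S → e.rightSquare ∉ S →
      (e.leftSquare ∈ Q ↔ e.rightSquare ∈ Q) := by
    intro e h1 h2
    refine ⟨hQ e h1 h2 (by simp) (by simp), ?_⟩
    have := hQ e.rev
    rw [Edge.leftSquare_rev, Edge.rightSquare_rev] at this
    exact this h2 h1 (by simp) (by simp)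
  -- Outside the box of radius `N` all squares are joined through far rows and columns. Whichever of
  -- `Q` and its complement misses these squares is, outside `S`, a finite union of components,
  -- hence empty.
  obtain ⟨N, hN⟩ := (S.image fun c => max |c.1| |c.2|).bddAbove
  have hN' : ∀ c : ℤ × ℤ, N < |c.1| ∨ N < |c.2| → c ∉ S := by
    intro c hc hcS
    have := hN (Finset.mem_coe.2 (Finset.mem_image_of_mem _ hcS))
    rw [max_le_iff] at this
    omega
  have hrow : ∀ j : ℤ, N < |j| → ∀ i i' : ℤ, ((i, j) ∈ Q ↔ (i', j) ∈ Q) := by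
    intro j hj
    refine iff_of_forall_iff_succ fun i => ?_
    have := hstep ((i + 1, j), (.y, true))
    simp only [Edge.leftSquare, Edge.rightSquare, add_sub_cancel_right] at this
    exact this (hN' _ (Or.inr hj)) (hN' _ (Or.inr hj))
  have hcol : ∀ i : ℤ, N < |i| → ∀ j j' : ℤ, ((i, j) ∈ Q ↔ (i, j') ∈ Q) := by
    intro i hi
    refine iff_of_forall_iff_succ fun j => ?_
    have := hstep ((i + 1, j + 1), (.x, false))
    simp only [Edge.leftSquare, Edge.rightSquare, add_sub_cancel_right] at this
    exact this (hN' _ (Or.inl hi)) (hN' _ (Or.inl hi))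
  have hfar : N < |(|N| + 1)| := by
    rw [abs_of_nonneg (by positivity)]
    have := le_abs_self N
    omega
  have hout : ∀ c : ℤ × ℤ, N < |c.1| ∨ N < |c.2| → (c ∈ Q ↔ (|N| + 1, |N| + 1) ∈ Q) := by
    rintro ⟨i, j⟩ (h | h)
    · exact (hcol i h j (|N| + 1)).trans (hrow _ hfar _ _)
    · exact (hrow j h i (|N| + 1)).trans (hcol _ hfar _ _)
  have hfin : ∀ R : Set (ℤ × ℤ), (∀ c ∈ R, ¬ (N < |c.1| ∨ N < |c.2|)) → R.Finite := by
    intro R hR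
    refine (((Set.finite_Icc (-N) N).prod (Set.finite_Icc (-N) N))).subset fun c hc => ?_
    have := hR c hc
    rw [not_or, not_lt, not_lt, abs_le, abs_le] at this
    exact ⟨this.1, this.2⟩
  have hcomp : ∀ R : Set (ℤ × ℤ), (∀ c ∈ R, ¬ (N < |c.1| ∨ N < |c.2|)) → (∀ c ∈ R, c ∉ S) →
      (∀ e : Edge, e.leftSquare ∉ S → e.rightSquare ∉ S →
        (e.leftSquare ∈ R ↔ e.rightSquare ∈ R)) → R = ∅ := by
    intro R h1 h2 h3
    have := hS.eq_empty_of_component (H := (hfin R h1).toFinset)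
      (Finset.disjoint_right.2 fun c hc => h2 c (by simpa using hc)) (by simpa using h3)
    simpa using this
  by_contra hbQ
  by_cases hq : (|N| + 1, |N| + 1) ∈ Q
  · have : {c | c ∉ S ∧ c ∉ Q} = ∅ := hcomp _ (fun c hc h => hc.2 ((hout c h).2 hq))
      (fun c hc => hc.1) fun e h1 h2 => by
        have := hstep e h1 h2
        simp only [Set.mem_ofPred_eq]
        tauto
    exact Set.eq_empty_iff_forall_notMem.1 this b ⟨hb, hbQ⟩
  · have : {c | c ∉ S ∧ c ∈ Q} = ∅ := hcomp _ (fun c hc h => hq ((hout c h).1 hc.2))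
      (fun c hc => hc.1) fun e h1 h2 => by
        have := hstep e h1 h2
        simp only [Set.mem_ofPred_eq]
        tauto
    exact Set.eq_empty_iff_forall_notMem.1 this a ⟨ha, haQ⟩

/-! ### The Hurewicz image -/

section HurewiczImage

variable {α ι : Type*} {r : ι → Word α}

theorem pictureChain_actCls (w : Word α) (σ : PictureGroup r) :
    pictureChain r (actCls w σ) = pictureChain r σ := by
  induction σ using Quotient.inductionOn with | _ D
  change Multiplicative.ofAdd (diskChain (cups ι [] w [] ++ pad w (winv w) D.steps)) =
    Multiplicative.ofAdd (diskChain D.steps)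
  rw [diskChain_append, diskChain_noDisk (noDisk_cups _ _ _), diskChain_pad, zero_add]

theorem hurewicz_single_smul (g : PresGroup r) (x : Pi2 r) :
    hurewicz r ((MonoidAlgebra.single g (1 : ℤ) : MonoidAlgebra ℤ (PresGroup r)) • x) =
      hurewicz r x := by
  obtain ⟨g, rfl⟩ := QuotientGroup.mk_surjective g
  obtain ⟨w, rfl⟩ := Quot.exists_rep g
  apply Subtype.ext
  have h := single_mk_smul w x
  change (pictureChain r (_ • x : Pi2 r).toMul.1).toAdd = (pictureChain r x.toMul.1).toAdd
  rw [← pictureChain_actCls w x.toMul.1, ← h]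
  rfl

/-- Group elements act trivially after `hurewicz`, so a group ring element acts through its
augmentation, an integer. -/
theorem hurewicz_smul_mem {K : AddSubgroup (H2 r)} {x : Pi2 r} (hx : hurewicz r x ∈ K)
    (a : MonoidAlgebra ℤ (PresGroup r)) : hurewicz r (a • x) ∈ K := by
  induction a using MonoidAlgebra.induction_linear with
  | zero => rw [zero_smul, map_zero]; exact K.zero_mem
  | add a b ha hb => rw [add_smul, map_add]; exact K.add_mem ha hb
  | single g k =>
    have h : (MonoidAlgebra.single g k : MonoidAlgebra ℤ (PresGroup r)) =
        k • MonoidAlgebra.single g (1 : ℤ) := by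
      rw [MonoidAlgebra.smul_single, smul_eq_mul, mul_one]
    rw [h, smul_assoc, map_zsmul, hurewicz_single_smul]
    exact K.zsmul_mem hx k

/-- This is why the module structure of `J` leaves no trace in homology: passing from the generated
subgroup to the generated submodule does not enlarge the image. -/
theorem map_hurewicz_span (s : Set (Pi2 r)) :
    (Submodule.span (MonoidAlgebra ℤ (PresGroup r)) s).toAddSubgroup.map (hurewicz r) =
      AddSubgroup.closure (hurewicz r '' s) := by
  apply le_antisymm
  · rintro _ ⟨x, hx, rfl⟩
    induction hx using Submodule.span_induction with
    | mem x hx => exact AddSubgroup.subset_closure ⟨x, hx, rfl⟩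
    | zero => rw [map_zero]; exact AddSubgroup.zero_mem _
    | add x y _ _ hx hy => rw [map_add]; exact AddSubgroup.add_mem _ hx hy
    | smul a x _ hx => exact hurewicz_smul_mem hx a
  · rw [AddSubgroup.closure_le]
    rintro _ ⟨x, hx, rfl⟩
    exact ⟨x, Submodule.subset_span hx, rfl⟩

theorem hurewicz_quotientPicture (B D : Picture r) (hw : D.word = B.word) :
    (hurewicz r (quotientPicture B D hw) : ι →₀ ℤ) = diskChain B.steps - diskChain D.steps := by
  change (pictureChain r (B.cls * D.cls⁻¹)).toAdd = _
  rw [map_mul, map_inv, sub_eq_add_neg]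
  rfl

end HurewiczImage

theorem H2_eq_top {ι : Type*} {r : ι → Word Gen} (hr : ∀ i, expSum (r i) = 0) : H2 r = ⊤ := by
  rw [LinearMap.ker_eq_top]
  refine LinearMap.ext fun z => ?_
  simp [cellBoundary, hr, Finsupp.linearCombination_apply]

/-- The image of `J` under the Hurewicz homomorphism consists of the relations between the tiles. -/
theorem map_subtype_hurewicz {n : ℕ} {t : Fin n → Finset (ℤ × ℤ)} {b : Fin n → ℤ × ℤ}
    {r : Fin n → Word Gen}
    (hdual : ∀ Γ, IsDisk Γ → ∃ p w, IsBoundaryWord Γ p w ∧ ∀ A, IsTiling t Γ A →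
      ∃ B : Picture r, B.word = w ∧ IsDualPicture t b A p B) :
    ((tilingSubmodule t b r).toAddSubgroup.map (hurewicz r)).map
      (H2 r).subtype.toAddMonoidHom = tileRelations t := by
  rw [tilingSubmodule, map_hurewicz_span, AddMonoidHom.map_closure, tileRelations]
  congr 1
  ext z
  constructor
  · rintro ⟨_, ⟨_, ⟨Γ, A, A', p, B, D, hw, hΓ, hA, hA', -, hB, hD, rfl⟩, rfl⟩, rfl⟩
    refine ⟨Γ, A, A', hΓ, hA, hA', ?_⟩
    rw [← hB.diskChain, ← hD.diskChain]
    exact hurewicz_quotientPicture B D hw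
  · rintro ⟨Γ, A, A', hΓ, hA, hA', rfl⟩
    -- Only this inclusion needs the existence of pictures. Basepoint and word are fixed before the
    -- tilings, so both pictures have the same boundary word.
    obtain ⟨p, w, hpw, h⟩ := hdual Γ hΓ
    obtain ⟨B, hBw, hB⟩ := h A hA
    obtain ⟨D, hDw, hD⟩ := h A' hA'
    refine ⟨_, ⟨quotientPicture B D (hDw.trans hBw.symm), ⟨Γ, A, A', p, B, D, hDw.trans hBw.symm, hΓ, hA, hA',
      by rwa [hBw], hB, hD, rfl⟩, rfl⟩, ?_⟩
    rw [← hB.diskChain, ← hD.diskChain]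
    exact hurewicz_quotientPicture B D (hDw.trans hBw.symm)

/-- The algebraic half of the argument, with all geometry isolated in `hdual`: the inclusion of `H2
r` into the chains is an isomorphism that carries `h(J)` onto `I`. -/
theorem tileCountingGroup_equiv {n : ℕ} {t : Fin n → Finset (ℤ × ℤ)} {b : Fin n → ℤ × ℤ}
    {r : Fin n → Word Gen} (hr : ∀ i, expSum (r i) = 0)
    (hdual : ∀ Γ, IsDisk Γ → ∃ p w, IsBoundaryWord Γ p w ∧ ∀ A, IsTiling t Γ A →
      ∃ B : Picture r, B.word = w ∧ IsDualPicture t b A p B) :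
    Nonempty (TileCountingGroup t ≃+
      H2 r ⧸ (tilingSubmodule t b r).toAddSubgroup.map (hurewicz r)) :=
  ⟨(QuotientAddGroup.congr _ _ (LinearEquiv.ofTop _ (H2_eq_top hr)).toAddEquiv
    (map_subtype_hurewicz hdual)).symm⟩

end TilePictures

/-- Let `t 0, …, t (n - 1)` be lattice tiles that are homeomorphic to a disk, with boundary words
`r i` read clockwise from basepoints `b i`. Then the tile counting group for all regions
homeomorphic to a disk is isomorphic to the quotient of `H₂` of the standard 2-complex of
`⟨x, y | r 0, …, r (n - 1)⟩` by the image of the submodule `J` under the Hurewicz homomorphism. -/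
theorem theorem1 {n : ℕ} (t : Fin n → Finset (ℤ × ℤ)) (ht : ∀ i, TilePictures.IsDisk (t i))
    (b : Fin n → ℤ × ℤ) (r : Fin n → TilePictures.Word TilePictures.Gen)
    (hr : ∀ i, TilePictures.IsBoundaryWord (t i) (b i) (r i)) :
    Nonempty (TilePictures.TileCountingGroup t ≃+
      TilePictures.H2 r ⧸
        (TilePictures.tilingSubmodule t b r).toAddSubgroup.map (TilePictures.hurewicz r)) := by
  have hconn := fun i => (ht i).edgeConn
  have hne := fun i => (ht i).nonempty
  refine TilePictures.tileCountingGroup_equiv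
    (fun i => TilePictures.expSum_eq_zero (hr i).1) fun Γ hΓ => ?_
  obtain ⟨p, w, hw⟩ :=
    TilePictures.exists_isBoundaryWord hΓ.nonempty hΓ.edgeConn hΓ.edgeConn_compl
  exact ⟨p, w, hw, fun A hA =>
    TilePictures.exists_isDualPicture hconn hne hr hΓ.edgeConn_compl hw hA⟩
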